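/- Let $(\Sigma,\mu)$ be a $\sigma$-finite measure space and $L_0$ the space of complex measurable functions on it (modulo a.e. equality). A Köthe space is an $L_\infty$-submodule $X$ of $L_0$ with a complete norm such that $\|f\|_X\le\|g\|_X$ whenever $f,g\in X$ and $|f|\le|g|$ a.e. Its Köthe dual is $X^*=\{g\in L_0:\ \|g\|_{X^*}=\sup_{\|f\|_X\le1}\int|fg|\,d\mu<\infty\}$. For a pair $(X_0,X_1)$ let $\mathcal F(X_0,X_1)$ be the Calderón space of bounded continuous functions $F$ from the strip $0\le\mathrm{Re}\,z\le1$ to $X_0+X_1$, analytic in its interior, such that for $j=0,1$ the map $t\mapsto F(j+it)$ is continuous into $X_j$ and tends to $0$ as $|t|\to\infty$, normed by $\|F\|=\max_{j}\sup_t\|F(j+it)\|_{X_j}$; let $[X_0,X_1]_\theta=\{F(\theta):F\in\mathcal F(X_0,X_1)\}$ with its quotient norm. A differential of $(X_0,X_1)$ at $\theta$ is a map $\Omega(x)=B(x)'(\theta)$, where $B:[X_0,X_1]_\theta\to\mathcal F(X_0,X_1)$ is a homogeneous map with $B(x)(\theta)=x$ and $\|B(x)\|\le K\|x\|$ for some constant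 $K$. Equalities of spaces are meant with equivalent norms. Maps $\Omega,\Psi:L_2(\mu)\to L_0$ are called boundedly equivalent if $\Omega-\Psi$ maps the unit ball of $L_2(\mu)$ into a bounded subset of $L_2(\mu)$, and equivalent if there is a linear map $L:L_2(\mu)\to L_0$ such that $\Omega-\Psi-L$ maps the unit ball of $L_2(\mu)$ into a bounded subset of $L_2(\mu)$. For a Köthe space $X$ with $[X,X^*]_{1/2}=L_2(\mu)$, write $\Omega_X$ for a differential of $(X,X^*)$ at $1/2$. For $0<\theta<1$ put $X_\theta=[X,L_\infty(\mu)]_\theta$, and write $\Omega_{X_\theta}$ for a differential of $(X_\theta,(X_\theta)^*)$ at $1/2$. **Corollary.** Let $X,Y$ be Köthe spaces over $(\Sigma,\mu)$ with $[X,X^*]_{1/2}=L_2(\mu)=[Y,Y^*]_{1/2}$, and let $0<\theta<1$. Then $[X_\theta,(X_\theta)^*]_{1/2}=L_2(\mu)=[Y_\theta,(Y_\theta)^*]_{1/2}$, and $$\Omega_{X_\theta}-\Omega_{Y_\theta}=(1-\theta)(\Omega_X-\Omega_Y)$$ in the following sense: for all choices of the four differentials the two sides are boundedly equivalent, and for every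 choice of $\Omega_X,\Omega_Y$ there are choices of $\Omega_{X_\theta},\Omega_{Y_\theta}$ for which they are equal on $L_2(\mu)$. Hence, for all choices of the differentials, if $\Omega_X$ and $\Omega_Y$ are equivalent, then $\Omega_{X_\theta}$ and $\Omega_{Y_\theta}$ are equivalent; and if $\Omega_X$ and $\Omega_Y$ are boundedly equivalent, then $\Omega_{X_\theta}$ and $\Omega_{Y_\theta}$ are boundedly equivalent. -/

import Mathlib

open MeasureTheory Filter Topology
open scoped ENNReal NNReal

/-!
A space of (classes of) measurable functions `X ⊆ L₀(μ)` with a norm is encoded by its extended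
norm `N : L₀(μ) → [0, ∞]`, equal to the norm on `X` and to `∞` off `X`; thus `X = {f | N f < ∞}`.
-/

namespace Butterfly

/-- `L₀(μ)`: complex measurable functions modulo equality almost everywhere. -/
abbrev L0 {α : Type*} [MeasurableSpace α] (μ : Measure α) : Type _ := α →ₘ[μ] ℂ

/-- Extended norms on `L₀(μ)`. -/
abbrev ENormOn {α : Type*} [MeasurableSpace α] (μ : Measure α) : Type _ := L0 μ → ℝ≥0∞

section Spaces

variable {α : Type*} [MeasurableSpace α] {μ : Measure α}

/-- `{f | N f < ∞}` is a (Banach) Köthe function space with norm `N`.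
The field `mono` expresses both that the space is an `L_∞`-submodule of `L₀`
and that the norm is monotone. -/
structure IsKothe (N : ENormOn μ) : Prop where
  eq_zero_iff : ∀ f, N f = 0 ↔ f = 0
  add_le : ∀ f g, N (f + g) ≤ N f + N g
  smul : ∀ (c : ℂ) (f), N (c • f) = ‖c‖ₑ * N f
  mono : ∀ f g : L0 μ, (∀ᵐ a ∂μ, ‖f a‖ ≤ ‖g a‖) → N f ≤ N g
  complete : ∀ u : ℕ → L0 μ, (∀ n, N (u n) < ∞) →
    (∀ ε : ℝ≥0∞, 0 < ε → ∃ n₀, ∀ m ≥ n₀, ∀ n ≥ n₀, N (u m - u n) ≤ ε) →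
    ∃ f, N f < ∞ ∧ Tendsto (fun n => N (u n - f)) atTop (𝓝 0)

/-- The space `L₂(μ)`. -/
noncomputable def L2 (μ : Measure α) : ENormOn μ := fun f => eLpNorm f 2 μ

/-- The space `L_∞(μ)`. -/
noncomputable def Linfty (μ : Measure α) : ENormOn μ := fun f => eLpNorm f ∞ μ

/-- The Köthe dual `X^*`: `‖g‖ = sup {∫ |f g| dμ : ‖f‖_X ≤ 1}`. -/
noncomputable def kotheDual (N : ENormOn μ) : ENormOn μ := fun g =>
  ⨆ (f : L0 μ) (_ : N f ≤ 1), ∫⁻ a, ‖f a * g a‖ₑ ∂μ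

/-- Equality of two spaces, with equivalence of the norms. -/
def SameSpace (N M : ENormOn μ) : Prop :=
  ∃ C : ℝ≥0, ∀ f, N f ≤ C * M f ∧ M f ≤ C * N f

/-- The norm of the sum space `X₀ + X₁`. -/
noncomputable def sumNorm (N₀ N₁ : ENormOn μ) : ENormOn μ := fun f =>
  ⨅ (a : L0 μ) (b : L0 μ) (_ : a + b = f), N₀ a + N₁ b

end Spaces

/-- The closed unit strip `0 ≤ Re z ≤ 1`. -/
def closedStrip : Set ℂ := {z | 0 ≤ z.re ∧ z.re ≤ 1}

/-- The open unit strip `0 < Re z < 1`. -/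
def openStrip : Set ℂ := {z | 0 < z.re ∧ z.re < 1}

/-- The point `j + i t`. -/
noncomputable def vertical (j t : ℝ) : ℂ := (j : ℂ) + (t : ℂ) * Complex.I

section Interpolation

variable {α : Type*} [MeasurableSpace α] {μ : Measure α}

/-- `D` is the complex derivative of `F` at `z`, the difference quotients converging in `N`. -/
def HasDerivIn (N : ENormOn μ) (F : ℂ → L0 μ) (D : L0 μ) (z : ℂ) : Prop :=
  Tendsto (fun w => N ((w - z)⁻¹ • (F w - F z) - D)) (𝓝[≠] z) (𝓝 0)

/-- The values of `F` on the line `Re z = j` are in the space `N`, depend continuously on the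
point, and tend to zero at infinity, all in the norm `N`. -/
structure IsC0OnLine (N : ENormOn μ) (F : ℂ → L0 μ) (j : ℝ) : Prop where
  mem : ∀ t : ℝ, N (F (vertical j t)) < ∞
  cont : ∀ t : ℝ, Tendsto (fun s : ℝ => N (F (vertical j s) - F (vertical j t))) (𝓝 t) (𝓝 0)
  zero_at_infty : Tendsto (fun t : ℝ => N (F (vertical j t))) (cocompact ℝ) (𝓝 0)

/-- Membership in the Calderón space `𝓕(X₀, X₁)`: bounded continuous functions from the closed
strip to `X₀ + X₁`, analytic in the open strip, with `t ↦ F (j + i t)` continuous into `X_j` and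
vanishing at infinity for `j = 0, 1`. Values outside the closed strip are irrelevant. -/
structure MemCalderon (N₀ N₁ : ENormOn μ) (F : ℂ → L0 μ) : Prop where
  bounded : ∃ M : ℝ≥0, ∀ z ∈ closedStrip, sumNorm N₀ N₁ (F z) ≤ M
  cont : ∀ z ∈ closedStrip,
    Tendsto (fun w => sumNorm N₀ N₁ (F w - F z)) (𝓝[closedStrip] z) (𝓝 0)
  analytic : ∀ z ∈ openStrip, ∃ D, HasDerivIn (sumNorm N₀ N₁) F D z
  left : IsC0OnLine N₀ F 0
  right : IsC0OnLine N₁ F 1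

/-- The norm of `𝓕(X₀, X₁)`. -/
noncomputable def calderonNorm (N₀ N₁ : ENormOn μ) (F : ℂ → L0 μ) : ℝ≥0∞ :=
  max (⨆ t : ℝ, N₀ (F (vertical 0 t))) (⨆ t : ℝ, N₁ (F (vertical 1 t)))

/-- The complex interpolation space `[X₀, X₁]_θ = {F(θ) : F ∈ 𝓕(X₀, X₁)}` with its quotient
norm. -/
noncomputable def interp (N₀ N₁ : ENormOn μ) (θ : ℝ) : ENormOn μ := fun f =>
  ⨅ (F : ℂ → L0 μ) (_ : MemCalderon N₀ N₁ F) (_ : F (θ : ℂ) = f), calderonNorm N₀ N₁ F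

/-- `Ω` is a differential (derivation) of the pair `(X₀, X₁)` at `θ`: there is a homogeneous
bounded selection `B` for the evaluation `F ↦ F(θ)` from `𝓕(X₀, X₁)` onto `[X₀, X₁]_θ` such that
`Ω x = (B x)'(θ)`. Only the values of `Ω` on `[X₀, X₁]_θ` matter. -/
def IsDifferential (N₀ N₁ : ENormOn μ) (θ : ℝ) (Ω : L0 μ → L0 μ) : Prop :=
  ∃ (B : L0 μ → ℂ → L0 μ) (K : ℝ≥0), ∀ x, interp N₀ N₁ θ x < ∞ →
    MemCalderon N₀ N₁ (B x) ∧
    B x (θ : ℂ) = x ∧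
    calderonNorm N₀ N₁ (B x) ≤ K * interp N₀ N₁ θ x ∧
    (∀ c : ℂ, ∀ z ∈ closedStrip, B (c • x) z = c • B x z) ∧
    HasDerivIn (sumNorm N₀ N₁) (B x) (Ω x) (θ : ℂ)

/-- A (homogeneous) map `Φ` on the space `N` takes values in the space and is bounded there. -/
def IsBoundedOn (N : ENormOn μ) (Φ : L0 μ → L0 μ) : Prop :=
  ∃ C : ℝ≥0, ∀ x, N x ≤ 1 → N (Φ x) ≤ C

/-- `Φ` is trivial on the space `X` of norm `N`: it is at bounded distance from a linear map
`X → L₀`. (Linear maps `X → L₀` are exactly the restrictions of linear maps `L₀ → L₀`.) -/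
def IsTrivialOn (N : ENormOn μ) (Φ : L0 μ → L0 μ) : Prop :=
  ∃ L : L0 μ →ₗ[ℂ] L0 μ, IsBoundedOn N (fun x => Φ x - L x)

/-- Equivalence of centralizers: the difference is trivial. -/
def AreEquivalentOn (N : ENormOn μ) (Ω Ψ : L0 μ → L0 μ) : Prop :=
  IsTrivialOn N (fun x => Ω x - Ψ x)

/-- Bounded equivalence of centralizers: the difference is bounded. -/
def AreBoundedlyEquivalentOn (N : ENormOn μ) (Ω Ψ : L0 μ → L0 μ) : Prop :=
  IsBoundedOn N (fun x => Ω x - Ψ x)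

/-- `X_θ = [X, L_∞]_θ`. -/
noncomputable def convexified (N : ENormOn μ) (θ : ℝ) : ENormOn μ := interp N (Linfty μ) θ

/-- `Ω` is a centralizer `Ω_X`: a differential of the pair `(X, X^*)` at `1/2`. -/
def IsOmega (N : ENormOn μ) (Ω : L0 μ → L0 μ) : Prop :=
  IsDifferential N (kotheDual N) (1 / 2) Ω

end Interpolation

end Butterfly

/-! The theorem rests on a pointwise description of differentials. Let `F` lie in the Calderón space
of `(X₀, X₁)`, and apply Cauchy's formula on the strip to `exp (s (z - θ)) F z` and to its
difference quotient at `θ`. The kernel averages of `|F|` over the two boundary lines give `A` in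
`X₀` and `B` in `X₁`, not depending on the real number `s`, such that both `|F θ|` and `|F' θ + s F
θ|` are at most `e^{s(1-θ)} |B| + e^{-sθ} |A|` almost everywhere (`exists_pointwise_bound`). The
choice `s = log (|A| / |B|)` balances the two terms. Hence `|F θ|` is at most a multiple of
`|A|^{1-θ} |B|^θ`, and `F' θ` differs from `F θ · log (|B| / |A|)` by at most such a multiple.

For a pair `(X, X^*)` at `1/2` the error is of the size of `√(|A| |B|)`, which is square integrable
by Hölder's inequality. Replacing the factors by any others with `|x|² ≤ A' B'` changes `x log (B /
A)` only by an error of the same kind (`norm_sub_log_sq_le`). Thus `Ω_X x` is `x log (B / A)` up to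
a bounded map, whichever factorization through `X` and `X^*` is used.

A factorization `|x|² ≤ A B` for `X` produces one for `X_θ`, namely `P = A^{1-θ}` and `Q = B^{1-θ}
|x|^{2θ}`. Since `log (Q / P) = (1 - θ) log (B / A) + 2 θ log |x|`, the map `Ω_{X_θ}` is `(1 - θ)
Ω_X + 2 θ x log |x|` up to a bounded map (`IsOmega.isBoundedOn_sub`). The logarithmic term does not
involve `X`, so it cancels in `Ω_{X_θ} - Ω_{Y_θ}`.

Neither a Fatou property nor order continuity is assumed, so `A^{1-θ}` need not belong to `X_θ`.
Only its truncations are placed there, by explicit exponential families (`interp_le_of_exp`,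
`convexified_truncation_le`). Monotone convergence then gives Hölder's inequality against the dual
of `X_θ` (`lintegral_mul_le_convexified`). For the same reason `[X_θ, X_θ^*]_{1/2} = L₂` is reached
by approximation in `L₂` followed by the iteration of the open mapping theorem
(`exists_approx_convexified`, `le_of_approx`).

Exact equality for suitable choices holds because a differential plus a bounded homogeneous map is
again a differential (`IsDifferential.add_bounded`): the bounded defect is absorbed into `Ω_{X_θ}`.
The dual of `X` is a normed space only if `X` is saturated; this is extracted from `[X, X^*]_{1/2} =
L₂` in `eq_zero_of_kotheDual_eq_zero`. -/

namespace Butterfly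

/-! ### Köthe norms and the Banach spaces they define -/

section KotheNorms

variable {α : Type*} [MeasurableSpace α] {μ : Measure α} {N N₀ N₁ : ENormOn μ}

/-- A Köthe norm, without completeness. -/
structure IsKotheNorm (N : ENormOn μ) : Prop where
  eq_zero_iff : ∀ f, N f = 0 ↔ f = 0
  add_le : ∀ f g, N (f + g) ≤ N f + N g
  smul : ∀ (c : ℂ) (f), N (c • f) = ‖c‖ₑ * N f
  mono : ∀ f g : L0 μ, (∀ᵐ a ∂μ, ‖f a‖ ≤ ‖g a‖) → N f ≤ N g

theorem IsKothe.norm (h : IsKothe N) : IsKotheNorm N := ⟨h.eq_zero_iff, h.add_le, h.smul, h.mono⟩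

/-- Homogeneity follows from the inequality in one direction. -/
theorem smul_eq_of_le (h0 : N 0 = 0) (h : ∀ (c : ℂ) (f : L0 μ), c ≠ 0 → N (c • f) ≤ ‖c‖ₑ * N f)
    (c : ℂ) (f : L0 μ) : N (c • f) = ‖c‖ₑ * N f := by
  rcases eq_or_ne c 0 with rfl | hc
  · rw [show (0 : ℂ) • f = 0 from zero_smul ℂ f, h0, enorm_zero, zero_mul]
  refine le_antisymm (h c f hc) ?_
  have h1 := h c⁻¹ (c • f) (inv_ne_zero hc)
  rw [smul_smul, inv_mul_cancel₀ hc, one_smul] at h1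
  calc ‖c‖ₑ * N f ≤ ‖c‖ₑ * (‖c⁻¹‖ₑ * N (c • f)) := by gcongr
    _ = N (c • f) := by
      rw [← mul_assoc, ← enorm_mul, mul_inv_cancel₀ hc, enorm_one, one_mul]

/-- The multiplier is `f / g`, with value `0` where `g` vanishes. It reduces monotonicity of sum and
interpolation norms to multiplying a decomposition, or a representing analytic function, by `m`. -/
theorem exists_mul_of_norm_le {f g : L0 μ} (h : ∀ᵐ a ∂μ, ‖f a‖ ≤ ‖g a‖) :
    ∃ m : L0 μ, (∀ᵐ a ∂μ, ‖m a‖ ≤ 1) ∧ f = m * g := by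
  have hm : AEStronglyMeasurable (fun a => f a / g a) μ :=
    (f.measurable.div g.measurable).aestronglyMeasurable
  refine ⟨AEEqFun.mk _ hm, ?_, ?_⟩
  · filter_upwards [AEEqFun.coeFn_mk _ hm, h] with a h1 h2
    rw [h1, norm_div]
    exact div_le_one_of_le₀ h2 (norm_nonneg _)
  · apply AEEqFun.ext
    filter_upwards [AEEqFun.coeFn_mk _ hm, AEEqFun.coeFn_mul (AEEqFun.mk _ hm) g, h] with a h1 h2 h3
    rw [h2, Pi.mul_apply, h1]
    rcases eq_or_ne (g a) 0 with h0 | h0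
    · simp only [h0, norm_zero, norm_le_zero_iff] at h3
      simp [h0, h3]
    · field_simp

/-- The absolute value of an element of `L₀`. -/
noncomputable def absL0 (f : L0 μ) : L0 μ :=
  AEEqFun.comp (fun z : ℂ => ((‖z‖ : ℝ) : ℂ)) (by fun_prop) f

theorem coeFn_absL0 (f : L0 μ) : ∀ᵐ a ∂μ, absL0 f a = ((‖f a‖ : ℝ) : ℂ) :=
  AEEqFun.coeFn_comp _ _ f

theorem norm_absL0 (f : L0 μ) : ∀ᵐ a ∂μ, ‖absL0 f a‖ = ‖f a‖ := by
  filter_upwards [coeFn_absL0 f] with a h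
  simp [h]

theorem norm_mul_le_of_norm_le_one {m : L0 μ} (hm : ∀ᵐ a ∂μ, ‖m a‖ ≤ 1) (f : L0 μ) :
    ∀ᵐ a ∂μ, ‖(m * f) a‖ ≤ ‖f a‖ := by
  filter_upwards [AEEqFun.coeFn_mul m f, hm] with a h1 h2
  rw [h1, Pi.mul_apply, norm_mul]
  exact mul_le_of_le_one_left (norm_nonneg _) h2

/-- Multiplication by a fixed function. -/
noncomputable def mulL0 (m : L0 μ) : L0 μ →ₗ[ℂ] L0 μ where
  toFun f := m * f
  map_add' f g := by
    apply AEEqFun.ext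
    filter_upwards [AEEqFun.coeFn_mul m (f + g), AEEqFun.coeFn_add f g,
      AEEqFun.coeFn_add (m * f) (m * g), AEEqFun.coeFn_mul m f, AEEqFun.coeFn_mul m g]
      with a h1 h2 h3 h4 h5
    rw [h1, h3, Pi.mul_apply, Pi.add_apply, h2, h4, h5]
    simp [mul_add]
  map_smul' c f := by
    apply AEEqFun.ext
    filter_upwards [AEEqFun.coeFn_mul m (c • f), AEEqFun.coeFn_smul c f,
      AEEqFun.coeFn_smul c (m * f), AEEqFun.coeFn_mul m f]
      with a h1 h2 h3 h4
    rw [h1, RingHom.id_apply, h3, Pi.mul_apply, Pi.smul_apply, h2, h4]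
    simp [mul_left_comm]

theorem mulL0_apply (m f : L0 μ) : mulL0 m f = m * f := rfl

namespace IsKotheNorm

theorem zero (h : IsKotheNorm N) : N 0 = 0 := (h.eq_zero_iff 0).2 rfl

theorem neg (h : IsKotheNorm N) (f : L0 μ) : N (-f) = N f := by
  have := h.smul (-1) f
  rwa [show (-1 : ℂ) • f = -f from neg_one_smul ℂ f, enorm_neg, enorm_one, one_mul] at this

theorem sub_le (h : IsKotheNorm N) (f g : L0 μ) : N (f - g) ≤ N f + N g := by
  rw [sub_eq_add_neg, ← h.neg g]
  exact h.add_le _ _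

theorem abs (h : IsKotheNorm N) (f : L0 μ) : N (absL0 f) = N f :=
  le_antisymm (h.mono _ _ ((norm_absL0 f).mono fun _ h => h.le))
    (h.mono _ _ ((norm_absL0 f).mono fun _ h => h.ge))

/-- The space `{f | N f < ∞}` as a submodule of `L₀`. -/
def submodule (h : IsKotheNorm N) : Submodule ℂ (L0 μ) where
  carrier := {f | N f < ∞}
  add_mem' := fun ha hb => (h.add_le _ _).trans_lt (ENNReal.add_lt_top.2 ⟨ha, hb⟩)
  zero_mem' := by simp [h.zero]
  smul_mem' := fun c f hf => by
    simp only [Set.mem_ofPred_eq, h.smul]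
    exact ENNReal.mul_lt_top enorm_lt_top hf

/-- The normed space `{f | N f < ∞}`. -/
def Space (h : IsKotheNorm N) : Type _ := h.submodule

noncomputable instance (h : IsKotheNorm N) : AddCommGroup h.Space := inferInstanceAs (AddCommGroup h.submodule)

noncomputable instance (h : IsKotheNorm N) : Module ℂ h.Space := inferInstanceAs (Module ℂ h.submodule)

/-- The inclusion into `L₀`. -/
noncomputable def val (h : IsKotheNorm N) : h.Space →ₗ[ℂ] L0 μ := h.submodule.subtype

theorem val_injective (h : IsKotheNorm N) : Function.Injective h.val := Subtype.val_injective

theorem val_lt_top (h : IsKotheNorm N) (f : h.Space) : N (h.val f) < ∞ := f.2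

noncomputable instance (h : IsKotheNorm N) : Norm h.Space := ⟨fun f => (N (h.val f)).toReal⟩

theorem norm_def (h : IsKotheNorm N) (f : h.Space) : ‖f‖ = (N (h.val f)).toReal := rfl

theorem core (h : IsKotheNorm N) : NormedSpace.Core ℂ h.Space where
  norm_nonneg f := ENNReal.toReal_nonneg
  norm_smul c f := by
    rw [norm_def, norm_def, map_smul, h.smul, ENNReal.toReal_mul, toReal_enorm]
  norm_triangle f g := by
    rw [norm_def, norm_def, norm_def, map_add,
      ← ENNReal.toReal_add (h.val_lt_top f).ne (h.val_lt_top g).ne]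
    exact ENNReal.toReal_mono (ENNReal.add_ne_top.2 ⟨(h.val_lt_top f).ne, (h.val_lt_top g).ne⟩)
      (h.add_le _ _)
  norm_eq_zero_iff f := by
    rw [norm_def, ENNReal.toReal_eq_zero_iff, or_iff_left (h.val_lt_top f).ne, h.eq_zero_iff,
      LinearMap.map_eq_zero_iff _ h.val_injective]

noncomputable instance (h : IsKotheNorm N) : NormedAddCommGroup h.Space :=
  NormedAddCommGroup.ofCore h.core

noncomputable instance (h : IsKotheNorm N) : NormedSpace ℂ h.Space := NormedSpace.ofCore h.core

theorem enorm_eq (h : IsKotheNorm N) (f : h.Space) : ‖f‖ₑ = N (h.val f) := by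
  rw [← ofReal_norm, norm_def, ENNReal.ofReal_toReal (h.val_lt_top f).ne]

theorem edist_eq (h : IsKotheNorm N) (f g : h.Space) : edist f g = N (h.val f - h.val g) := by
  rw [edist_eq_enorm_sub, enorm_eq, map_sub]

/-- An element of `L₀` with finite norm, as an element of the normed space (and `0` otherwise). -/
noncomputable def lift (h : IsKotheNorm N) (f : L0 μ) : h.Space := by
  classical exact if hf : f ∈ h.submodule then (⟨f, hf⟩ : h.submodule) else (0 : h.submodule)

theorem val_lift (h : IsKotheNorm N) {f : L0 μ} (hf : N f < ∞) : h.val (h.lift f) = f := by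
  have hf' : f ∈ h.submodule := hf
  have : h.lift f = (⟨f, hf'⟩ : h.submodule) := dif_pos hf'
  rw [this]
  rfl

theorem tendsto_iff (h : IsKotheNorm N) {ι : Type*} {l : Filter ι} (u : ι → h.Space)
    (f : h.Space) :
    Tendsto u l (𝓝 f) ↔ Tendsto (fun n => N (h.val (u n) - h.val f)) l (𝓝 0) := by
  rw [tendsto_iff_edist_tendsto_0]
  simp only [edist_eq]

theorem finset_sum_lt_top (h : IsKotheNorm N) {ι : Type*} (s : Finset ι) (u : ι → L0 μ)
    (hu : ∀ i, N (u i) < ∞) : N (∑ i ∈ s, u i) < ∞ :=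
  h.submodule.sum_mem fun i _ => hu i

/-- A Köthe norm is complete if absolutely convergent series converge. -/
theorem isKothe_of_series (h : IsKotheNorm N)
    (H : ∀ u : ℕ → L0 μ, (∑' k, N (u k)) ≠ ∞ →
      ∃ f, Tendsto (fun n => N (f - ∑ k ∈ Finset.range n, u k)) atTop (𝓝 0)) : IsKothe N := by
  have : CompleteSpace h.Space := by
    refine NormedAddCommGroup.completeSpace_of_summable_imp_tendsto fun u hu => ?_
    have h1 : (∑' k, N (h.val (u k))) ≠ ∞ := by
      simp_rw [← h.enorm_eq, ← ofReal_norm]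
      exact hu.tsum_ofReal_ne_top
    obtain ⟨f, hf⟩ := H _ h1
    have hlt : N f < ∞ := by
      obtain ⟨n, hn⟩ := (hf.eventually (gt_mem_nhds zero_lt_one)).exists
      have : f = (f - ∑ k ∈ Finset.range n, h.val (u k)) + ∑ k ∈ Finset.range n, h.val (u k) := by
        abel
      rw [this]
      exact (h.add_le _ _).trans_lt (ENNReal.add_lt_top.2
        ⟨hn.trans ENNReal.one_lt_top, h.finset_sum_lt_top _ _ fun k => h.val_lt_top _⟩)
    refine ⟨h.lift f, (h.tendsto_iff _ _).2 ?_⟩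
    refine hf.congr fun n => ?_
    rw [h.val_lift hlt, map_sum, ← h.neg, neg_sub]
  refine ⟨h.eq_zero_iff, h.add_le, h.smul, h.mono, fun u hu hc => ?_⟩
  have hcs : CauchySeq fun n => h.lift (u n) := by
    rw [EMetric.cauchySeq_iff]
    intro ε hε
    obtain ⟨δ, hδ0, hδ⟩ := exists_between hε
    obtain ⟨n₀, hn⟩ := hc δ hδ0
    refine ⟨n₀, fun m hm n hn' => ?_⟩
    rw [h.edist_eq, h.val_lift (hu m), h.val_lift (hu n)]
    exact (hn m hm n hn').trans_lt hδ
  obtain ⟨f, hf⟩ := cauchySeq_tendsto_of_complete hcs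
  refine ⟨h.val f, h.val_lt_top f, ?_⟩
  refine ((h.tendsto_iff _ _).1 hf).congr fun n => ?_
  rw [h.val_lift (hu n)]

end IsKotheNorm

namespace IsKothe

instance completeSpace [hN : Fact (IsKothe N)] : CompleteSpace hN.out.norm.Space := by
  have h := hN.out.norm
  refine EMetric.complete_of_cauchySeq_tendsto fun u hu => ?_
  rw [EMetric.cauchySeq_iff] at hu
  obtain ⟨f, hf, hf'⟩ := hN.out.complete (fun n => h.val (u n)) (fun n => h.val_lt_top _)
    (fun ε hε => by
      obtain ⟨n₀, hn⟩ := hu ε hε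
      refine ⟨n₀, fun m hm n hn' => ?_⟩
      rw [← h.edist_eq]
      exact (hn m hm n hn').le)
  refine ⟨h.lift f, (h.tendsto_iff _ _).2 ?_⟩
  rwa [h.val_lift hf]

theorem series (hN : IsKothe N) (u : ℕ → L0 μ) (hu : (∑' k, N (u k)) ≠ ∞) :
    ∃ f, N f < ∞ ∧ Tendsto (fun n => N (f - ∑ k ∈ Finset.range n, u k)) atTop (𝓝 0) := by
  have h := hN.norm
  have := Fact.mk hN
  have hlt : ∀ k, N (u k) < ∞ := fun k => (ENNReal.ne_top_of_tsum_ne_top hu k).lt_top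
  have hs : Summable fun k => ‖h.lift (u k)‖ := by
    simp_rw [h.norm_def, h.val_lift (hlt _)]
    exact ENNReal.summable_toReal hu
  obtain ⟨f, hf⟩ := NormedAddCommGroup.summable_imp_tendsto_of_complete _ hs
  refine ⟨h.val f, h.val_lt_top f, ?_⟩
  refine ((h.tendsto_iff _ _).1 hf).congr fun n => ?_
  rw [← h.neg, neg_sub, map_sum]
  simp_rw [h.val_lift (hlt _)]

/-- The terms of an absolutely convergent series tend to zero almost everywhere. -/
theorem ae_summable (hN : IsKothe N) (u : ℕ → L0 μ) (hu : (∑' k, N (u k)) ≠ ∞) :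
    ∀ᵐ a ∂μ, (∑' k, ‖u k a‖ₑ) ≠ ∞ := by
  have h := hN.norm
  obtain ⟨f, hf, hT⟩ := hN.series (fun k => absL0 (u k)) (by simpa only [h.abs] using hu)
  -- The positive part `d` of the excess of the `n`-th partial sum over `|f|` is dominated by `|f -
  -- S_m|` for every `m ≥ n`, where `S_m` is the `m`-th partial sum. Since `S_m` tends to `f` in
  -- norm, `d` has norm zero.
  have key : ∀ n, ∀ᵐ a ∂μ, ∑ k ∈ Finset.range n, ‖u k a‖ ≤ ‖f a‖ := by
    intro n
    have hm : AEStronglyMeasurable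
        (fun a => ((max (∑ k ∈ Finset.range n, ‖u k a‖ - ‖f a‖) 0 : ℝ) : ℂ)) μ := by
      apply Measurable.aestronglyMeasurable
      have := fun k => (u k).measurable
      have := f.measurable
      fun_prop
    set d : L0 μ := AEEqFun.mk _ hm with hd
    have habs : ∀ᵐ a ∂μ, ∀ k, absL0 (u k) a = ((‖u k a‖ : ℝ) : ℂ) :=
      ae_all_iff.2 fun k => coeFn_absL0 _
    have hle : ∀ m ≥ n, N d ≤ N (f - ∑ k ∈ Finset.range m, absL0 (u k)) := by
      intro m hmn
      apply h.mono
      filter_upwards [AEEqFun.coeFn_mk _ hm, AEEqFun.coeFn_sub f (∑ k ∈ Finset.range m, absL0 (u k)),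
        AEEqFun.coeFn_finsetSum (Finset.range m) (fun k => absL0 (u k)), habs] with a h1 h2 h3 h4
      rw [hd, h1, h2, Pi.sub_apply, h3, Finset.sum_apply]
      simp only [h4]
      rw [Complex.norm_real, Real.norm_eq_abs, abs_of_nonneg (le_max_right _ _), norm_sub_rev,
        ← Complex.ofReal_sum]
      refine max_le ?_ (norm_nonneg _)
      have h5 : ∑ k ∈ Finset.range n, ‖u k a‖ ≤ ∑ k ∈ Finset.range m, ‖u k a‖ :=
        Finset.sum_le_sum_of_subset_of_nonneg (Finset.range_mono hmn) fun _ _ _ => norm_nonneg _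
      have h6 := norm_sub_norm_le ((∑ k ∈ Finset.range m, ‖u k a‖ : ℝ) : ℂ) (f a)
      rw [Complex.norm_real, Real.norm_eq_abs,
        abs_of_nonneg (Finset.sum_nonneg fun _ _ => norm_nonneg _)] at h6
      linarith
    have h0 : N d = 0 := by
      refine le_antisymm (ge_of_tendsto hT ?_) zero_le
      filter_upwards [eventually_ge_atTop n] with m hmn using hle m hmn
    rw [h.eq_zero_iff] at h0
    filter_upwards [AEEqFun.coeFn_mk _ hm, AEEqFun.coeFn_zero (μ := μ) (α := α) (β := ℂ)] with a h1 h2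
    rw [← hd, h0, h2] at h1
    have h3 : max (∑ k ∈ Finset.range n, ‖u k a‖ - ‖f a‖) 0 = 0 := by
      have h4 := h1.symm
      rw [Pi.zero_apply] at h4
      exact_mod_cast h4
    have := le_max_left (∑ k ∈ Finset.range n, ‖u k a‖ - ‖f a‖) 0
    linarith
  filter_upwards [ae_all_iff.2 key] with a ha
  have : (∑' k, ‖u k a‖ₑ) ≤ ‖f a‖ₑ := by
    refine ENNReal.tsum_le_of_sum_range_le fun n => ?_
    have h1 := ENNReal.ofReal_le_ofReal (ha n)
    rw [ENNReal.ofReal_sum_of_nonneg fun _ _ => norm_nonneg _] at h1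
    simpa only [ofReal_norm] using h1
  exact (this.trans_lt enorm_lt_top).ne

end IsKothe

end KotheNorms

end Butterfly

namespace Butterfly

/-! ### Completeness of `L_∞`, of sums and of Köthe duals -/

section Constructions

variable {α : Type*} [MeasurableSpace α] {μ : Measure α} {N N₀ N₁ : ENormOn μ}

/-- A countably subadditive Köthe norm is complete. -/
theorem IsKotheNorm.isKothe_of_le_tsum (h : IsKotheNorm N)
    (H₁ : ∀ u : ℕ → L0 μ, (∑' k, N (u k)) ≠ ∞ → ∀ᵐ a ∂μ, (∑' k, ‖u k a‖ₑ) ≠ ∞)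
    (H₂ : ∀ (u : ℕ → L0 μ) (f : L0 μ), (∀ᵐ a ∂μ, ‖f a‖ₑ ≤ ∑' k, ‖u k a‖ₑ) →
      N f ≤ ∑' k, N (u k)) : IsKothe N := by
  refine h.isKothe_of_series fun u hu => ?_
  have hs : ∀ᵐ a ∂μ, Summable fun k => ‖u k a‖ := by
    filter_upwards [H₁ u hu] with a ha
    have := ENNReal.summable_toReal ha
    simpa only [toReal_enorm] using this
  have hm : AEStronglyMeasurable (fun a => ∑' k, u k a) μ := by
    refine aestronglyMeasurable_of_tendsto_ae atTop
      (f := fun (n : ℕ) a => ∑ k ∈ Finset.range n, u k a) (fun n => ?_) ?_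
    · have := fun k => (u k).measurable
      exact Measurable.aestronglyMeasurable (by fun_prop)
    · filter_upwards [hs] with a ha
      exact ha.of_norm.hasSum.tendsto_sum_nat
  refine ⟨AEEqFun.mk _ hm, ?_⟩
  refine tendsto_of_tendsto_of_tendsto_of_le_of_le tendsto_const_nhds
    (ENNReal.tendsto_sum_nat_add _ hu) (fun _ => zero_le) fun n => ?_
  refine H₂ (fun k => u (k + n)) _ ?_
  filter_upwards [hs, AEEqFun.coeFn_mk _ hm, AEEqFun.coeFn_sub (AEEqFun.mk _ hm)
    (∑ k ∈ Finset.range n, u k), AEEqFun.coeFn_finsetSum (Finset.range n) u] with a h1 h2 h3 h4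
  rw [h3, Pi.sub_apply, h2, h4, Finset.sum_apply, ← h1.of_norm.sum_add_tsum_nat_add n,
    add_sub_cancel_left]
  exact enorm_tsum_le_tsum_enorm

/-! ### The space `L_∞` -/

theorem Linfty_isKothe (μ : Measure α) : IsKothe (Linfty μ) := by
  have hn : IsKotheNorm (Linfty μ) := by
    refine ⟨fun f => ?_, fun f g => ?_, fun c f => ?_, fun f g hfg => ?_⟩
    · unfold Linfty
      rw [eLpNorm_eq_zero_iff f.aestronglyMeasurable (by simp)]
      constructor
      · intro h
        apply AEEqFun.ext
        exact h.trans AEEqFun.coeFn_zero.symm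
      · rintro rfl
        exact AEEqFun.coeFn_zero
    · unfold Linfty
      rw [eLpNorm_congr_ae (AEEqFun.coeFn_add f g)]
      exact eLpNorm_add_le f.aestronglyMeasurable g.aestronglyMeasurable (by simp)
    · unfold Linfty
      rw [eLpNorm_congr_ae (AEEqFun.coeFn_smul c f), eLpNorm_const_smul]
    · exact eLpNorm_mono_ae hfg
  have hle : ∀ u : ℕ → L0 μ, ∀ᵐ a ∂μ, (∑' k, ‖u k a‖ₑ) ≤ ∑' k, Linfty μ (u k) := by
    intro u
    filter_upwards [ae_all_iff.2 fun k => enorm_ae_le_eLpNormEssSup (u k) μ] with a ha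
    exact ENNReal.tsum_le_tsum fun k => (ha k).trans_eq (by simp [Linfty])
  refine hn.isKothe_of_le_tsum (fun u hu => ?_) fun u f hf => ?_
  · filter_upwards [hle u] with a ha
    exact (ha.trans_lt hu.lt_top).ne
  · rw [Linfty, eLpNorm_exponent_top]
    refine eLpNormEssSup_le_of_ae_enorm_bound ?_
    filter_upwards [hf, hle u] with a h1 h2 using h1.trans h2

theorem ae_le_of_Linfty_le {f : L0 μ} {C : ℝ≥0∞} (h : Linfty μ f ≤ C) : ∀ᵐ a ∂μ, ‖f a‖ₑ ≤ C := by
  rw [Linfty, eLpNorm_exponent_top] at h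
  filter_upwards [enorm_ae_le_eLpNormEssSup f μ] with a ha using ha.trans h

theorem Linfty_le_of_ae {f : L0 μ} {C : ℝ≥0∞} (h : ∀ᵐ a ∂μ, ‖f a‖ₑ ≤ C) : Linfty μ f ≤ C := by
  rw [Linfty, eLpNorm_exponent_top]
  exact eLpNormEssSup_le_of_ae_enorm_bound h

/-! ### Sums -/

theorem exists_add_of_sumNorm_lt {f : L0 μ} {r : ℝ≥0∞} (h : sumNorm N₀ N₁ f < r) :
    ∃ a b, a + b = f ∧ N₀ a + N₁ b < r := by
  simp only [sumNorm, iInf_lt_iff] at h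
  obtain ⟨a, b, hab, h⟩ := h
  exact ⟨a, b, hab, h⟩

theorem sumNorm_add_le (a b : L0 μ) : sumNorm N₀ N₁ (a + b) ≤ N₀ a + N₁ b :=
  iInf_le_of_le a (iInf_le_of_le b (iInf_le_of_le rfl le_rfl))

theorem sumNorm_le_left (h₁ : IsKotheNorm N₁) (f : L0 μ) : sumNorm N₀ N₁ f ≤ N₀ f := by
  have := sumNorm_add_le (N₀ := N₀) (N₁ := N₁) f 0
  rwa [add_zero, h₁.zero, add_zero] at this

theorem sumNorm_le_right (h₀ : IsKotheNorm N₀) (f : L0 μ) : sumNorm N₀ N₁ f ≤ N₁ f := by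
  have := sumNorm_add_le (N₀ := N₀) (N₁ := N₁) 0 f
  rwa [zero_add, h₀.zero, zero_add] at this

/-- Almost everywhere convergence to zero of a summable sequence. -/
theorem IsKothe.ae_tendsto_zero (hN : IsKothe N) (u : ℕ → L0 μ) (hu : (∑' k, N (u k)) ≠ ∞) :
    ∀ᵐ a ∂μ, Tendsto (fun k => u k a) atTop (𝓝 0) := by
  filter_upwards [hN.ae_summable u hu] with a ha
  rw [tendsto_zero_iff_norm_tendsto_zero]
  have := ENNReal.summable_toReal ha
  simp only [toReal_enorm] at this
  exact this.tendsto_atTop_zero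

/-- Definiteness is the only point that needs completeness of the summands: if the sum norm of `f`
vanishes, then `f = a_k + b_k` with summable norms, and both sequences tend to zero almost
everywhere. -/
theorem sumNorm_isKotheNorm (h₀ : IsKothe N₀) (h₁ : IsKothe N₁) :
    IsKotheNorm (sumNorm N₀ N₁) := by
  have hz : sumNorm N₀ N₁ 0 = 0 := by
    refine le_antisymm ?_ zero_le
    exact (sumNorm_le_left h₁.norm 0).trans_eq h₀.norm.zero
  refine ⟨fun f => ⟨fun hf => ?_, ?_⟩, fun f g => ?_, ?_, fun f g hfg => ?_⟩
  · obtain ⟨ε, hε0, hε⟩ := ENNReal.exists_pos_sum_of_countable (ε := 1) one_ne_zero ℕ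
    have hlt : ∀ k, sumNorm N₀ N₁ f < ε k := fun k => by
      rw [hf]; exact_mod_cast hε0 k
    choose a b hab hr using fun k => exists_add_of_sumNorm_lt (hlt k)
    have ha : (∑' k, N₀ (a k)) ≠ ∞ := ((ENNReal.tsum_le_tsum fun k =>
      le_self_add.trans (hr k).le).trans_lt (hε.trans ENNReal.one_lt_top)).ne
    have hb : (∑' k, N₁ (b k)) ≠ ∞ := ((ENNReal.tsum_le_tsum fun k =>
      le_add_self.trans (hr k).le).trans_lt (hε.trans ENNReal.one_lt_top)).ne
    apply AEEqFun.ext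
    filter_upwards [h₀.ae_tendsto_zero a ha, h₁.ae_tendsto_zero b hb,
      ae_all_iff.2 fun k => AEEqFun.coeFn_add (a k) (b k),
      AEEqFun.coeFn_zero (μ := μ) (α := α) (β := ℂ)] with x h1 h2 h3 h4
    rw [h4, Pi.zero_apply]
    have h5 := h1.add h2
    rw [add_zero] at h5
    refine tendsto_nhds_unique (tendsto_const_nhds.congr fun k => ?_) h5
    rw [← hab k, h3 k, Pi.add_apply]
  · rintro rfl
    exact hz
  · refine ENNReal.le_of_forall_pos_le_add fun ε hε hlt => ?_
    have hε' : (ε / 2 : ℝ≥0∞) ≠ 0 := by simpa using hε.ne'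
    obtain ⟨a, b, rfl, hr⟩ := exists_add_of_sumNorm_lt
      (ENNReal.lt_add_right (ENNReal.add_lt_top.1 hlt).1.ne hε')
    obtain ⟨c, d, rfl, hs⟩ := exists_add_of_sumNorm_lt
      (ENNReal.lt_add_right (ENNReal.add_lt_top.1 hlt).2.ne hε')
    calc sumNorm N₀ N₁ (a + b + (c + d)) = sumNorm N₀ N₁ ((a + c) + (b + d)) := by
          rw [add_add_add_comm]
      _ ≤ N₀ (a + c) + N₁ (b + d) := sumNorm_add_le _ _
      _ ≤ (N₀ a + N₀ c) + (N₁ b + N₁ d) := add_le_add (h₀.add_le _ _) (h₁.add_le _ _)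
      _ = (N₀ a + N₁ b) + (N₀ c + N₁ d) := by rw [add_add_add_comm]
      _ ≤ (sumNorm N₀ N₁ (a + b) + ε / 2) + (sumNorm N₀ N₁ (c + d) + ε / 2) :=
          add_le_add hr.le hs.le
      _ = sumNorm N₀ N₁ (a + b) + sumNorm N₀ N₁ (c + d) + ε := by
          rw [add_add_add_comm, ENNReal.add_halves]
  · refine smul_eq_of_le hz fun c f hc => ?_
    rw [sumNorm, sumNorm]
    rw [ENNReal.mul_iInf_of_ne (by simpa using hc) enorm_ne_top]
    refine le_iInf fun a => ?_
    rw [ENNReal.mul_iInf_of_ne (by simpa using hc) enorm_ne_top]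
    refine le_iInf fun b => ?_
    rw [ENNReal.mul_iInf_of_ne (by simpa using hc) enorm_ne_top]
    refine le_iInf fun hab => ?_
    rw [mul_add, ← h₀.smul, ← h₁.smul]
    refine sumNorm_add_le (N₀ := N₀) (N₁ := N₁) (c • a) (c • b) |>.trans' (le_of_eq ?_)
    rw [← hab]
    exact congrArg (sumNorm N₀ N₁) (smul_add c a b)
  · obtain ⟨m, hm, rfl⟩ := exists_mul_of_norm_le hfg
    refine le_iInf fun a => le_iInf fun b => le_iInf fun hab => ?_
    rw [← hab, ← mulL0_apply, map_add]
    exact (sumNorm_add_le _ _).trans (add_le_add (h₀.mono _ _ (norm_mul_le_of_norm_le_one hm a))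
      (h₁.mono _ _ (norm_mul_le_of_norm_le_one hm b)))

theorem sumNorm_isKothe (h₀ : IsKothe N₀) (h₁ : IsKothe N₁) : IsKothe (sumNorm N₀ N₁) := by
  refine (sumNorm_isKotheNorm h₀ h₁).isKothe_of_series fun u hu => ?_
  obtain ⟨ε, hε0, hε⟩ := ENNReal.exists_pos_sum_of_countable (ε := 1) one_ne_zero ℕ
  have hlt : ∀ k, sumNorm N₀ N₁ (u k) < sumNorm N₀ N₁ (u k) + ε k := fun k =>
    ENNReal.lt_add_right (ENNReal.ne_top_of_tsum_ne_top hu k) (by simpa using (hε0 k).ne')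
  choose a b hab hr using fun k => exists_add_of_sumNorm_lt (hlt k)
  have hfin : (∑' k, (sumNorm N₀ N₁ (u k) + ε k)) < ∞ := by
    rw [ENNReal.tsum_add]
    exact ENNReal.add_lt_top.2 ⟨hu.lt_top, hε.trans ENNReal.one_lt_top⟩
  have ha : (∑' k, N₀ (a k)) ≠ ∞ := ((ENNReal.tsum_le_tsum fun k =>
    le_self_add.trans (hr k).le).trans_lt hfin).ne
  have hb : (∑' k, N₁ (b k)) ≠ ∞ := ((ENNReal.tsum_le_tsum fun k =>
    le_add_self.trans (hr k).le).trans_lt hfin).ne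
  obtain ⟨f, -, hf⟩ := h₀.series a ha
  obtain ⟨g, -, hg⟩ := h₁.series b hb
  refine ⟨f + g, ?_⟩
  have hlim := hf.add hg
  rw [add_zero] at hlim
  refine tendsto_of_tendsto_of_tendsto_of_le_of_le tendsto_const_nhds hlim
    (fun _ => zero_le) fun n => ?_
  have : f + g - ∑ k ∈ Finset.range n, u k =
      (f - ∑ k ∈ Finset.range n, a k) + (g - ∑ k ∈ Finset.range n, b k) := by
    simp_rw [← hab, Finset.sum_add_distrib]
    abel
  rw [this]
  exact sumNorm_add_le _ _

/-! ### Köthe duals -/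

theorem lintegral_mul_le_kotheDual {f g : L0 μ} (hf : N f ≤ 1) :
    ∫⁻ a, ‖f a * g a‖ₑ ∂μ ≤ kotheDual N g :=
  le_iSup₂_of_le f hf le_rfl

theorem lintegral_smul_mul (c : ℂ) (f g : L0 μ) :
    ∫⁻ a, ‖(c • f : L0 μ) a * g a‖ₑ ∂μ = ‖c‖ₑ * ∫⁻ a, ‖f a * g a‖ₑ ∂μ := by
  rw [← lintegral_const_mul' _ _ enorm_ne_top]
  refine lintegral_congr_ae ?_
  filter_upwards [AEEqFun.coeFn_smul c f] with a h
  rw [h, Pi.smul_apply, smul_eq_mul, mul_assoc, enorm_mul]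

/-- Hölder's inequality for a space and its Köthe dual. -/
theorem IsKotheNorm.lintegral_mul_le (h : IsKotheNorm N) {f : L0 μ} (hf : N f < ∞) (g : L0 μ) :
    ∫⁻ a, ‖f a * g a‖ₑ ∂μ ≤ N f * kotheDual N g := by
  rcases eq_or_ne (N f) 0 with h0 | h0
  · rw [h.eq_zero_iff] at h0
    subst h0
    refine le_of_eq_of_le ?_ zero_le
    rw [← lintegral_zero (μ := μ)]
    refine lintegral_congr_ae ?_
    filter_upwards [AEEqFun.coeFn_zero (μ := μ) (α := α) (β := ℂ)] with a ha
    simp [ha]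
  · have hpos : 0 < (N f).toReal := ENNReal.toReal_pos h0 hf.ne
    have hc : ‖(((N f).toReal : ℝ) : ℂ)‖ₑ = N f := by
      rw [← ofReal_norm, Complex.norm_real, Real.norm_eq_abs, abs_of_pos hpos,
        ENNReal.ofReal_toReal hf.ne]
    have hc' : ‖((((N f).toReal : ℝ) : ℂ))⁻¹‖ₑ = (N f)⁻¹ := by
      rw [enorm_inv (by exact_mod_cast hpos.ne'), hc]
    have h1 := lintegral_mul_le_kotheDual (N := N) (f := ((((N f).toReal : ℝ) : ℂ))⁻¹ • f) (g := g)
      (by rw [h.smul, hc', ENNReal.inv_mul_cancel h0 hf.ne])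
    rw [lintegral_smul_mul, hc'] at h1
    calc ∫⁻ a, ‖f a * g a‖ₑ ∂μ = N f * ((N f)⁻¹ * ∫⁻ a, ‖f a * g a‖ₑ ∂μ) := by
          rw [← mul_assoc, ENNReal.mul_inv_cancel h0 hf.ne, one_mul]
      _ ≤ _ := by gcongr

/-- The Köthe dual of a saturated space is a Köthe space. -/
theorem kotheDual_isKothe (hs : ∀ g, kotheDual N g = 0 → g = 0) :
    IsKothe (kotheDual N) := by
  have hz : kotheDual N 0 = 0 := by
    simp only [kotheDual, ENNReal.iSup_eq_zero]
    intro f _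
    rw [← lintegral_zero (μ := μ)]
    refine lintegral_congr_ae ?_
    filter_upwards [AEEqFun.coeFn_zero (μ := μ) (α := α) (β := ℂ)] with a ha
    simp [ha]
  have hsub : ∀ (u : ℕ → L0 μ) (f g : L0 μ), N f ≤ 1 → (∀ᵐ a ∂μ, ‖g a‖ₑ ≤ ∑' k, ‖u k a‖ₑ) →
      ∫⁻ a, ‖f a * g a‖ₑ ∂μ ≤ ∑' k, kotheDual N (u k) := by
    intro u f g hf hg
    calc ∫⁻ a, ‖f a * g a‖ₑ ∂μ ≤ ∫⁻ a, ∑' k, ‖f a * u k a‖ₑ ∂μ := by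
          refine lintegral_mono_ae ?_
          filter_upwards [hg] with a ha
          simp_rw [enorm_mul, ENNReal.tsum_mul_left]
          gcongr
      _ = ∑' k, ∫⁻ a, ‖f a * u k a‖ₑ ∂μ :=
          lintegral_tsum fun k => (f.measurable.mul (u k).measurable).enorm.aemeasurable
      _ ≤ _ := ENNReal.tsum_le_tsum fun k => lintegral_mul_le_kotheDual hf
  have hn : IsKotheNorm (kotheDual N) := by
    refine ⟨fun f => ⟨hs f, ?_⟩, fun f g => ?_, ?_, fun f g hfg => ?_⟩
    · rintro rfl
      exact hz
    · refine iSup₂_le fun x hx => ?_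
      calc ∫⁻ a, ‖x a * (f + g) a‖ₑ ∂μ ≤ ∫⁻ a, (‖x a * f a‖ₑ + ‖x a * g a‖ₑ) ∂μ := by
            refine lintegral_mono_ae ?_
            filter_upwards [AEEqFun.coeFn_add f g] with a ha
            rw [ha, Pi.add_apply, mul_add]
            exact enorm_add_le _ _
        _ = ∫⁻ a, ‖x a * f a‖ₑ ∂μ + ∫⁻ a, ‖x a * g a‖ₑ ∂μ :=
            lintegral_add_left (x.measurable.mul f.measurable).enorm _
        _ ≤ _ := add_le_add (lintegral_mul_le_kotheDual hx) (lintegral_mul_le_kotheDual hx)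
    · refine smul_eq_of_le hz fun c f _ => iSup₂_le fun x hx => ?_
      have h1 : ∫⁻ a, ‖x a * (c • f : L0 μ) a‖ₑ ∂μ = ‖c‖ₑ * ∫⁻ a, ‖x a * f a‖ₑ ∂μ := by
        simp_rw [mul_comm (x _)]
        exact lintegral_smul_mul c f x
      rw [h1]
      gcongr
      exact lintegral_mul_le_kotheDual hx
    · refine iSup₂_le fun x hx => ?_
      refine le_trans (lintegral_mono_ae ?_) (lintegral_mul_le_kotheDual (g := g) hx)
      filter_upwards [hfg] with a ha
      rw [enorm_mul, enorm_mul]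
      gcongr
      exact enorm_le_iff_norm_le.2 ha
  refine hn.isKothe_of_le_tsum (fun u hu => ?_) fun u f hf => iSup₂_le fun x hx => hsub u x f hx hf
  have hmeas : Measurable fun a => ∑' k, ‖u k a‖ₑ :=
    Measurable.tsum fun k => (u k).measurable.enorm
  -- Every `f` in the unit ball has finite integral against the series, so it vanishes almost
  -- everywhere on the divergence set `T`. The indicator of `T` therefore has dual norm zero, and
  -- saturation makes `T` a null set.
  set T : Set α := {a | ∑' k, ‖u k a‖ₑ = ∞} with hT
  have hTm : MeasurableSet T := hmeas (measurableSet_singleton ∞)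
  have him : AEStronglyMeasurable (T.indicator fun _ => (1 : ℂ)) μ :=
    (measurable_const.indicator hTm).aestronglyMeasurable
  have h0 : kotheDual N (AEEqFun.mk _ him) = 0 := by
    simp only [kotheDual, ENNReal.iSup_eq_zero]
    intro f hf
    have hle : ∫⁻ a, ‖f a‖ₑ * ∑' k, ‖u k a‖ₑ ∂μ ≠ ∞ := by
      have : ∫⁻ a, ‖f a‖ₑ * ∑' k, ‖u k a‖ₑ ∂μ = ∑' k, ∫⁻ a, ‖f a * u k a‖ₑ ∂μ := by
        refine Eq.trans ?_
          (lintegral_tsum fun k => (f.measurable.mul (u k).measurable).enorm.aemeasurable)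
        simp_rw [enorm_mul, ENNReal.tsum_mul_left]
      rw [this]
      exact ((ENNReal.tsum_le_tsum fun k => lintegral_mul_le_kotheDual hf).trans_lt hu.lt_top).ne
    have hae := ae_lt_top (f.measurable.enorm.mul hmeas) hle
    rw [← lintegral_zero (μ := μ)]
    refine lintegral_congr_ae ?_
    filter_upwards [hae, AEEqFun.coeFn_mk _ him] with a h1 h2
    rw [h2]
    by_cases ha : a ∈ T
    · have hfa : f a = 0 := by
        by_contra hne
        have : (‖f a‖ₑ * ∑' k, ‖u k a‖ₑ) = ∞ := by
          rw [show (∑' k, ‖u k a‖ₑ) = ∞ from ha, ENNReal.mul_top (by simpa using hne)]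
        exact absurd this h1.ne
      simp [hfa]
    · simp [ha]
  have h1 := hs _ h0
  have h2 := AEEqFun.coeFn_mk _ him
  rw [h1] at h2
  filter_upwards [h2, AEEqFun.coeFn_zero (μ := μ) (α := α) (β := ℂ)] with a h3 h4 ha
  rw [h4, Set.indicator_of_mem (show a ∈ T from ha)] at h3
  simp at h3

end Constructions

end Butterfly

namespace Butterfly

/-! ### Analytic functions on the strip with values in a Banach space -/

section Strip

open Complex Set
open scoped Real Interval

variable {E : Type*} [NormedAddCommGroup E] [NormedSpace ℂ E]

theorem vertical_re (j t : ℝ) : (vertical j t).re = j := by simp [vertical]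

theorem vertical_im (j t : ℝ) : (vertical j t).im = t := by simp [vertical]

theorem continuous_vertical (j : ℝ) : Continuous (vertical j) := by
  unfold vertical
  fun_prop

theorem vertical_zero_mem (t : ℝ) : vertical 0 t ∈ closedStrip := by
  simp [closedStrip, vertical_re]

theorem vertical_one_mem (t : ℝ) : vertical 1 t ∈ closedStrip := by
  simp [closedStrip, vertical_re]

theorem isOpen_openStrip : IsOpen openStrip :=
  (isOpen_lt continuous_const continuous_re).inter (isOpen_lt continuous_re continuous_const)

theorem openStrip_subset : openStrip ⊆ closedStrip := fun _ h => ⟨h.1.le, h.2.le⟩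

theorem ofReal_mem_openStrip {θ : ℝ} (h0 : 0 < θ) (h1 : θ < 1) : (θ : ℂ) ∈ openStrip := by
  simp [openStrip, h0, h1]

theorem openStrip_eq : openStrip = re ⁻¹' Ioo 0 1 := rfl

theorem closure_openStrip : closure openStrip = closedStrip := by
  rw [openStrip_eq, closure_preimage_re, closure_Ioo zero_ne_one]
  rfl

omit [NormedSpace ℂ E] in
theorem continuous_comp_vertical {G : ℂ → E} (hc : ContinuousOn G closedStrip) {j : ℝ}
    (hj : ∀ t, vertical j t ∈ closedStrip) : Continuous fun t => G (vertical j t) :=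
  hc.comp_continuous (continuous_vertical j) hj

/-- The maximum principle on the strip. -/
theorem norm_le_of_boundary {G : ℂ → E} (hc : ContinuousOn G closedStrip)
    (hd : DifferentiableOn ℂ G openStrip) {M C : ℝ} (hM : ∀ z ∈ closedStrip, ‖G z‖ ≤ M)
    (h0 : ∀ t, ‖G (vertical 0 t)‖ ≤ C) (h1 : ∀ t, ‖G (vertical 1 t)‖ ≤ C) {z : ℂ}
    (hz : z ∈ closedStrip) : ‖G z‖ ≤ C := by
  have hv : ∀ (j : ℝ) (w : ℂ), w.re = j → w = vertical j w.im := fun j w hw => by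
    apply Complex.ext <;> simp [vertical_re, vertical_im, hw]
  refine PhragmenLindelof.vertical_strip (a := 0) (b := 1) (f := G) ⟨hd, ?_⟩
    ⟨0, by simpa using Real.pi_pos, 0, ?_⟩ (fun w hw => ?_) (fun w hw => ?_) hz.1 hz.2
  · rw [← openStrip_eq, closure_openStrip]
    exact hc
  · refine Asymptotics.IsBigO.of_bound M ?_
    filter_upwards [mem_inf_of_right (mem_principal_self _)] with w hw
    simpa using hM w (openStrip_subset hw)
  · rw [hv 0 w hw]; exact h0 _
  · rw [hv 1 w hw]; exact h1 _

/-- The kernel `1 / sin (π (θ - i t))`. -/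
noncomputable def stripKernel (θ t : ℝ) : ℂ := (sin (π * (θ - t * I)))⁻¹

theorem sin_pi_re (a b : ℝ) : (sin (π * (a + b * I))).re = Real.sin (π * a) * Real.cosh (π * b) := by
  have : (π : ℂ) * (a + b * I) = ((π * a : ℝ) : ℂ) + ((π * b : ℝ) : ℂ) * I := by
    push_cast; ring
  rw [this, sin_add_mul_I, ← ofReal_sin, ← ofReal_cos, ← ofReal_cosh, ← ofReal_sinh]
  simp only [add_re, mul_re, mul_im, ofReal_re, ofReal_im, I_re, I_im]
  ring

theorem sin_pi_im (a b : ℝ) : (sin (π * (a + b * I))).im = Real.cos (π * a) * Real.sinh (π * b) := by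
  have : (π : ℂ) * (a + b * I) = ((π * a : ℝ) : ℂ) + ((π * b : ℝ) : ℂ) * I := by
    push_cast; ring
  rw [this, sin_add_mul_I, ← ofReal_sin, ← ofReal_cos, ← ofReal_cosh, ← ofReal_sinh]
  simp only [add_im, mul_re, mul_im, ofReal_re, ofReal_im, I_re, I_im]
  ring

theorem sin_pi_mul_pos {θ : ℝ} (h0 : 0 < θ) (h1 : θ < 1) : 0 < Real.sin (π * θ) :=
  Real.sin_pos_of_pos_of_lt_pi (by positivity) (by nlinarith [Real.pi_pos])

theorem le_cosh_pi_mul (t : ℝ) : 1 + t ^ 2 ≤ Real.cosh (π * t) := by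
  have h1 : Real.cosh (π * t) = 1 + 2 * Real.sinh (π * t / 2) ^ 2 := by
    have h := Real.cosh_two_mul (π * t / 2)
    rw [Real.cosh_sq] at h
    rw [show π * t = 2 * (π * t / 2) by ring, h]
    ring_nf
  have h2 : |π * t / 2| ≤ |Real.sinh (π * t / 2)| := by
    rw [Real.abs_sinh]
    exact Real.self_le_sinh_iff.2 (abs_nonneg _)
  have h3 := sq_le_sq.2 h2
  have h4 : (2 : ℝ) ≤ π ^ 2 := by nlinarith [Real.pi_gt_three]
  nlinarith [sq_nonneg t, mul_le_mul_of_nonneg_right h4 (sq_nonneg t)]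

theorem sin_kernel_re {θ : ℝ} (t : ℝ) :
    (sin (π * (θ - t * I))).re = Real.sin (π * θ) * Real.cosh (π * t) := by
  have := sin_pi_re θ (-t)
  rw [mul_neg, Real.cosh_neg] at this
  rw [← this]
  congr 3
  push_cast
  ring

/-- On the two boundary lines `1 / sin (π (z - θ))` takes opposite values. This compensates for the
opposite orientations, so both boundary integrals in Cauchy's formula carry the same kernel. -/
theorem inv_sin_right (θ t : ℝ) : (sin (π * (((1 : ℝ) + t * I : ℂ) - θ)))⁻¹ = stripKernel θ t := by
  have h : (π : ℂ) * (((1 : ℝ) + t * I : ℂ) - θ) = π - π * (θ - t * I) := by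
    push_cast
    ring
  rw [h, sin_pi_sub, stripKernel]

theorem inv_sin_left (θ t : ℝ) : (sin (π * (((0 : ℝ) + t * I : ℂ) - θ)))⁻¹ = -stripKernel θ t := by
  have h : (π : ℂ) * (((0 : ℝ) + t * I : ℂ) - θ) = -(π * (θ - t * I)) := by
    push_cast
    ring
  rw [h, sin_neg, inv_neg, stripKernel]

/-- A lower bound for the modulus of the sine. -/
theorem abs_le_norm_sin_pi (a T : ℝ) : |T| ≤ ‖sin (π * (a + T * I))‖ := by
  have hn := Complex.sq_norm (sin (π * ((a : ℂ) + T * I)))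
  rw [normSq_apply, sin_pi_re a T, sin_pi_im a T] at hn
  have hsq : T ^ 2 ≤ ‖sin (π * ((a : ℂ) + T * I))‖ ^ 2 := by
    have hcs := Real.cosh_sq (π * T)
    have hsc := Real.sin_sq_add_cos_sq (π * a)
    have h5 : T ^ 2 ≤ Real.sinh (π * T) ^ 2 := by
      apply sq_le_sq.2
      rw [Real.abs_sinh]
      refine le_trans ?_ (Real.self_le_sinh_iff.2 (abs_nonneg _))
      rw [abs_mul, abs_of_pos Real.pi_pos]
      nlinarith [Real.pi_gt_three, abs_nonneg T]
    rw [hn]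
    have h6 : Real.sin (π * a) * Real.cosh (π * T) * (Real.sin (π * a) * Real.cosh (π * T)) +
      Real.cos (π * a) * Real.sinh (π * T) * (Real.cos (π * a) * Real.sinh (π * T)) =
      Real.sinh (π * T) ^ 2 + Real.sin (π * a) ^ 2 := by
      calc _ = Real.sin (π * a) ^ 2 * Real.cosh (π * T) ^ 2 +
            Real.cos (π * a) ^ 2 * Real.sinh (π * T) ^ 2 := by ring
        _ = Real.sinh (π * T) ^ 2 * (Real.sin (π * a) ^ 2 + Real.cos (π * a) ^ 2) +
            Real.sin (π * a) ^ 2 := by rw [hcs]; ring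
        _ = _ := by rw [hsc, mul_one]
    rw [h6]
    linarith [sq_nonneg (Real.sin (π * a))]
  have := sq_le_sq.1 hsq
  rwa [abs_norm] at this

/-! ### Integrability of the kernel and Cauchy's formula -/

section Kernel

variable {θ : ℝ} (h0 : 0 < θ) (h1 : θ < 1)
include h0 h1

theorem sin_kernel_re_pos (t : ℝ) : 0 < (sin (π * (θ - t * I))).re := by
  rw [sin_kernel_re]
  exact mul_pos (sin_pi_mul_pos h0 h1) (Real.cosh_pos _)

theorem sin_kernel_ne_zero (t : ℝ) : sin (π * (θ - t * I)) ≠ 0 := fun h => by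
  have := sin_kernel_re_pos h0 h1 t
  simp [h] at this

theorem continuous_stripKernel : Continuous (stripKernel θ) :=
  Continuous.inv₀ (by fun_prop) (sin_kernel_ne_zero h0 h1)

theorem norm_stripKernel_le (t : ℝ) : ‖stripKernel θ t‖ ≤ (Real.sin (π * θ))⁻¹ * (1 + t ^ 2)⁻¹ := by
  rw [stripKernel, norm_inv, ← mul_inv]
  have hs := sin_pi_mul_pos h0 h1
  apply inv_anti₀ (by positivity)
  refine le_trans ?_ (Complex.re_le_norm _)
  rw [sin_kernel_re]
  exact mul_le_mul_of_nonneg_left (le_cosh_pi_mul t) hs.le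

theorem integrable_stripKernel : Integrable (stripKernel θ) :=
  (integrable_inv_one_add_sq.const_mul _).mono'
    (continuous_stripKernel h0 h1).aestronglyMeasurable
    (Eventually.of_forall (norm_stripKernel_le h0 h1))

theorem integrable_stripKernel_smul {g : ℝ → E} (hg : Continuous g) {M : ℝ} (hM : ∀ t, ‖g t‖ ≤ M) :
    Integrable fun t => stripKernel θ t • g t := by
  refine ((integrable_stripKernel h0 h1).norm.mul_const M).mono'
    ((continuous_stripKernel h0 h1).smul hg).aestronglyMeasurable (Eventually.of_forall fun t => ?_)
  rw [norm_smul]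
  exact mul_le_mul_of_nonneg_left (hM t) (norm_nonneg _)

/-- The real part of the kernel is positive everywhere. The pointwise bounds divide by this
integral, whose exact value is never needed. -/
theorem integral_stripKernel_ne_zero : ∫ t, stripKernel θ t ≠ 0 := by
  intro h
  have hpos : ∀ t, 0 < (stripKernel θ t).re := fun t => by
    rw [stripKernel, inv_re]
    exact div_pos (sin_kernel_re_pos h0 h1 t) (normSq_pos.2 (sin_kernel_ne_zero h0 h1 t))
  have hi := (integrable_stripKernel h0 h1).re
  have h2 : ∫ t, (stripKernel θ t).re = 0 := by
    have := integral_re (integrable_stripKernel h0 h1)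
    rw [h] at this
    simpa using this
  have h3 := (integral_pos_iff_support_of_nonneg (fun t => (hpos t).le) hi).2 (by
    have : Function.support (fun t => (stripKernel θ t).re) = univ := by
      ext t
      simpa using (hpos t).ne'
    rw [this]
    simp)
  exact h3.ne' h2

set_option maxHeartbeats 1000000 in
/-- Cauchy's formula on the strip, for functions vanishing at `θ`. -/
theorem integral_boundary_sub [CompleteSpace E] {G : ℂ → E} (hc : ContinuousOn G closedStrip)
    (hd : DifferentiableOn ℂ G openStrip) {M : ℝ} (hM : ∀ z ∈ closedStrip, ‖G z - G θ‖ ≤ M) :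
    ∫ t, stripKernel θ t • ((G (vertical 1 t) - G θ) + (G (vertical 0 t) - G θ)) = 0 := by
  set s : ℂ → ℂ := fun z => sin (π * (z - θ)) with hs
  have hsd : Differentiable ℂ s := by fun_prop
  have hsθ : s θ = 0 := by simp [hs]
  have hsv : ∀ z, s z = sin (π * (((z.re - θ : ℝ) : ℂ) + z.im * I)) := fun z => by
    simp only [hs]
    congr 2
    conv_lhs => rw [← re_add_im z]
    push_cast
    ring
  have hsnz : ∀ z ∈ closedStrip, z ≠ θ → s z ≠ 0 := by
    intro z hz hne h
    have hre := sin_pi_re (z.re - θ) z.im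
    have him := sin_pi_im (z.re - θ) z.im
    rw [← hsv, h, zero_re, eq_comm, mul_eq_zero, or_iff_left (Real.cosh_pos _).ne'] at hre
    have hzr : z.re = θ := by
      have hlt1 : -π < π * (z.re - θ) := by nlinarith [hz.1, Real.pi_pos]
      have hlt2 : π * (z.re - θ) < π := by nlinarith [hz.2, Real.pi_pos]
      have := (Real.sin_eq_zero_iff_of_lt_of_lt hlt1 hlt2).1 hre
      rw [mul_eq_zero, or_iff_right Real.pi_pos.ne'] at this
      linarith
    rw [← hsv, h, zero_im, hzr, sub_self, mul_zero, Real.cos_zero, one_mul, eq_comm,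
      Real.sinh_eq_zero, mul_eq_zero, or_iff_right Real.pi_pos.ne'] at him
    exact hne (Complex.ext (by simp [hzr]) (by simp [him]))
  have hθ := ofReal_mem_openStrip h0 h1
  have hds : Differentiable ℂ (dslope s θ) := by
    rw [← differentiableOn_univ, Complex.differentiableOn_dslope univ_mem]
    exact hsd.differentiableOn
  have hdsnz : ∀ z ∈ closedStrip, dslope s θ z ≠ 0 := by
    intro z hz
    rcases eq_or_ne z θ with rfl | hne
    · rw [dslope_same]
      have h : HasDerivAt s (cos (π * (θ - θ)) * (π * 1)) θ :=
        (((hasDerivAt_id (θ : ℂ)).sub_const (θ : ℂ)).const_mul (π : ℂ)).csin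
      rw [h.deriv]
      simp [Real.pi_pos.ne']
    · rw [dslope_of_ne _ hne, slope_def_field, hsθ, sub_zero]
      exact div_ne_zero (hsnz z hz hne) (sub_ne_zero.2 hne)
  -- This is `(G z - G θ) / sin (π (z - θ))`. In the closed strip the sine vanishes only at `θ`, and
  -- writing the quotient with `dslope` fills in that removable singularity.
  set H : ℂ → E := fun z => (dslope s θ z)⁻¹ • dslope G θ z with hH
  have hHc : ContinuousOn H closedStrip := by
    refine (hds.continuous.continuousOn.inv₀ hdsnz).smul ?_
    rw [continuousOn_dslope (mem_of_superset (isOpen_openStrip.mem_nhds hθ) openStrip_subset)]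
    exact ⟨hc, hd.differentiableAt (isOpen_openStrip.mem_nhds hθ)⟩
  have hHd : DifferentiableOn ℂ H openStrip := by
    refine (hds.differentiableOn.inv fun z hz => hdsnz z (openStrip_subset hz)).smul ?_
    rw [Complex.differentiableOn_dslope (isOpen_openStrip.mem_nhds hθ)]
    exact hd
  have hHv : ∀ z : ℂ, z ≠ θ → H z = (s z)⁻¹ • (G z - G θ) := by
    intro z hne
    simp only [hH]
    rw [dslope_of_ne _ hne, dslope_of_ne _ hne, slope_def_field, hsθ, sub_zero, slope_def_module,
      smul_smul]
    congr 1
    have := sub_ne_zero.2 hne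
    field_simp
  have hM0 : 0 ≤ M := (norm_nonneg _).trans (hM _ (openStrip_subset hθ))
  have hright : ∀ t : ℝ, H ((1 : ℝ) + t * I) = stripKernel θ t • (G (vertical 1 t) - G θ) := by
    intro t
    rw [hHv]
    · rw [← inv_sin_right]
      simp only [hs, vertical]
    · intro h
      have := congrArg re h
      simp at this
      linarith
  have hleft : ∀ t : ℝ, H ((0 : ℝ) + t * I) = -(stripKernel θ t • (G (vertical 0 t) - G θ)) := by
    intro t
    rw [hHv]
    · rw [← neg_smul, ← inv_sin_left]
      simp only [hs, vertical]
    · intro h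
      have := congrArg re h
      simp at this
      linarith
  -- Cauchy's theorem on the rectangle of height `2T` turns the integral along the vertical sides
  -- into that along the horizontal ones, which are `O(1 / T)` because `|sin (π (z - θ))| ≥ |Im z|`.
  have hrect : ∀ T : ℝ, 0 ≤ T → ∫ t in (-T)..T, stripKernel θ t •
      ((G (vertical 1 t) - G θ) + (G (vertical 0 t) - G θ)) =
      I • ((∫ x in (0 : ℝ)..1, H (x + (-T : ℝ) * I)) - ∫ x in (0 : ℝ)..1, H (x + T * I)) := by
    intro T hT
    have hsub : [[(0 : ℝ), 1]] ×ℂ [[-T, T]] ⊆ closedStrip := by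
      intro z hz
      have := hz.1
      rw [uIcc_of_le zero_le_one] at this
      exact this
    have hsub' : Ioo (min (0 : ℝ) 1) (max 0 1) ×ℂ Ioo (min (-T) T) (max (-T) T) ⊆ openStrip := by
      intro z hz
      have := hz.1
      rw [min_eq_left zero_le_one, max_eq_right zero_le_one] at this
      exact this
    have key := integral_boundary_rect_eq_zero_of_continuousOn_of_differentiableOn H
      ⟨0, -T⟩ ⟨1, T⟩ (hHc.mono hsub) (hHd.mono hsub')
    simp only [hright, hleft] at key
    have e1 : ∫ t in (-T)..T, stripKernel θ t •
        ((G (vertical 1 t) - G θ) + (G (vertical 0 t) - G θ)) =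
        (∫ t in (-T)..T, stripKernel θ t • (G (vertical 1 t) - G θ)) -
          ∫ t in (-T)..T, -(stripKernel θ t • (G (vertical 0 t) - G θ)) := by
      rw [← intervalIntegral.integral_sub]
      · simp only [smul_add, sub_neg_eq_add]
      · exact ((continuous_stripKernel h0 h1).smul ((continuous_comp_vertical hc
          vertical_one_mem).sub continuous_const)).intervalIntegrable _ _
      · exact ((continuous_stripKernel h0 h1).smul ((continuous_comp_vertical hc
          vertical_zero_mem).sub continuous_const)).neg.intervalIntegrable _ _
    rw [e1]
    set A := ∫ t in (-T)..T, stripKernel θ t • (G (vertical 1 t) - G θ)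
    set B := ∫ t in (-T)..T, -(stripKernel θ t • (G (vertical 0 t) - G θ))
    set P := ∫ x in (0 : ℝ)..1, H (x + (-T : ℝ) * I)
    set Q := ∫ x in (0 : ℝ)..1, H (x + T * I)
    have h2 : I • (A - B) = -(P - Q) := by
      rw [smul_sub, eq_neg_iff_add_eq_zero, ← key]
      abel
    calc A - B = (-I) • (I • (A - B)) := by
          rw [smul_smul]; simp
      _ = I • (P - Q) := by rw [h2, neg_smul, smul_neg, neg_neg]
  have hhor : ∀ T : ℝ, 0 < |T| → ‖∫ x in (0 : ℝ)..1, H (x + T * I)‖ ≤ M * |T|⁻¹ := by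
    intro T hT
    have hb : ∀ x ∈ uIoc (0 : ℝ) 1, ‖H (x + T * I)‖ ≤ M * |T|⁻¹ := by
      intro x hx
      rw [uIoc_of_le zero_le_one] at hx
      have hmem : (x : ℂ) + T * I ∈ closedStrip := by
        simp [closedStrip, hx.1.le, hx.2]
      rw [hHv _ (fun h => by
        have := congrArg im h
        simp at this
        simp [this] at hT), norm_smul, norm_inv, mul_comm]
      refine mul_le_mul (hM _ hmem) (inv_anti₀ hT ?_) (by positivity) hM0
      rw [hsv]
      simp only [add_re, ofReal_re, mul_re, I_re, mul_zero, ofReal_im, I_im, mul_one, sub_self,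
        add_zero, add_im, mul_im, zero_add]
      exact abs_le_norm_sin_pi (x - θ) T
    have := intervalIntegral.norm_integral_le_of_norm_le_const hb
    simpa using this
  have hint : Integrable fun t => stripKernel θ t •
      ((G (vertical 1 t) - G θ) + (G (vertical 0 t) - G θ)) :=
    integrable_stripKernel_smul h0 h1 (((continuous_comp_vertical hc
      vertical_one_mem).sub continuous_const).add ((continuous_comp_vertical hc
      vertical_zero_mem).sub continuous_const)) (M := M + M) fun t =>
      (norm_add_le _ _).trans (add_le_add (hM _ (vertical_one_mem t)) (hM _ (vertical_zero_mem t)))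
  have hlim := intervalIntegral_tendsto_integral hint tendsto_neg_atTop_atBot tendsto_id
  refine tendsto_nhds_unique hlim ?_
  rw [tendsto_zero_iff_norm_tendsto_zero]
  have hz : Tendsto (fun T : ℝ => M * |T|⁻¹ + M * |T|⁻¹) atTop (𝓝 0) := by
    have h3 : Tendsto (fun T : ℝ => |T|⁻¹) atTop (𝓝 0) :=
      tendsto_inv_atTop_zero.comp tendsto_abs_atTop_atTop
    simpa using (h3.const_mul M).add (h3.const_mul M)
  refine squeeze_zero' (Eventually.of_forall fun _ => norm_nonneg _) ?_ hz
  filter_upwards [eventually_gt_atTop 0] with T hT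
  have hT' : 0 < |T| := by positivity
  rw [id, hrect T hT.le, norm_smul, norm_I, one_mul]
  refine (norm_sub_le _ _).trans (add_le_add ?_ (hhor T hT'))
  simpa using hhor (-T) (by simpa using hT')

/-- Cauchy's formula on the strip. -/
theorem strip_cauchy [CompleteSpace E] {G : ℂ → E} (hc : ContinuousOn G closedStrip)
    (hd : DifferentiableOn ℂ G openStrip) {M : ℝ} (hM : ∀ z ∈ closedStrip, ‖G z‖ ≤ M) :
    (2 * ∫ t, stripKernel θ t) • G θ =
      (∫ t, stripKernel θ t • G (vertical 1 t)) + ∫ t, stripKernel θ t • G (vertical 0 t) := by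
  have hθ := openStrip_subset (ofReal_mem_openStrip h0 h1)
  have key := integral_boundary_sub h0 h1 hc hd (M := M + M) fun z hz =>
    (norm_sub_le _ _).trans (add_le_add (hM z hz) (hM _ hθ))
  have i1 := integrable_stripKernel_smul h0 h1 (continuous_comp_vertical hc vertical_one_mem)
    fun t => hM _ (vertical_one_mem t)
  have i0 := integrable_stripKernel_smul h0 h1 (continuous_comp_vertical hc vertical_zero_mem)
    fun t => hM _ (vertical_zero_mem t)
  have ic : Integrable fun t => stripKernel θ t • G θ :=
    (integrable_stripKernel h0 h1).smul_const _
  have e : ∀ t, stripKernel θ t • ((G (vertical 1 t) - G θ) + (G (vertical 0 t) - G θ)) =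
      (stripKernel θ t • G (vertical 1 t) + stripKernel θ t • G (vertical 0 t)) -
      (stripKernel θ t • G θ + stripKernel θ t • G θ) := fun t => by
    simp only [smul_add, smul_sub]
    abel
  simp_rw [e] at key
  have key' := integral_sub (i1.add i0) (ic.add ic)
  simp only [Pi.add_apply] at key'
  rw [key', integral_add i1 i0, integral_add ic ic, integral_smul_const, sub_eq_zero] at key
  rw [key, two_mul, add_smul]

end Kernel

end Strip

end Butterfly

namespace Butterfly

section Calderon

variable {α : Type*} [MeasurableSpace α] {μ : Measure α} {N N₀ N₁ : ENormOn μ}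

/-! ### Integrals of functions with values in a Köthe space -/

namespace IsKotheNorm

/-- The inclusion between two Köthe spaces. -/
noncomputable def incl (h : IsKotheNorm N₀) (h' : IsKotheNorm N₁) (hle : ∀ f, N₁ f ≤ N₀ f) :
    h.Space →L[ℂ] h'.Space :=
  LinearMap.mkContinuous
    { toFun := fun f => h'.lift (h.val f)
      map_add' := fun f g => h'.val_injective (by
        have hlt : ∀ f, N₁ (h.val f) < ∞ := fun f => (hle _).trans_lt (h.val_lt_top f)
        rw [map_add h'.val, h'.val_lift (hlt _), h'.val_lift (hlt _), h'.val_lift (hlt _), map_add])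
      map_smul' := fun c f => h'.val_injective (by
        have hlt : ∀ f, N₁ (h.val f) < ∞ := fun f => (hle _).trans_lt (h.val_lt_top f)
        rw [RingHom.id_apply, map_smul h'.val, h'.val_lift (hlt _), h'.val_lift (hlt _),
          map_smul]) } 1 fun f => by
    rw [one_mul, LinearMap.coe_mk, AddHom.coe_mk, norm_def, norm_def,
      h'.val_lift ((hle _).trans_lt (h.val_lt_top f))]
    exact ENNReal.toReal_mono (h.val_lt_top f).ne (hle _)

theorem val_incl (h : IsKotheNorm N₀) (h' : IsKotheNorm N₁) (hle : ∀ f, N₁ f ≤ N₀ f)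
    (f : h.Space) : h'.val (h.incl h' hle f) = h.val f :=
  h'.val_lift ((hle _).trans_lt (h.val_lt_top f))

theorem incl_lift (h : IsKotheNorm N₀) (h' : IsKotheNorm N₁) (hle : ∀ f, N₁ f ≤ N₀ f)
    {f : L0 μ} (hf : N₀ f < ∞) : h.incl h' hle (h.lift f) = h'.lift f := by
  apply h'.val_injective
  rw [val_incl, h.val_lift hf, h'.val_lift ((hle _).trans_lt hf)]

theorem norm_lift_le (h : IsKotheNorm N) {f : L0 μ} {R : ℝ≥0} (hf : N f ≤ R) : ‖h.lift f‖ ≤ R := by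
  rw [h.norm_def, h.val_lift (hf.trans_lt ENNReal.coe_lt_top)]
  exact ENNReal.toReal_le_coe_of_le_coe hf

theorem le_of_norm_le (h : IsKotheNorm N) {f : h.Space} {R : ℝ≥0} (hf : ‖f‖ ≤ R) :
    N (h.val f) ≤ R := by
  rw [← h.enorm_eq]
  exact enorm_le_coe.2 hf

/-- The absolute value on a Köthe space. -/
noncomputable def abs' (h : IsKotheNorm N) (f : h.Space) : h.Space := h.lift (absL0 (h.val f))

theorem val_abs' (h : IsKotheNorm N) (f : h.Space) : h.val (h.abs' f) = absL0 (h.val f) :=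
  h.val_lift (by rw [h.abs]; exact h.val_lt_top f)

theorem norm_abs' (h : IsKotheNorm N) (f : h.Space) : ‖h.abs' f‖ = ‖f‖ := by
  rw [h.norm_def, h.val_abs', h.abs, h.norm_def]

theorem continuous_abs' (h : IsKotheNorm N) : Continuous h.abs' := by
  refine LipschitzWith.continuous (K := 1) fun f g => ?_
  rw [ENNReal.coe_one, one_mul, h.edist_eq, h.edist_eq, h.val_abs', h.val_abs']
  apply h.mono
  filter_upwards [AEEqFun.coeFn_sub (absL0 (h.val f)) (absL0 (h.val g)),
    AEEqFun.coeFn_sub (h.val f) (h.val g), coeFn_absL0 (h.val f), coeFn_absL0 (h.val g)]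
    with a h1 h2 h3 h4
  rw [h1, h2, Pi.sub_apply, Pi.sub_apply, h3, h4, ← Complex.ofReal_sub, Complex.norm_real]
  exact abs_norm_sub_norm_le _ _

/-- The closed convex cone of the pairs with `|f| ≤ Re g`. -/
def cone (h : IsKotheNorm N) : Set (h.Space × h.Space) :=
  {p | ∀ᵐ a ∂μ, ‖h.val p.1 a‖ ≤ (h.val p.2 a).re}

theorem smul_mem_cone (h : IsKotheNorm N) {p : h.Space × h.Space} (hp : p ∈ h.cone) {r : ℝ}
    (hr : 0 ≤ r) : r • p ∈ h.cone := by
  have hp' : ∀ᵐ a ∂μ, ‖h.val p.1 a‖ ≤ (h.val p.2 a).re := hp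
  change ∀ᵐ a ∂μ, ‖h.val (r • p.1) a‖ ≤ (h.val (r • p.2) a).re
  rw [← Complex.coe_smul, ← Complex.coe_smul, map_smul, map_smul]
  filter_upwards [hp', AEEqFun.coeFn_smul (r : ℂ) (h.val p.1),
    AEEqFun.coeFn_smul (r : ℂ) (h.val p.2)] with a h1 h2 h3
  rw [h2, h3, Pi.smul_apply, Pi.smul_apply, norm_smul, smul_eq_mul, Complex.re_ofReal_mul,
    Complex.norm_real, Real.norm_eq_abs, abs_of_nonneg hr]
  exact mul_le_mul_of_nonneg_left h1 hr

theorem add_mem_cone (h : IsKotheNorm N) {p q : h.Space × h.Space} (hp : p ∈ h.cone)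
    (hq : q ∈ h.cone) : p + q ∈ h.cone := by
  have hp' : ∀ᵐ a ∂μ, ‖h.val p.1 a‖ ≤ (h.val p.2 a).re := hp
  have hq' : ∀ᵐ a ∂μ, ‖h.val q.1 a‖ ≤ (h.val q.2 a).re := hq
  change ∀ᵐ a ∂μ, ‖h.val (p.1 + q.1) a‖ ≤ (h.val (p.2 + q.2) a).re
  rw [map_add, map_add]
  filter_upwards [hp', hq', AEEqFun.coeFn_add (h.val p.1) (h.val q.1),
    AEEqFun.coeFn_add (h.val p.2) (h.val q.2)] with a h1 h2 h3 h4
  rw [h3, h4, Pi.add_apply, Pi.add_apply, Complex.add_re]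
  exact (norm_add_le _ _).trans (add_le_add h1 h2)

theorem convex_cone (h : IsKotheNorm N) : Convex ℝ h.cone := fun _ hp _ hq _ _ ha hb _ =>
  h.add_mem_cone (h.smul_mem_cone hp ha) (h.smul_mem_cone hq hb)

/-- For a limit `(f, g)` of pairs `(f_n, g_n)` in the cone, the positive part of `|f| - Re g` is
dominated by `|f_n - f| + |g_n - g|`. Its norm is thus zero, without passing to an almost everywhere
convergent subsequence. -/
theorem isClosed_cone (h : IsKotheNorm N) : IsClosed h.cone := by
  refine isClosed_of_closure_subset fun p hp => ?_
  obtain ⟨u, hu, hlim⟩ := mem_closure_iff_seq_limit.1 hp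
  have hm : AEStronglyMeasurable
      (fun a => ((max (‖h.val p.1 a‖ - (h.val p.2 a).re) 0 : ℝ) : ℂ)) μ := by
    have h1 := (h.val p.1).measurable
    have h2 := (h.val p.2).measurable
    apply Measurable.aestronglyMeasurable
    fun_prop
  set d : L0 μ := AEEqFun.mk _ hm with hd
  have h1 := (h.tendsto_iff _ _).1 ((continuous_fst.tendsto p).comp hlim)
  have h2 := (h.tendsto_iff _ _).1 ((continuous_snd.tendsto p).comp hlim)
  have h12 := h1.add h2
  rw [add_zero] at h12
  have hle : ∀ n, N d ≤ N (h.val (u n).1 - h.val p.1) + N (h.val (u n).2 - h.val p.2) := by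
    intro n
    have hun : ∀ᵐ a ∂μ, ‖h.val (u n).1 a‖ ≤ (h.val (u n).2 a).re := hu n
    rw [← h.abs (h.val (u n).1 - h.val p.1), ← h.abs (h.val (u n).2 - h.val p.2)]
    refine le_trans (h.mono _ _ ?_) (h.add_le _ _)
    filter_upwards [hun, AEEqFun.coeFn_mk _ hm,
      AEEqFun.coeFn_add (absL0 (h.val (u n).1 - h.val p.1)) (absL0 (h.val (u n).2 - h.val p.2)),
      coeFn_absL0 (h.val (u n).1 - h.val p.1), coeFn_absL0 (h.val (u n).2 - h.val p.2),
      AEEqFun.coeFn_sub (h.val (u n).1) (h.val p.1),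
      AEEqFun.coeFn_sub (h.val (u n).2) (h.val p.2)] with a g1 g2 g3 g4 g5 g6 g7
    rw [hd, g2, g3, Pi.add_apply, g4, g5, g6, g7, Pi.sub_apply, Pi.sub_apply,
      ← Complex.ofReal_add, Complex.norm_real, Complex.norm_real, Real.norm_eq_abs,
      Real.norm_eq_abs, abs_of_nonneg (le_max_right _ _), abs_of_nonneg (by positivity)]
    refine max_le ?_ (by positivity)
    have e1 := norm_sub_norm_le (h.val p.1 a) (h.val (u n).1 a)
    rw [norm_sub_rev] at e1
    have e2 := Complex.re_le_norm (h.val (u n).2 a - h.val p.2 a)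
    rw [Complex.sub_re] at e2
    linarith
  have h0 : N d = 0 :=
    le_antisymm (ge_of_tendsto h12 (Eventually.of_forall hle)) zero_le
  rw [h.eq_zero_iff] at h0
  change ∀ᵐ a ∂μ, ‖h.val p.1 a‖ ≤ (h.val p.2 a).re
  filter_upwards [AEEqFun.coeFn_mk _ hm, AEEqFun.coeFn_zero (μ := μ) (α := α) (β := ℂ)] with a h1 h2
  rw [← hd, h0, h2, Pi.zero_apply] at h1
  have h3 : max (‖h.val p.1 a‖ - (h.val p.2 a).re) 0 = 0 := by
    have := h1.symm
    exact_mod_cast this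
  have := le_max_left (‖h.val p.1 a‖ - (h.val p.2 a).re) 0
  linarith

/-- The absolute value of an integral is at most the integral of the absolute value. -/
theorem norm_integral_le (h : IsKotheNorm N) [CompleteSpace h.Space] {f g : ℝ → h.Space}
    (hf : Integrable f) (hg : Integrable g)
    (hfg : ∀ t, ∀ᵐ a ∂μ, ‖h.val (f t) a‖ ≤ (h.val (g t) a).re) :
    ∀ᵐ a ∂μ, ‖h.val (∫ t, f t) a‖ ≤ (h.val (∫ t, g t) a).re := by
  -- Averages over sets of finite measure stay in a closed convex set, and a cone is stable under
  -- rescaling to the integral. The whole line has infinite measure and is reached as a limit of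
  -- intervals.
  have hfin : ∀ T : ℝ, 0 < T → ∫ t in (-T)..T, (f t, g t) ∈ h.cone := by
    intro T hT
    have hv : volume (Set.Ioc (-T) T) = ENNReal.ofReal (2 * T) := by
      rw [Real.volume_Ioc]; congr 1; ring
    have hvr : volume.real (Set.Ioc (-T) T) = 2 * T := by
      rw [measureReal_def, hv, ENNReal.toReal_ofReal (by positivity)]
    have key := h.convex_cone.set_average_mem h.isClosed_cone (μ := volume)
      (t := Set.Ioc (-T) T) (f := fun t => (f t, g t))
      (by rw [hv]; simpa using hT) (by rw [hv]; exact ENNReal.ofReal_ne_top)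
      (Eventually.of_forall hfg) (hf.prodMk hg).integrableOn
    rw [setAverage_eq, hvr] at key
    rw [intervalIntegral.integral_of_le (by linarith)]
    have := h.smul_mem_cone key (r := 2 * T) (by positivity)
    rwa [smul_smul, mul_inv_cancel₀ (by positivity), one_smul] at this
  have hlim := intervalIntegral_tendsto_integral (hf.prodMk hg) tendsto_neg_atTop_atBot tendsto_id
  have hmem : ∫ t, (f t, g t) ∈ h.cone := by
    refine h.isClosed_cone.mem_of_tendsto hlim ?_
    filter_upwards [eventually_gt_atTop 0] with T hT using hfin T hT
  rw [integral_pair hf hg] at hmem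
  exact hmem

end IsKotheNorm

/-! ### Elements of the Calderón space as functions with values in a Banach space -/

section Lift

variable (h₀ : IsKothe N₀) (h₁ : IsKothe N₁)

namespace MemCalderon

variable {h₀ h₁} {F : ℂ → L0 μ} (hF : MemCalderon N₀ N₁ F)
include hF

theorem sumNorm_lt_top {z : ℂ} (hz : z ∈ closedStrip) : sumNorm N₀ N₁ (F z) < ∞ := by
  obtain ⟨M, hM⟩ := hF.bounded
  exact (hM z hz).trans_lt ENNReal.coe_lt_top

theorem val_lift (hs : IsKotheNorm (sumNorm N₀ N₁)) {z : ℂ} (hz : z ∈ closedStrip) :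
    hs.val (hs.lift (F z)) = F z := hs.val_lift (hF.sumNorm_lt_top hz)

theorem continuousOn_lift (hs : IsKotheNorm (sumNorm N₀ N₁)) :
    ContinuousOn (fun z => hs.lift (F z)) closedStrip := by
  intro z hz
  refine (hs.tendsto_iff _ _).2 ?_
  refine (hF.cont z hz).congr' ?_
  filter_upwards [self_mem_nhdsWithin] with w hw
  rw [hF.val_lift hs hw, hF.val_lift hs hz]

/-- `HasDerivIn` does not require `D` to lie in the sum space. It does lie there, since at some
nearby point both the difference quotient and its distance to `D` have finite norm. -/
theorem hasDerivAt_lift (hs : IsKotheNorm (sumNorm N₀ N₁)) {z : ℂ} (hz : z ∈ openStrip) {D : L0 μ}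
    (hD : HasDerivIn (sumNorm N₀ N₁) F D z) :
    sumNorm N₀ N₁ D < ∞ ∧ HasDerivAt (fun z => hs.lift (F z)) (hs.lift D) z := by
  have hmem : ∀ᶠ w in 𝓝[≠] z, w ∈ closedStrip :=
    mem_nhdsWithin_of_mem_nhds (mem_of_superset (isOpen_openStrip.mem_nhds hz) openStrip_subset)
  have hDlt : sumNorm N₀ N₁ D < ∞ := by
    obtain ⟨w, hw, hwm⟩ := ((hD.eventually (gt_mem_nhds zero_lt_one)).and hmem).exists
    set q := (w - z)⁻¹ • (F w - F z)
    have hq : sumNorm N₀ N₁ q < ∞ := by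
      rw [hs.smul]
      exact ENNReal.mul_lt_top enorm_lt_top ((hs.sub_le _ _).trans_lt (ENNReal.add_lt_top.2
        ⟨hF.sumNorm_lt_top hwm, hF.sumNorm_lt_top (openStrip_subset hz)⟩))
    have : D = q - (q - D) := by abel
    rw [this]
    exact (hs.sub_le _ _).trans_lt (ENNReal.add_lt_top.2 ⟨hq, hw.trans ENNReal.one_lt_top⟩)
  refine ⟨hDlt, ?_⟩
  rw [hasDerivAt_iff_tendsto_slope, hs.tendsto_iff]
  refine Tendsto.congr' ?_ hD
  filter_upwards [hmem] with w hw
  rw [slope_def_module, map_smul, map_sub, hF.val_lift hs hw, hF.val_lift hs (openStrip_subset hz),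
    hs.val_lift hDlt]

theorem differentiableOn_lift (hs : IsKotheNorm (sumNorm N₀ N₁)) :
    DifferentiableOn ℂ (fun z => hs.lift (F z)) openStrip := fun z hz => by
  obtain ⟨D, hD⟩ := hF.analytic z hz
  exact (hF.hasDerivAt_lift hs hz hD).2.differentiableAt.differentiableWithinAt

theorem exists_norm_lift_le (hs : IsKotheNorm (sumNorm N₀ N₁)) :
    ∃ M : ℝ, ∀ z ∈ closedStrip, ‖hs.lift (F z)‖ ≤ M := by
  obtain ⟨M, hM⟩ := hF.bounded
  exact ⟨M, fun z hz => hs.norm_lift_le (hM z hz)⟩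

end MemCalderon

theorem IsC0OnLine.continuous_lift (h : IsKotheNorm N) {F : ℂ → L0 μ} {j : ℝ}
    (hF : IsC0OnLine N F j) : Continuous fun t => h.lift (F (vertical j t)) := by
  rw [continuous_iff_continuousAt]
  intro t
  refine (h.tendsto_iff _ _).2 ((hF.cont t).congr fun s => ?_)
  rw [h.val_lift (hF.mem _), h.val_lift (hF.mem _)]

theorem norm_left_le {F : ℂ → L0 μ} (t : ℝ) : N₀ (F (vertical 0 t)) ≤ calderonNorm N₀ N₁ F :=
  le_max_of_le_left (le_iSup (fun t : ℝ => N₀ (F (vertical 0 t))) t)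

theorem norm_right_le {F : ℂ → L0 μ} (t : ℝ) : N₁ (F (vertical 1 t)) ≤ calderonNorm N₀ N₁ F :=
  le_max_of_le_right (le_iSup (fun t : ℝ => N₁ (F (vertical 1 t))) t)

theorem calderonNorm_le {F : ℂ → L0 μ} {R : ℝ≥0∞} (h0 : ∀ t, N₀ (F (vertical 0 t)) ≤ R)
    (h1 : ∀ t, N₁ (F (vertical 1 t)) ≤ R) : calderonNorm N₀ N₁ F ≤ R :=
  max_le (iSup_le h0) (iSup_le h1)

include h₀ h₁ in
/-- The maximum principle in the Calderón space. -/
theorem MemCalderon.sumNorm_le {F : ℂ → L0 μ} (hF : MemCalderon N₀ N₁ F) {z : ℂ}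
    (hz : z ∈ closedStrip) : sumNorm N₀ N₁ (F z) ≤ calderonNorm N₀ N₁ F := by
  have hs := sumNorm_isKotheNorm h₀ h₁
  rcases eq_or_ne (calderonNorm N₀ N₁ F) ∞ with h | h
  · rw [h]; exact le_top
  lift calderonNorm N₀ N₁ F to ℝ≥0 using h with R hR
  obtain ⟨M, hM⟩ := hF.exists_norm_lift_le hs
  have := norm_le_of_boundary (hF.continuousOn_lift hs) (hF.differentiableOn_lift hs) hM (C := R)
    (fun t => hs.norm_lift_le ((sumNorm_le_left h₁.norm _).trans (hR ▸ norm_left_le t)))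
    (fun t => hs.norm_lift_le ((sumNorm_le_right h₀.norm _).trans (hR ▸ norm_right_le t))) hz
  have := hs.le_of_norm_le this
  rwa [hF.val_lift hs hz] at this

end Lift

end Calderon

end Butterfly

namespace Butterfly

section Pointwise

variable {α : Type*} [MeasurableSpace α] {μ : Measure α} {N N₀ N₁ : ENormOn μ}

/-! ### Pointwise bounds for elements of the Calderón space -/

theorem integrable_kernel_mul_smul {E : Type*} [NormedAddCommGroup E] [NormedSpace ℂ E] {θ : ℝ}
    (h0 : 0 < θ) (h1 : θ < 1) {φ : ℝ → ℂ} (hφ : Continuous φ) {c : ℝ} (hφc : ∀ t, ‖φ t‖ ≤ c)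
    {f : ℝ → E} (hf : Continuous f) {R : ℝ} (hR : ∀ t, ‖f t‖ ≤ R) :
    Integrable fun t => (stripKernel θ t * φ t) • f t := by
  simp_rw [mul_smul]
  refine integrable_stripKernel_smul h0 h1 (hφ.smul hf) (M := c * R) fun t => ?_
  rw [norm_smul]
  exact mul_le_mul (hφc t) (hR t) (norm_nonneg _) ((norm_nonneg _).trans (hφc t))

/-- The average of `|f|` against the modulus of the kernel. -/
noncomputable def kernelAverage (h : IsKotheNorm N) (θ : ℝ) (f : ℝ → h.Space) : h.Space :=
  ∫ t, ‖stripKernel θ t‖ • h.abs' (f t)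

theorem norm_kernelAverage_le (h : IsKotheNorm N) {θ : ℝ} (h0 : 0 < θ) (h1 : θ < 1)
    {f : ℝ → h.Space} {R : ℝ} (hR : ∀ t, ‖f t‖ ≤ R) :
    ‖kernelAverage h θ f‖ ≤ (∫ t, ‖stripKernel θ t‖) * R := by
  refine (MeasureTheory.norm_integral_le_of_norm_le
    ((integrable_stripKernel h0 h1).norm.mul_const R) (Eventually.of_forall fun t => ?_)).trans_eq
    (integral_mul_const _ _)
  rw [norm_smul, norm_norm, h.norm_abs']
  exact mul_le_mul_of_nonneg_left (hR t) (norm_nonneg _)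

/-- The scalar factor `φ` enters the majorant only through its bound `c`; the average itself depends
on `f` alone. With `φ` an exponential of parameter `s`, a single average then serves all `s`. -/
theorem norm_integral_kernel_le (h : IsKotheNorm N) [CompleteSpace h.Space] {θ : ℝ}
    (h0 : 0 < θ) (h1 : θ < 1) {φ : ℝ → ℂ} (hφ : Continuous φ) {c : ℝ} (hφc : ∀ t, ‖φ t‖ ≤ c)
    {f : ℝ → h.Space} (hf : Continuous f) {R : ℝ} (hR : ∀ t, ‖f t‖ ≤ R) :
    ∀ᵐ a ∂μ, ‖h.val (∫ t, (stripKernel θ t * φ t) • f t) a‖ ≤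
      c * ‖h.val (kernelAverage h θ f) a‖ := by
  have hc : 0 ≤ c := (norm_nonneg _).trans (hφc 0)
  have hg : Integrable fun t => ‖stripKernel θ t‖ • h.abs' (f t) := by
    have := integrable_stripKernel_smul h0 h1 (h.continuous_abs'.comp hf) (M := R)
      (fun t => (h.norm_abs' _).trans_le (hR t))
    refine this.mono ((continuous_stripKernel h0 h1).norm.smul
      (h.continuous_abs'.comp hf)).aestronglyMeasurable (Eventually.of_forall fun t => ?_)
    rw [norm_smul, norm_smul, norm_norm]
    rfl
  have key := h.norm_integral_le (integrable_kernel_mul_smul h0 h1 hφ hφc hf hR) (hg.smul c)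
    fun t => by
      have e : h.val (c • ‖stripKernel θ t‖ • h.abs' (f t)) =
          ((c * ‖stripKernel θ t‖ : ℝ) : ℂ) • absL0 (h.val (f t)) := by
        rw [smul_smul, ← Complex.coe_smul, map_smul, h.val_abs']
      simp only [Pi.smul_apply]
      rw [e, map_smul]
      filter_upwards [AEEqFun.coeFn_smul (stripKernel θ t * φ t) (h.val (f t)),
        AEEqFun.coeFn_smul ((c * ‖stripKernel θ t‖ : ℝ) : ℂ) (absL0 (h.val (f t))),
        coeFn_absL0 (h.val (f t))] with a g1 g2 g3
      rw [g1, g2, Pi.smul_apply, Pi.smul_apply, g3, norm_smul, smul_eq_mul, norm_mul,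
        ← Complex.ofReal_mul, Complex.ofReal_re, mul_comm c]
      exact mul_le_mul_of_nonneg_right (mul_le_mul_of_nonneg_left (hφc t) (norm_nonneg _))
        (norm_nonneg _)
  have e : h.val (∫ t, (c • fun t => ‖stripKernel θ t‖ • h.abs' (f t)) t) =
      (c : ℂ) • h.val (kernelAverage h θ f) := by
    simp only [Pi.smul_apply]
    rw [integral_smul, ← Complex.coe_smul, map_smul]
    rfl
  rw [e] at key
  filter_upwards [key, AEEqFun.coeFn_smul (c : ℂ) (h.val (kernelAverage h θ f))] with a g1 g2
  rw [g2, Pi.smul_apply, smul_eq_mul, Complex.re_ofReal_mul] at g1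
  exact g1.trans (mul_le_mul_of_nonneg_left (Complex.re_le_norm _) hc)

/-- A pointwise form of Cauchy's formula on the strip, for functions with boundary values
`φ f + ψ w` with scalar functions `φ`, `ψ` and a fixed vector `w`. -/
theorem norm_strip_le (h₀ : IsKothe N₀) (h₁ : IsKothe N₁) (hs : IsKothe (sumNorm N₀ N₁)) {θ : ℝ}
    (h0 : 0 < θ) (h1 : θ < 1)
    {f₀ : ℝ → h₀.norm.Space} {f₁ : ℝ → h₁.norm.Space} (hf₀ : Continuous f₀) (hf₁ : Continuous f₁)
    {R : ℝ} (hR₀ : ∀ t, ‖f₀ t‖ ≤ R) (hR₁ : ∀ t, ‖f₁ t‖ ≤ R)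
    {G : ℂ → hs.norm.Space} (hc : ContinuousOn G closedStrip) (hd : DifferentiableOn ℂ G openStrip)
    {M : ℝ} (hM : ∀ z ∈ closedStrip, ‖G z‖ ≤ M) (w : hs.norm.Space)
    {φ₀ φ₁ ψ : ℝ → ℂ} (hφ₀ : Continuous φ₀) (hφ₁ : Continuous φ₁) {c₀ c₁ : ℝ}
    (hc₀ : ∀ t, ‖φ₀ t‖ ≤ c₀) (hc₁ : ∀ t, ‖φ₁ t‖ ≤ c₁) (hψ : Continuous ψ) {d : ℝ}
    (hψd : ∀ t, ‖ψ t‖ ≤ d)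
    (hG : ∀ t, G (vertical 1 t) + G (vertical 0 t) =
      φ₁ t • h₁.norm.incl hs.norm (sumNorm_le_right h₀.norm) (f₁ t) +
      φ₀ t • h₀.norm.incl hs.norm (sumNorm_le_left h₁.norm) (f₀ t) + ψ t • w) :
    ∀ᵐ a ∂μ, ‖2 * ∫ t, stripKernel θ t‖ * ‖hs.norm.val (G θ) a‖ ≤
      c₁ * ‖h₁.norm.val (kernelAverage h₁.norm θ f₁) a‖ +
      c₀ * ‖h₀.norm.val (kernelAverage h₀.norm θ f₀) a‖ +
      (∫ t, ‖stripKernel θ t‖) * d * ‖hs.norm.val w a‖ := by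
  have := Fact.mk h₀
  have := Fact.mk h₁
  have := Fact.mk hs
  have hcau := strip_cauchy h0 h1 hc hd hM
  have i1 := integrable_kernel_mul_smul h0 h1 hφ₁ hc₁ hf₁ hR₁
  have i0 := integrable_kernel_mul_smul h0 h1 hφ₀ hc₀ hf₀ hR₀
  have iw : Integrable fun t => stripKernel θ t * ψ t := by
    simpa only [smul_eq_mul] using integrable_stripKernel_smul h0 h1 hψ hψd
  -- The two boundary integrals are merged under the common kernel, because `hG` describes only the
  -- sum of the two boundary values.
  rw [← integral_add (integrable_stripKernel_smul h0 h1 (continuous_comp_vertical hc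
    vertical_one_mem) fun t => hM _ (vertical_one_mem t)) (integrable_stripKernel_smul h0 h1
    (continuous_comp_vertical hc vertical_zero_mem) fun t => hM _ (vertical_zero_mem t))] at hcau
  have e : ∀ t, stripKernel θ t • G (vertical 1 t) + stripKernel θ t • G (vertical 0 t) =
      h₁.norm.incl hs.norm (sumNorm_le_right h₀.norm) ((stripKernel θ t * φ₁ t) • f₁ t) +
      h₀.norm.incl hs.norm (sumNorm_le_left h₁.norm) ((stripKernel θ t * φ₀ t) • f₀ t) +
      (stripKernel θ t * ψ t) • w := fun t => by
    rw [← smul_add, hG, smul_add, smul_add, smul_smul, smul_smul, smul_smul, map_smul, map_smul]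
  simp_rw [e] at hcau
  have j1 := (h₁.norm.incl hs.norm (sumNorm_le_right h₀.norm)).integrable_comp i1
  have j0 := (h₀.norm.incl hs.norm (sumNorm_le_left h₁.norm)).integrable_comp i0
  have e2 := integral_add (j1.add j0) (iw.smul_const w)
  have e3 := integral_add j1 j0
  simp only [Pi.add_apply] at e2
  rw [e2, e3, ContinuousLinearMap.integral_comp_comm _ i1,
    ContinuousLinearMap.integral_comp_comm _ i0, integral_smul_const] at hcau
  have hval := congrArg hs.norm.val hcau
  rw [map_smul, map_add, map_add, map_smul, IsKotheNorm.val_incl, IsKotheNorm.val_incl] at hval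
  have b1 := norm_integral_kernel_le h₁.norm h0 h1 hφ₁ hc₁ hf₁ hR₁
  have b0 := norm_integral_kernel_le h₀.norm h0 h1 hφ₀ hc₀ hf₀ hR₀
  set v1 := h₁.norm.val (∫ t, (stripKernel θ t * φ₁ t) • f₁ t)
  set v0 := h₀.norm.val (∫ t, (stripKernel θ t * φ₀ t) • f₀ t)
  have bw : ‖∫ t, stripKernel θ t * ψ t‖ ≤ (∫ t, ‖stripKernel θ t‖) * d := by
    rw [← integral_mul_const]
    refine norm_integral_le_of_norm_le ((integrable_stripKernel h0 h1).norm.mul_const d)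
      (Eventually.of_forall fun t => ?_)
    rw [norm_mul]
    exact mul_le_mul_of_nonneg_left (hψd t) (norm_nonneg _)
  set W := ∫ t, stripKernel θ t * ψ t
  set C := 2 * ∫ t, stripKernel θ t
  filter_upwards [b1, b0, AEEqFun.coeFn_smul C (hs.norm.val (G θ)),
    AEEqFun.coeFn_add (v1 + v0) (W • hs.norm.val w), AEEqFun.coeFn_add v1 v0,
    AEEqFun.coeFn_smul W (hs.norm.val w)] with a g1 g0 g2 g3 g4 g5
  have : C * hs.norm.val (G θ) a = v1 a + v0 a + W * hs.norm.val w a := by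
    calc C * hs.norm.val (G θ) a = (C • hs.norm.val (G θ) : L0 μ) a := by
          rw [g2, Pi.smul_apply, smul_eq_mul]
      _ = (v1 + v0 + W • hs.norm.val w : L0 μ) a := by rw [hval]
      _ = _ := by rw [g3, Pi.add_apply, g4, g5, Pi.add_apply, Pi.smul_apply, smul_eq_mul]
  rw [← norm_mul, this]
  refine (norm_add_le _ _).trans (add_le_add ((norm_add_le _ _).trans (add_le_add g1 g0)) ?_)
  rw [norm_mul]
  exact mul_le_mul_of_nonneg_right bw (norm_nonneg _)

end Pointwise

end Butterfly

namespace Butterfly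

/-! ### Pointwise bounds uniform in the exponential parameter -/

section PointwiseBound

variable {α : Type*} [MeasurableSpace α] {μ : Measure α} {N N₀ N₁ : ENormOn μ}

theorem norm_exp_mul_sub (s θ : ℝ) (z : ℂ) :
    ‖Complex.exp (s * (z - θ))‖ = Real.exp (s * (z.re - θ)) := by
  rw [Complex.norm_exp]
  simp

theorem norm_exp_mul_sub_le (s : ℝ) {θ : ℝ} (h0 : 0 < θ) (h1 : θ < 1) {z : ℂ}
    (hz : z ∈ closedStrip) : ‖Complex.exp (s * (z - θ))‖ ≤ Real.exp |s| := by
  rw [norm_exp_mul_sub]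
  apply Real.exp_le_exp.2
  refine (le_abs_self _).trans ?_
  rw [abs_mul]
  refine mul_le_of_le_one_right (abs_nonneg _) ?_
  rw [abs_le]
  constructor <;> linarith [hz.1, hz.2]

theorem vertical_sub_ne_zero {j θ : ℝ} (hj : j ≠ θ) (t : ℝ) : vertical j t - θ ≠ 0 := fun h => by
  have := congrArg Complex.re h
  rw [Complex.sub_re, vertical_re, Complex.ofReal_re, Complex.zero_re] at this
  exact hj (by linarith)

theorem norm_inv_vertical_sub_le {j θ : ℝ} (hj : j ≠ θ) (t : ℝ) :
    ‖(vertical j t - θ)⁻¹‖ ≤ |j - θ|⁻¹ := by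
  rw [norm_inv]
  refine inv_anti₀ (abs_pos.2 (sub_ne_zero.2 hj)) ?_
  have := Complex.abs_re_le_norm (vertical j t - θ)
  rwa [Complex.sub_re, vertical_re, Complex.ofReal_re] at this

/-- The difference quotients of a bounded function on the strip are bounded. -/
theorem exists_norm_dslope_le {E : Type*} [NormedAddCommGroup E] [NormedSpace ℂ E]
    {θ : ℝ} (h0 : 0 < θ) (h1 : θ < 1) {G : ℂ → E}
    (hc : ContinuousOn (dslope G θ) closedStrip) {M : ℝ} (hM : ∀ z ∈ closedStrip, ‖G z‖ ≤ M) :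
    ∃ M', ∀ z ∈ closedStrip, ‖dslope G θ z‖ ≤ M' := by
  have hθ := ofReal_mem_openStrip h0 h1
  obtain ⟨r, hr, hball⟩ := Metric.isOpen_iff.1 isOpen_openStrip _ hθ
  have hsub : Metric.closedBall (θ : ℂ) (r / 2) ⊆ closedStrip :=
    ((Metric.closedBall_subset_ball (half_lt_self hr)).trans hball).trans openStrip_subset
  obtain ⟨M₁, hM₁⟩ := (isCompact_closedBall (θ : ℂ) (r / 2)).exists_bound_of_continuousOn
    (hc.mono hsub)
  refine ⟨max M₁ ((r / 2)⁻¹ * (M + M)), fun z hz => ?_⟩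
  by_cases h : z ∈ Metric.closedBall (θ : ℂ) (r / 2)
  · exact le_max_of_le_left (hM₁ z h)
  · rw [Metric.mem_closedBall, dist_eq_norm, not_le] at h
    refine le_max_of_le_right ?_
    have hne : z ≠ θ := fun h' => by
      rw [h', sub_self, norm_zero] at h
      linarith
    rw [dslope_of_ne _ hne, slope_def_module, norm_smul, norm_inv]
    refine mul_le_mul (inv_anti₀ (by positivity) h.le) ((norm_sub_le _ _).trans
      (add_le_add (hM z hz) (hM _ (openStrip_subset hθ)))) (norm_nonneg _) (by positivity)

/-- The bounds with a fixed real parameter. -/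
theorem MemCalderon.norm_le_kernelAverage (h₀ : IsKothe N₀) (h₁ : IsKothe N₁) {θ : ℝ} (h0 : 0 < θ)
    (h1 : θ < 1) {F : ℂ → L0 μ} (hF : MemCalderon N₀ N₁ F) {R : ℝ≥0}
    (hR : calderonNorm N₀ N₁ F ≤ R) {D : L0 μ} (hD : HasDerivIn (sumNorm N₀ N₁) F D θ) (s : ℝ) :
    ∀ᵐ a ∂μ,
      ‖2 * ∫ t, stripKernel θ t‖ * ‖F θ a‖ ≤ Real.exp (s * (1 - θ)) *
          ‖h₁.norm.val (kernelAverage h₁.norm θ fun t => h₁.norm.lift (F (vertical 1 t))) a‖ +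
        Real.exp (s * (0 - θ)) *
          ‖h₀.norm.val (kernelAverage h₀.norm θ fun t => h₀.norm.lift (F (vertical 0 t))) a‖ ∧
      ‖2 * ∫ t, stripKernel θ t‖ * ‖D a + s * F θ a‖ ≤ |1 - θ|⁻¹ * Real.exp (s * (1 - θ)) *
          ‖h₁.norm.val (kernelAverage h₁.norm θ fun t => h₁.norm.lift (F (vertical 1 t))) a‖ +
        |0 - θ|⁻¹ * Real.exp (s * (0 - θ)) *
          ‖h₀.norm.val (kernelAverage h₀.norm θ fun t => h₀.norm.lift (F (vertical 0 t))) a‖ +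
        (∫ t, ‖stripKernel θ t‖) * (|1 - θ|⁻¹ + |0 - θ|⁻¹) * ‖F θ a‖ := by
  have hs := sumNorm_isKothe h₀ h₁
  have := Fact.mk hs
  have hθ := ofReal_mem_openStrip h0 h1
  set f₀ := fun t => h₀.norm.lift (F (vertical 0 t)) with hf₀
  set f₁ := fun t => h₁.norm.lift (F (vertical 1 t)) with hf₁
  have cf₀ : Continuous f₀ := hF.left.continuous_lift h₀.norm
  have cf₁ : Continuous f₁ := hF.right.continuous_lift h₁.norm
  have hR₀ : ∀ t, ‖f₀ t‖ ≤ R := fun t => h₀.norm.norm_lift_le ((norm_left_le t).trans hR)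
  have hR₁ : ∀ t, ‖f₁ t‖ ≤ R := fun t => h₁.norm.norm_lift_le ((norm_right_le t).trans hR)
  set e : ℂ → hs.norm.Space := fun z => hs.norm.lift (F z) with he
  have ce : ContinuousOn e closedStrip := hF.continuousOn_lift hs.norm
  have de : DifferentiableOn ℂ e openStrip := hF.differentiableOn_lift hs.norm
  obtain ⟨M, hM⟩ := hF.exists_norm_lift_le hs.norm
  have hM0 : 0 ≤ M := (norm_nonneg _).trans (hM _ (openStrip_subset hθ))
  obtain ⟨hDlt, hDe⟩ := hF.hasDerivAt_lift hs.norm hθ hD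
  -- This weight equals `1` at `θ` and has constant modulus `e^{s(j - θ)}` on the line `Re z = j`.
  -- Multiplying by it keeps the value at `θ` and adds `s F θ` to the derivative there.
  set x : ℂ → ℂ := fun z => Complex.exp (s * (z - θ)) with hx
  have hxd : Differentiable ℂ x := by fun_prop
  have hxθ : x θ = 1 := by simp [hx]
  set G : ℂ → hs.norm.Space := fun z => x z • e z with hG
  have cG : ContinuousOn G closedStrip := hxd.continuous.continuousOn.smul ce
  have dG : DifferentiableOn ℂ G openStrip := hxd.differentiableOn.smul de
  have hMG : ∀ z ∈ closedStrip, ‖G z‖ ≤ Real.exp |s| * M := fun z hz => by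
    rw [hG, norm_smul]
    exact mul_le_mul (norm_exp_mul_sub_le s h0 h1 hz) (hM z hz) (norm_nonneg _) (by positivity)
  have hGθ : G θ = e θ := by simp [hG, hxθ]
  have cDG : ContinuousOn (dslope G θ) closedStrip := by
    rw [continuousOn_dslope (mem_of_superset (isOpen_openStrip.mem_nhds hθ) openStrip_subset)]
    exact ⟨cG, dG.differentiableAt (isOpen_openStrip.mem_nhds hθ)⟩
  have dDG : DifferentiableOn ℂ (dslope G θ) openStrip := by
    rw [Complex.differentiableOn_dslope (isOpen_openStrip.mem_nhds hθ)]
    exact dG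
  obtain ⟨M', hM'⟩ := exists_norm_dslope_le h0 h1 cDG hMG
  have hne0 : (0 : ℝ) ≠ θ := h0.ne
  have hne1 : (1 : ℝ) ≠ θ := h1.ne'
  have nv : ∀ (j t : ℝ), ‖x (vertical j t)‖ = Real.exp (s * (j - θ)) := fun j t => by
    rw [hx, norm_exp_mul_sub, vertical_re]
  have cv : ∀ j : ℝ, Continuous fun t => x (vertical j t) := fun j =>
    hxd.continuous.comp (continuous_vertical j)
  have ci : ∀ j : ℝ, j ≠ θ → Continuous fun t => (vertical j t - θ)⁻¹ := fun j hj =>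
    ((continuous_vertical j).sub continuous_const).inv₀ (vertical_sub_ne_zero hj)
  have e1 : ∀ t, h₁.norm.incl hs.norm (sumNorm_le_right h₀.norm) (f₁ t) = e (vertical 1 t) :=
    fun t => h₁.norm.incl_lift _ _ (hF.right.mem t)
  have e0 : ∀ t, h₀.norm.incl hs.norm (sumNorm_le_left h₁.norm) (f₀ t) = e (vertical 0 t) :=
    fun t => h₀.norm.incl_lift _ _ (hF.left.mem t)
  have key1 := norm_strip_le h₀ h₁ hs h0 h1 cf₀ cf₁ hR₀ hR₁ cG dG hMG 0 (cv 0) (cv 1)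
    (fun t => (nv 0 t).le) (fun t => (nv 1 t).le) (ψ := fun _ => 0) continuous_const (d := 0)
    (fun t => by simp) (fun t => by rw [e1, e0, smul_zero, add_zero])
  -- The value of `dslope G θ` at `θ` is the derivative `D + s F θ`. On the boundary it is `(z -
  -- θ)⁻¹ (G z - G θ)`; the terms with `G θ` are collected in the fixed vector `e θ`, with minus the
  -- sum of the two reciprocals as coefficient.
  have key2 := norm_strip_le h₀ h₁ hs h0 h1 cf₀ cf₁ hR₀ hR₁ cDG dDG hM' (e θ)
    (φ₀ := fun t => (vertical 0 t - θ)⁻¹ * x (vertical 0 t))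
    (φ₁ := fun t => (vertical 1 t - θ)⁻¹ * x (vertical 1 t))
    ((ci 0 hne0).mul (cv 0)) ((ci 1 hne1).mul (cv 1))
    (c₀ := |0 - θ|⁻¹ * Real.exp (s * (0 - θ))) (c₁ := |1 - θ|⁻¹ * Real.exp (s * (1 - θ)))
    (fun t => by
      rw [norm_mul, nv]
      exact mul_le_mul_of_nonneg_right (norm_inv_vertical_sub_le hne0 t) (Real.exp_pos _).le)
    (fun t => by
      rw [norm_mul, nv]
      exact mul_le_mul_of_nonneg_right (norm_inv_vertical_sub_le hne1 t) (Real.exp_pos _).le)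
    (ψ := fun t => -((vertical 1 t - θ)⁻¹ + (vertical 0 t - θ)⁻¹))
    ((ci 1 hne1).add (ci 0 hne0)).neg (d := |1 - θ|⁻¹ + |0 - θ|⁻¹)
    (fun t => by
      rw [norm_neg]
      exact (norm_add_le _ _).trans (add_le_add (norm_inv_vertical_sub_le hne1 t)
        (norm_inv_vertical_sub_le hne0 t)))
    (fun t => by
      rw [e1, e0, dslope_of_ne _ (sub_ne_zero.1 (vertical_sub_ne_zero hne1 t)),
        dslope_of_ne _ (sub_ne_zero.1 (vertical_sub_ne_zero hne0 t)), slope_def_module,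
        slope_def_module, hGθ, hG]
      simp only [smul_sub, smul_smul, neg_smul, add_smul]
      abel)
  have hval : hs.norm.val (e θ) = F θ := hF.val_lift hs.norm (openStrip_subset hθ)
  have hder : hs.norm.val (dslope G θ θ) = (s : ℂ) • F θ + D := by
    have hxder : HasDerivAt x (x θ * (s * 1)) θ :=
      (((hasDerivAt_id (θ : ℂ)).sub_const (θ : ℂ)).const_mul (s : ℂ)).cexp
    have hGder := hxder.smul hDe
    rw [dslope_same]
    have : deriv G θ = x θ • hs.norm.lift D + (x θ * (s * 1)) • e θ := hGder.deriv
    rw [this, hxθ, one_smul, one_mul, mul_one, map_add, map_smul, hval, hs.norm.val_lift hDlt,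
      add_comm]
  rw [hGθ, hval] at key1
  rw [hder, hval] at key2
  filter_upwards [key1, key2, AEEqFun.coeFn_add ((s : ℂ) • F θ) D,
    AEEqFun.coeFn_smul (s : ℂ) (F θ)] with a g1 g2 g3 g4
  rw [g3, Pi.add_apply, g4, Pi.smul_apply, smul_eq_mul, add_comm] at g2
  rw [mul_zero, zero_mul, add_zero] at g1
  exact ⟨g1, g2⟩

/-- Pointwise bounds for the values and derivatives at `θ` of the elements of the Calderón space,
with one pair of majorants for all values of the real parameter `s`. -/
theorem exists_pointwise_bound (h₀ : IsKothe N₀) (h₁ : IsKothe N₁) {θ : ℝ} (h0 : 0 < θ)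
    (h1 : θ < 1) : ∃ C : ℝ≥0, ∀ (F : ℂ → L0 μ) (R : ℝ≥0) (D : L0 μ), MemCalderon N₀ N₁ F →
      calderonNorm N₀ N₁ F ≤ R → HasDerivIn (sumNorm N₀ N₁) F D θ →
      ∃ A B : L0 μ, N₀ A ≤ C * R ∧ N₁ B ≤ C * R ∧ ∀ᵐ a ∂μ, ∀ s : ℝ,
        ‖F θ a‖ ≤ Real.exp (s * (1 - θ)) * ‖B a‖ + Real.exp (s * (0 - θ)) * ‖A a‖ ∧
        ‖D a + s * F θ a‖ ≤ Real.exp (s * (1 - θ)) * ‖B a‖ + Real.exp (s * (0 - θ)) * ‖A a‖ := by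
  set c := ‖2 * ∫ t, stripKernel θ t‖ with hcdef
  have hc : 0 < c := norm_pos_iff.2 (mul_ne_zero two_ne_zero (integral_stripKernel_ne_zero h0 h1))
  set I := ∫ t, ‖stripKernel θ t‖
  have hI : 0 ≤ I := integral_nonneg fun _ => norm_nonneg _
  set δ := |1 - θ|⁻¹ + |0 - θ|⁻¹ with hδ
  have hδ0 : 0 ≤ δ := by positivity
  -- The factor `c⁻¹` divides by the kernel integral. The summand `1` serves the value, `δ` the
  -- boundary terms of the derivative, and `I δ c⁻¹` the term in `F θ`, to which the bound for the
  -- value is applied again.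
  set K := c⁻¹ * (1 + δ + I * δ * c⁻¹) with hK
  have hK0 : 0 ≤ K := by positivity
  obtain ⟨C, hC⟩ : ∃ C : ℝ≥0, (C : ℝ) = K * I := ⟨⟨K * I, by positivity⟩, rfl⟩
  refine ⟨C, fun F R D hF hR hD => ?_⟩
  set A₀ := h₀.norm.val (kernelAverage h₀.norm θ fun t => h₀.norm.lift (F (vertical 0 t)))
  set B₀ := h₁.norm.val (kernelAverage h₁.norm θ fun t => h₁.norm.lift (F (vertical 1 t)))
  have hnorm : ∀ {N : ENormOn μ} (h : IsKotheNorm N) (f : ℝ → h.Space), (∀ t, ‖f t‖ ≤ R) →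
      N ((K : ℂ) • h.val (kernelAverage h θ f)) ≤ (C : ℝ≥0∞) * R := by
    intro N h f hf
    rw [← map_smul, ← ENNReal.coe_mul]
    refine h.le_of_norm_le ?_
    rw [norm_smul, Complex.norm_real, Real.norm_eq_abs, abs_of_nonneg hK0, NNReal.coe_mul,
      hC, mul_assoc K]
    exact mul_le_mul_of_nonneg_left (norm_kernelAverage_le h h0 h1 hf) hK0
  refine ⟨(K : ℂ) • A₀, (K : ℂ) • B₀,
    hnorm _ _ fun t => h₀.norm.norm_lift_le ((norm_left_le t).trans hR),
    hnorm _ _ fun t => h₁.norm.norm_lift_le ((norm_right_le t).trans hR), ?_⟩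
  -- The exceptional null set depends on the parameter, so the bounds are first taken for all
  -- rationals at once; continuity in `s` extends them to all reals off the same null set.
  have key : ∀ᵐ a ∂μ, ∀ q : ℚ, _ := ae_all_iff.2 fun q : ℚ =>
    hF.norm_le_kernelAverage h₀ h₁ h0 h1 hR hD (q : ℝ)
  filter_upwards [key, AEEqFun.coeFn_smul (K : ℂ) A₀, AEEqFun.coeFn_smul (K : ℂ) B₀]
    with a g gA gB
  rw [gA, gB, Pi.smul_apply, Pi.smul_apply, norm_smul, norm_smul, Complex.norm_real,
    Real.norm_eq_abs, abs_of_nonneg hK0]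
  have hclosed : ∀ f g : ℝ → ℝ, Continuous f → Continuous g → IsClosed {s | f s ≤ g s} :=
    fun f g => isClosed_le
  refine fun s => isClosed_property Rat.isDenseEmbedding_coe_real.dense
    (p := fun s : ℝ => ‖F θ a‖ ≤ Real.exp (s * (1 - θ)) * (K * ‖B₀ a‖) +
      Real.exp (s * (0 - θ)) * (K * ‖A₀ a‖) ∧ ‖D a + s * F θ a‖ ≤
      Real.exp (s * (1 - θ)) * (K * ‖B₀ a‖) + Real.exp (s * (0 - θ)) * (K * ‖A₀ a‖)) ?_ ?_ s
  · exact (hclosed (fun s => ‖F θ a‖) (fun s => Real.exp (s * (1 - θ)) * (K * ‖B₀ a‖) +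
      Real.exp (s * (0 - θ)) * (K * ‖A₀ a‖)) (by fun_prop) (by fun_prop)).inter
      (hclosed (fun s => ‖D a + s * F θ a‖) (fun s => Real.exp (s * (1 - θ)) * (K * ‖B₀ a‖) +
      Real.exp (s * (0 - θ)) * (K * ‖A₀ a‖)) (by fun_prop) (by fun_prop))
  · intro q
    obtain ⟨g1, g2⟩ := g q
    set u := Real.exp (q * (1 - θ)) * ‖B₀ a‖ with hu
    set v := Real.exp (q * (0 - θ)) * ‖A₀ a‖ with hv
    have hu0 : 0 ≤ u := by positivity
    have hv0 : 0 ≤ v := by positivity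
    have e : Real.exp (q * (1 - θ)) * (K * ‖B₀ a‖) + Real.exp (q * (0 - θ)) * (K * ‖A₀ a‖) =
        K * (u + v) := by rw [hu, hv]; ring
    rw [e]
    have i1 : ‖F θ a‖ ≤ c⁻¹ * (u + v) := by
      rw [inv_mul_eq_div, le_div_iff₀ hc, mul_comm]
      exact g1
    constructor
    · refine i1.trans (mul_le_mul_of_nonneg_right ?_ (by positivity))
      rw [hK]
      refine le_mul_of_one_le_right (by positivity) ?_
      have : 0 ≤ I * δ * c⁻¹ := by positivity
      linarith
    · have i2 : c * ‖D a + (q : ℝ) * F θ a‖ ≤ δ * (u + v) + I * δ * (c⁻¹ * (u + v)) := by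
        refine g2.trans (add_le_add ?_ (mul_le_mul_of_nonneg_left i1 (by positivity)))
        rw [mul_add, mul_assoc, mul_assoc]
        refine add_le_add (mul_le_mul_of_nonneg_right ?_ hu0) (mul_le_mul_of_nonneg_right ?_ hv0)
        · rw [hδ]; exact le_add_of_nonneg_right (by positivity)
        · rw [hδ]; exact le_add_of_nonneg_left (by positivity)
      have i3 : ‖D a + (q : ℝ) * F θ a‖ ≤ c⁻¹ * (δ * (u + v) + I * δ * (c⁻¹ * (u + v))) := by
        rw [inv_mul_eq_div, le_div_iff₀ hc, mul_comm]
        exact i2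
      refine i3.trans ?_
      rw [hK]
      have : 0 ≤ c⁻¹ * (u + v) := by positivity
      calc c⁻¹ * (δ * (u + v) + I * δ * (c⁻¹ * (u + v)))
          = c⁻¹ * (δ + I * δ * c⁻¹) * (u + v) := by ring
        _ ≤ c⁻¹ * (1 + δ + I * δ * c⁻¹) * (u + v) := by
          refine mul_le_mul_of_nonneg_right (mul_le_mul_of_nonneg_left ?_ (by positivity))
            (by positivity)
          linarith

end PointwiseBound

end Butterfly

namespace Butterfly

section Interp

variable {α : Type*} [MeasurableSpace α] {μ : Measure α} {N N₀ N₁ : ENormOn μ}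

/-! ### The Calderón space is closed under the usual operations -/

theorem IsC0OnLine.of_lift (h : IsKotheNorm N) {F : ℂ → L0 μ} {j : ℝ} {f : ℝ → h.Space}
    (hf : Continuous f) (hz : Tendsto f (cocompact ℝ) (𝓝 0)) (hF : ∀ t, F (vertical j t) = h.val (f t)) :
    IsC0OnLine N F j where
  mem t := by rw [hF]; exact h.val_lt_top _
  cont t := by
    simp only [hF]
    exact (h.tendsto_iff _ _).1 (hf.tendsto t)
  zero_at_infty := by
    simp only [hF]
    simpa using (h.tendsto_iff _ _).1 hz

theorem IsC0OnLine.tendsto_lift (h : IsKotheNorm N) {F : ℂ → L0 μ} {j : ℝ}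
    (hF : IsC0OnLine N F j) : Tendsto (fun t => h.lift (F (vertical j t))) (cocompact ℝ) (𝓝 0) := by
  refine (h.tendsto_iff _ _).2 (hF.zero_at_infty.congr fun t => ?_)
  rw [h.val_lift (hF.mem t), map_zero, sub_zero]

theorem HasDerivIn.of_lift (hs : IsKotheNorm N) {F : ℂ → L0 μ}
    {e : ℂ → hs.Space} (hF : ∀ z ∈ closedStrip, F z = hs.val (e z)) {z : ℂ} (hz : z ∈ openStrip)
    {d : hs.Space} (hd : HasDerivAt e d z) : HasDerivIn N F (hs.val d) z := by
  rw [hasDerivAt_iff_tendsto_slope, hs.tendsto_iff] at hd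
  refine Tendsto.congr' ?_ hd
  have hmem : ∀ᶠ w in 𝓝[≠] z, w ∈ closedStrip :=
    mem_nhdsWithin_of_mem_nhds (mem_of_superset (isOpen_openStrip.mem_nhds hz) openStrip_subset)
  filter_upwards [hmem] with w hw
  rw [slope_def_module, map_smul, map_sub, hF w hw, hF z (openStrip_subset hz)]

/-- Membership in the Calderón space in terms of functions with values in normed spaces. -/
theorem MemCalderon.of_lift (h₀ : IsKotheNorm N₀) (h₁ : IsKotheNorm N₁)
    (hs : IsKotheNorm (sumNorm N₀ N₁)) {F : ℂ → L0 μ}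
    {e : ℂ → hs.Space} (hF : ∀ z ∈ closedStrip, F z = hs.val (e z))
    (hc : ContinuousOn e closedStrip) (hd : DifferentiableOn ℂ e openStrip) {M : ℝ}
    (hM : ∀ z ∈ closedStrip, ‖e z‖ ≤ M)
    {f₀ : ℝ → h₀.Space} (c₀ : Continuous f₀) (z₀ : Tendsto f₀ (cocompact ℝ) (𝓝 0))
    (hF₀ : ∀ t, F (vertical 0 t) = h₀.val (f₀ t))
    {f₁ : ℝ → h₁.Space} (c₁ : Continuous f₁) (z₁ : Tendsto f₁ (cocompact ℝ) (𝓝 0))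
    (hF₁ : ∀ t, F (vertical 1 t) = h₁.val (f₁ t)) : MemCalderon N₀ N₁ F where
  bounded := by
    refine ⟨M.toNNReal, fun z hz => ?_⟩
    rw [hF z hz]
    exact hs.le_of_norm_le ((hM z hz).trans (Real.le_coe_toNNReal M))
  cont z hz := by
    refine Tendsto.congr' ?_ ((hs.tendsto_iff _ _).1 (hc z hz))
    filter_upwards [self_mem_nhdsWithin] with w hw
    rw [hF w hw, hF z hz]
  analytic z hz := ⟨_, HasDerivIn.of_lift hs hF hz
    (hd.differentiableAt (isOpen_openStrip.mem_nhds hz)).hasDerivAt⟩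
  left := IsC0OnLine.of_lift h₀ c₀ z₀ hF₀
  right := IsC0OnLine.of_lift h₁ c₁ z₁ hF₁

section Operations

variable (h₀ : IsKothe N₀) (h₁ : IsKothe N₁)
include h₀ h₁

theorem MemCalderon.add {F G : ℂ → L0 μ} (hF : MemCalderon N₀ N₁ F) (hG : MemCalderon N₀ N₁ G) :
    MemCalderon N₀ N₁ (fun z => F z + G z) := by
  have hs := sumNorm_isKotheNorm h₀ h₁
  obtain ⟨M, hM⟩ := hF.exists_norm_lift_le hs
  obtain ⟨M', hM'⟩ := hG.exists_norm_lift_le hs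
  have z0 := (hF.left.tendsto_lift h₀.norm).add (hG.left.tendsto_lift h₀.norm)
  have z1 := (hF.right.tendsto_lift h₁.norm).add (hG.right.tendsto_lift h₁.norm)
  rw [add_zero] at z0 z1
  exact MemCalderon.of_lift h₀.norm h₁.norm hs (e := fun z => hs.lift (F z) + hs.lift (G z))
    (f₀ := fun t => h₀.norm.lift (F (vertical 0 t)) + h₀.norm.lift (G (vertical 0 t)))
    (f₁ := fun t => h₁.norm.lift (F (vertical 1 t)) + h₁.norm.lift (G (vertical 1 t)))
    (fun z hz => by rw [map_add, hF.val_lift hs hz, hG.val_lift hs hz])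
    ((hF.continuousOn_lift hs).add (hG.continuousOn_lift hs))
    ((hF.differentiableOn_lift hs).add (hG.differentiableOn_lift hs))
    (fun z hz => (norm_add_le _ _).trans (add_le_add (hM z hz) (hM' z hz)))
    ((hF.left.continuous_lift h₀.norm).add (hG.left.continuous_lift h₀.norm)) z0
    (fun t => by rw [map_add, h₀.norm.val_lift (hF.left.mem t), h₀.norm.val_lift (hG.left.mem t)])
    ((hF.right.continuous_lift h₁.norm).add (hG.right.continuous_lift h₁.norm)) z1
    (fun t => by rw [map_add, h₁.norm.val_lift (hF.right.mem t), h₁.norm.val_lift (hG.right.mem t)])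

/-- Multiplication by a bounded scalar analytic function. -/
theorem MemCalderon.smul {F : ℂ → L0 μ} (hF : MemCalderon N₀ N₁ F) {φ : ℂ → ℂ}
    (hφc : ContinuousOn φ closedStrip) (hφd : DifferentiableOn ℂ φ openStrip) {c : ℝ}
    (hφ : ∀ z ∈ closedStrip, ‖φ z‖ ≤ c) : MemCalderon N₀ N₁ (fun z => φ z • F z) := by
  have hs := sumNorm_isKotheNorm h₀ h₁
  obtain ⟨M, hM⟩ := hF.exists_norm_lift_le hs
  have hzero : ∀ {N : ENormOn μ} (h : IsKotheNorm N) (j : ℝ), (∀ t, vertical j t ∈ closedStrip) →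
      IsC0OnLine N F j → Tendsto (fun t => φ (vertical j t) • h.lift (F (vertical j t)))
        (cocompact ℝ) (𝓝 0) := by
    intro N h j hj hFj
    rw [tendsto_zero_iff_norm_tendsto_zero]
    have := (tendsto_zero_iff_norm_tendsto_zero.1 (hFj.tendsto_lift h)).const_mul c
    rw [mul_zero] at this
    refine squeeze_zero (fun _ => norm_nonneg _) (fun t => ?_) this
    rw [norm_smul]
    exact mul_le_mul_of_nonneg_right (hφ _ (hj t)) (norm_nonneg _)
  exact MemCalderon.of_lift h₀.norm h₁.norm hs (e := fun z => φ z • hs.lift (F z))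
    (f₀ := fun t => φ (vertical 0 t) • h₀.norm.lift (F (vertical 0 t)))
    (f₁ := fun t => φ (vertical 1 t) • h₁.norm.lift (F (vertical 1 t)))
    (fun z hz => by rw [map_smul, hF.val_lift hs hz])
    (hφc.smul (hF.continuousOn_lift hs)) (hφd.smul (hF.differentiableOn_lift hs))
    (fun z hz => by
      rw [norm_smul]
      exact mul_le_mul (hφ z hz) (hM z hz) (norm_nonneg _) ((norm_nonneg _).trans (hφ z hz)))
    ((continuous_comp_vertical hφc vertical_zero_mem).smul (hF.left.continuous_lift h₀.norm))
    (hzero h₀.norm 0 vertical_zero_mem hF.left)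
    (fun t => by rw [map_smul, h₀.norm.val_lift (hF.left.mem t)])
    ((continuous_comp_vertical hφc vertical_one_mem).smul (hF.right.continuous_lift h₁.norm))
    (hzero h₁.norm 1 vertical_one_mem hF.right)
    (fun t => by rw [map_smul, h₁.norm.val_lift (hF.right.mem t)])

theorem MemCalderon.const_smul {F : ℂ → L0 μ} (hF : MemCalderon N₀ N₁ F) (c : ℂ) :
    MemCalderon N₀ N₁ (fun z => c • F z) :=
  hF.smul h₀ h₁ (φ := fun _ => c) continuousOn_const (differentiableOn_const c) (c := ‖c‖)
    fun _ _ => le_rfl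

theorem MemCalderon.zero : MemCalderon N₀ N₁ (fun _ => 0) := by
  have hs := sumNorm_isKotheNorm h₀ h₁
  exact MemCalderon.of_lift h₀.norm h₁.norm hs (e := fun _ => 0) (fun z _ => (map_zero _).symm)
    continuousOn_const (differentiableOn_const _) (M := 0) (fun z _ => by simp)
    (f₀ := fun _ => 0) continuous_const tendsto_const_nhds (fun t => (map_zero _).symm)
    (f₁ := fun _ => 0) continuous_const tendsto_const_nhds (fun t => (map_zero _).symm)

theorem MemCalderon.sub {F G : ℂ → L0 μ} (hF : MemCalderon N₀ N₁ F) (hG : MemCalderon N₀ N₁ G) :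
    MemCalderon N₀ N₁ (fun z => F z - G z) := by
  have h := hF.add h₀ h₁ (hG.const_smul h₀ h₁ (-1))
  have e : ∀ z, F z + (-1 : ℂ) • G z = F z - G z := fun z => by
    rw [show (-1 : ℂ) • G z = -G z from neg_one_smul ℂ (G z), sub_eq_add_neg]
  simpa only [e] using h

theorem MemCalderon.sum {F : ℕ → ℂ → L0 μ} (hF : ∀ k, MemCalderon N₀ N₁ (F k)) (n : ℕ) :
    MemCalderon N₀ N₁ (fun z => ∑ k ∈ Finset.range n, F k z) := by
  induction n with
  | zero => simpa using MemCalderon.zero h₀ h₁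
  | succ n ih =>
    simp_rw [Finset.sum_range_succ]
    exact ih.add h₀ h₁ (hF n)

end Operations

/-- Multiplication by a function bounded by one. -/
theorem MemCalderon.mul (h₀ : IsKotheNorm N₀) (h₁ : IsKotheNorm N₁)
    (hs : IsKotheNorm (sumNorm N₀ N₁)) {F : ℂ → L0 μ}
    (hF : MemCalderon N₀ N₁ F) {m : L0 μ} (hm : ∀ᵐ a ∂μ, ‖m a‖ ≤ 1) :
    MemCalderon N₀ N₁ (fun z => m * F z) := by
  have hle : ∀ {N : ENormOn μ} (h : IsKotheNorm N) (f : L0 μ), N (m * f) ≤ N f := fun h f =>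
    h.mono _ _ (norm_mul_le_of_norm_le_one hm f)
  have hsub : ∀ f g : L0 μ, m * f - m * g = m * (f - g) := fun f g => (map_sub (mulL0 m) f g).symm
  have line : ∀ {N : ENormOn μ} (h : IsKotheNorm N) (j : ℝ), IsC0OnLine N F j →
      IsC0OnLine N (fun z => m * F z) j := fun h j hj => by
    refine ⟨fun t => (hle h _).trans_lt (hj.mem t), fun t => ?_, ?_⟩
    · simp_rw [hsub]
      exact tendsto_of_tendsto_of_tendsto_of_le_of_le tendsto_const_nhds (hj.cont t)
        (fun _ => zero_le) fun _ => hle h _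
    · exact tendsto_of_tendsto_of_tendsto_of_le_of_le tendsto_const_nhds hj.zero_at_infty
        (fun _ => zero_le) fun _ => hle h _
  refine ⟨?_, fun z hz => ?_, fun z hz => ?_, line h₀ 0 hF.left, line h₁ 1 hF.right⟩
  · obtain ⟨M, hM⟩ := hF.bounded
    exact ⟨M, fun z hz => (hle hs _).trans (hM z hz)⟩
  · simp_rw [hsub]
    exact tendsto_of_tendsto_of_tendsto_of_le_of_le tendsto_const_nhds (hF.cont z hz)
      (fun _ => zero_le) fun _ => hle hs _
  · obtain ⟨D, hD⟩ := hF.analytic z hz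
    refine ⟨m * D, tendsto_of_tendsto_of_tendsto_of_le_of_le tendsto_const_nhds hD
      (fun _ => zero_le) fun w => ?_⟩
    have : (w - z)⁻¹ • (m * F w - m * F z) - m * D = m * ((w - z)⁻¹ • (F w - F z) - D) := by
      rw [hsub, ← hsub _ D]
      congr 1
      exact (map_smul (mulL0 m) _ _).symm
    simp only [this]
    exact hle hs _

theorem calderonNorm_add_le (h₀ : IsKotheNorm N₀) (h₁ : IsKotheNorm N₁) (F G : ℂ → L0 μ) :
    calderonNorm N₀ N₁ (fun z => F z + G z) ≤ calderonNorm N₀ N₁ F + calderonNorm N₀ N₁ G :=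
  calderonNorm_le (fun t => (h₀.add_le _ _).trans (add_le_add (norm_left_le t) (norm_left_le t)))
    fun t => (h₁.add_le _ _).trans (add_le_add (norm_right_le t) (norm_right_le t))

theorem calderonNorm_smul_le (h₀ : IsKotheNorm N₀) (h₁ : IsKotheNorm N₁) {F : ℂ → L0 μ}
    {φ : ℂ → ℂ} {c : ℝ≥0∞} (hφ : ∀ z ∈ closedStrip, ‖φ z‖ₑ ≤ c) :
    calderonNorm N₀ N₁ (fun z => φ z • F z) ≤ c * calderonNorm N₀ N₁ F := by
  refine calderonNorm_le (fun t => ?_) fun t => ?_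
  · rw [h₀.smul]
    exact mul_le_mul' (hφ _ (vertical_zero_mem t)) (norm_left_le t)
  · rw [h₁.smul]
    exact mul_le_mul' (hφ _ (vertical_one_mem t)) (norm_right_le t)

/-! ### Complex interpolation spaces are Köthe spaces -/

theorem exists_of_interp_lt {θ : ℝ} {f : L0 μ} {r : ℝ≥0∞} (h : interp N₀ N₁ θ f < r) :
    ∃ F, MemCalderon N₀ N₁ F ∧ F θ = f ∧ calderonNorm N₀ N₁ F < r := by
  simp only [interp, iInf_lt_iff] at h
  obtain ⟨F, hF, hFθ, h⟩ := h
  exact ⟨F, hF, hFθ, h⟩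

theorem interp_le {θ : ℝ} {F : ℂ → L0 μ} {f : L0 μ} (hF : MemCalderon N₀ N₁ F) (hf : F θ = f) :
    interp N₀ N₁ θ f ≤ calderonNorm N₀ N₁ F :=
  iInf_le_of_le F (iInf_le_of_le hF (iInf_le_of_le hf le_rfl))

theorem sumNorm_le_interp (h₀ : IsKothe N₀) (h₁ : IsKothe N₁) {θ : ℝ} (h0 : 0 < θ) (h1 : θ < 1)
    (f : L0 μ) : sumNorm N₀ N₁ f ≤ interp N₀ N₁ θ f :=
  le_iInf fun _ => le_iInf fun hF => le_iInf fun hFθ =>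
    hFθ ▸ hF.sumNorm_le h₀ h₁ (openStrip_subset (ofReal_mem_openStrip h0 h1))

/-- Definiteness comes from the embedding into the sum space, that is, from the maximum principle;
monotonicity from multiplying a representing function by a fixed function bounded by one. -/
theorem interp_isKotheNorm (h₀ : IsKothe N₀) (h₁ : IsKothe N₁) {θ : ℝ} (h0 : 0 < θ) (h1 : θ < 1) :
    IsKotheNorm (interp N₀ N₁ θ) := by
  have hs := sumNorm_isKotheNorm h₀ h₁
  have hz : interp N₀ N₁ θ 0 = 0 := by
    refine le_antisymm ((interp_le (MemCalderon.zero h₀ h₁) rfl).trans ?_) zero_le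
    exact calderonNorm_le (fun t => h₀.norm.zero.le) fun t => h₁.norm.zero.le
  refine ⟨fun f => ⟨fun hf => ?_, ?_⟩, fun f g => ?_, ?_, fun f g hfg => ?_⟩
  · rw [← hs.eq_zero_iff]
    exact le_antisymm (hf ▸ sumNorm_le_interp h₀ h₁ h0 h1 f) zero_le
  · rintro rfl
    exact hz
  · refine ENNReal.le_of_forall_pos_le_add fun ε hε hlt => ?_
    have hε' : (ε / 2 : ℝ≥0∞) ≠ 0 := by simpa using hε.ne'
    obtain ⟨F, hF, rfl, hr⟩ := exists_of_interp_lt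
      (ENNReal.lt_add_right (ENNReal.add_lt_top.1 hlt).1.ne hε')
    obtain ⟨G, hG, rfl, hr'⟩ := exists_of_interp_lt
      (ENNReal.lt_add_right (ENNReal.add_lt_top.1 hlt).2.ne hε')
    calc interp N₀ N₁ θ (F θ + G θ) ≤ calderonNorm N₀ N₁ (fun z => F z + G z) :=
          interp_le (hF.add h₀ h₁ hG) rfl
      _ ≤ _ := calderonNorm_add_le h₀.norm h₁.norm F G
      _ ≤ (interp N₀ N₁ θ (F θ) + ε / 2) + (interp N₀ N₁ θ (G θ) + ε / 2) :=
          add_le_add hr.le hr'.le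
      _ = _ := by rw [add_add_add_comm, ENNReal.add_halves]
  · refine smul_eq_of_le hz fun c f hc => ?_
    refine ENNReal.le_of_forall_pos_le_add fun ε hε hlt => ?_
    have hc' : ‖c‖ₑ ≠ 0 := by simpa using hc
    have hft : interp N₀ N₁ θ f ≠ ∞ := fun h => by
      rw [h, ENNReal.mul_top hc'] at hlt
      exact lt_irrefl _ hlt
    have hε' : (ε / ‖c‖ₑ : ℝ≥0∞) ≠ 0 := by
      simp [hε.ne']
    obtain ⟨F, hF, rfl, hr⟩ := exists_of_interp_lt (ENNReal.lt_add_right hft hε')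
    calc interp N₀ N₁ θ (c • F θ) ≤ calderonNorm N₀ N₁ (fun z => c • F z) :=
          interp_le (hF.const_smul h₀ h₁ c) rfl
      _ ≤ ‖c‖ₑ * calderonNorm N₀ N₁ F :=
          calderonNorm_smul_le h₀.norm h₁.norm fun _ _ => le_rfl
      _ ≤ ‖c‖ₑ * (interp N₀ N₁ θ (F θ) + ε / ‖c‖ₑ) := by gcongr
      _ = _ := by rw [mul_add, ENNReal.mul_div_cancel hc' enorm_ne_top]
  · obtain ⟨m, hm, rfl⟩ := exists_mul_of_norm_le hfg
    refine le_iInf fun F => le_iInf fun hF => le_iInf fun hFθ => ?_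
    rw [← hFθ]
    refine (interp_le (hF.mul h₀.norm h₁.norm hs hm) rfl).trans ?_
    exact calderonNorm_le
      (fun t => (h₀.mono _ _ (norm_mul_le_of_norm_le_one hm _)).trans (norm_left_le t))
      fun t => (h₁.mono _ _ (norm_mul_le_of_norm_le_one hm _)).trans (norm_right_le t)

/-- The Calderón space is complete. -/
theorem exists_calderon_sum (h₀ : IsKothe N₀) (h₁ : IsKothe N₁) {F : ℕ → ℂ → L0 μ}
    (hF : ∀ k, MemCalderon N₀ N₁ (F k)) {r : ℕ → ℝ≥0} (hr : Summable r)
    (hFr : ∀ k, calderonNorm N₀ N₁ (F k) ≤ r k) :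
    ∃ G, MemCalderon N₀ N₁ G ∧ ∀ n, calderonNorm N₀ N₁
      (fun z => G z - ∑ k ∈ Finset.range n, F k z) ≤ ∑' k, (r (k + n) : ℝ≥0∞) := by
  have hs := sumNorm_isKothe h₀ h₁
  have := Fact.mk h₀
  have := Fact.mk h₁
  have := Fact.mk hs
  have hr' : Summable fun k => (r k : ℝ) := NNReal.summable_coe.2 hr
  set e : ℕ → ℂ → hs.norm.Space := fun k z => hs.norm.lift (F k z) with he
  set f₀ : ℕ → ℝ → h₀.norm.Space := fun k t => h₀.norm.lift (F k (vertical 0 t)) with hf₀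
  set f₁ : ℕ → ℝ → h₁.norm.Space := fun k t => h₁.norm.lift (F k (vertical 1 t)) with hf₁
  -- By the maximum principle the bounds on the boundary also hold in the interior for the sum norm.
  -- The three series, inside the strip and on the two lines, thus share the majorant `r`.
  have be : ∀ k, ∀ z ∈ closedStrip, ‖e k z‖ ≤ r k := fun k z hz =>
    hs.norm.norm_lift_le (((hF k).sumNorm_le h₀ h₁ hz).trans (hFr k))
  have b0 : ∀ k t, ‖f₀ k t‖ ≤ r k := fun k t =>
    h₀.norm.norm_lift_le ((norm_left_le t).trans (hFr k))
  have b1 : ∀ k t, ‖f₁ k t‖ ≤ r k := fun k t =>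
    h₁.norm.norm_lift_le ((norm_right_le t).trans (hFr k))
  have s0 : ∀ t, Summable fun k => f₀ k t := fun t => hr'.of_norm_bounded fun k => b0 k t
  have s1 : ∀ t, Summable fun k => f₁ k t := fun t => hr'.of_norm_bounded fun k => b1 k t
  have z0 : Tendsto (fun t => ∑' k, f₀ k t) (cocompact ℝ) (𝓝 0) := by
    have := tendsto_tsum_of_dominated_convergence (𝓕 := cocompact ℝ) (f := fun t k => f₀ k t)
      (g := fun _ => 0) hr' (fun k => (hF k).left.tendsto_lift h₀.norm)
      (Eventually.of_forall fun t k => b0 k t)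
    simpa using this
  have z1 : Tendsto (fun t => ∑' k, f₁ k t) (cocompact ℝ) (𝓝 0) := by
    have := tendsto_tsum_of_dominated_convergence (𝓕 := cocompact ℝ) (f := fun t k => f₁ k t)
      (g := fun _ => 0) hr' (fun k => (hF k).right.tendsto_lift h₁.norm)
      (Eventually.of_forall fun t k => b1 k t)
    simpa using this
  have v0 : ∀ t, hs.norm.val (∑' k, e k (vertical 0 t)) = h₀.norm.val (∑' k, f₀ k t) := fun t => by
    rw [← h₀.norm.val_incl hs.norm (sumNorm_le_left h₁.norm), ContinuousLinearMap.map_tsum _ (s0 t)]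
    refine congrArg _ (tsum_congr fun k => ?_)
    exact (h₀.norm.incl_lift _ _ ((hF k).left.mem t)).symm
  have v1 : ∀ t, hs.norm.val (∑' k, e k (vertical 1 t)) = h₁.norm.val (∑' k, f₁ k t) := fun t => by
    rw [← h₁.norm.val_incl hs.norm (sumNorm_le_right h₀.norm),
      ContinuousLinearMap.map_tsum _ (s1 t)]
    refine congrArg _ (tsum_congr fun k => ?_)
    exact (h₁.norm.incl_lift _ _ ((hF k).right.mem t)).symm
  have tail : ∀ {E : Type _} [NormedAddCommGroup E] [CompleteSpace E] (f : ℕ → E),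
      (∀ k, ‖f k‖ ≤ r k) → ∀ n, ‖(∑' k, f k) - ∑ k ∈ Finset.range n, f k‖ₑ ≤
        ∑' k, (r (k + n) : ℝ≥0∞) := by
    intro E _ _ f hf n
    have hsum : Summable f := hr'.of_norm_bounded hf
    rw [← hsum.sum_add_tsum_nat_add n, add_sub_cancel_left]
    exact enorm_tsum_le_tsum_enorm.trans (ENNReal.tsum_le_tsum fun k => enorm_le_coe.2 (hf _))
  refine ⟨fun z => hs.norm.val (∑' k, e k z), ?_, fun n => calderonNorm_le (fun t => ?_) fun t => ?_⟩
  · refine MemCalderon.of_lift h₀.norm h₁.norm hs.norm (fun z _ => rfl) ?_ ?_ (M := ∑' k, (r k : ℝ))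
      ?_ ?_ z0 v0 ?_ z1 v1
    · exact continuousOn_tsum (fun k => (hF k).continuousOn_lift hs.norm) hr' fun k z hz => be k z hz
    · exact Complex.differentiableOn_tsum_of_summable_norm hr'
        (fun k => (hF k).differentiableOn_lift hs.norm) isOpen_openStrip
        fun k z hz => be k z (openStrip_subset hz)
    · intro z hz
      exact tsum_of_norm_bounded hr'.hasSum fun k => be k z hz
    · exact continuous_tsum (fun k => (hF k).left.continuous_lift h₀.norm) hr' b0
    · exact continuous_tsum (fun k => (hF k).right.continuous_lift h₁.norm) hr' b1
  · have := tail (fun k => f₀ k t) (fun k => b0 k t) n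
    rw [h₀.norm.enorm_eq, map_sub, map_sum, ← v0] at this
    simpa only [hf₀, h₀.norm.val_lift ((hF _).left.mem t)] using this
  · have := tail (fun k => f₁ k t) (fun k => b1 k t) n
    rw [h₁.norm.enorm_eq, map_sub, map_sum, ← v1] at this
    simpa only [hf₁, h₁.norm.val_lift ((hF _).right.mem t)] using this

theorem interp_isKothe (h₀ : IsKothe N₀) (h₁ : IsKothe N₁) {θ : ℝ} (h0 : 0 < θ) (h1 : θ < 1) :
    IsKothe (interp N₀ N₁ θ) := by
  refine (interp_isKotheNorm h₀ h₁ h0 h1).isKothe_of_series fun u hu => ?_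
  obtain ⟨ε, hε0, hε⟩ := ENNReal.exists_pos_sum_of_countable (ε := 1) one_ne_zero ℕ
  have hlt : ∀ k, interp N₀ N₁ θ (u k) < interp N₀ N₁ θ (u k) + ε k := fun k =>
    ENNReal.lt_add_right (ENNReal.ne_top_of_tsum_ne_top hu k) (by simpa using (hε0 k).ne')
  choose F hF hFθ hFr using fun k => exists_of_interp_lt (hlt k)
  have hfin : (∑' k, (interp N₀ N₁ θ (u k) + ε k)) ≠ ∞ := by
    rw [ENNReal.tsum_add]
    exact (ENNReal.add_lt_top.2 ⟨hu.lt_top, hε.trans ENNReal.one_lt_top⟩).ne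
  have hk : ∀ k, interp N₀ N₁ θ (u k) + ε k ≠ ∞ := fun k => ENNReal.ne_top_of_tsum_ne_top hfin k
  set r : ℕ → ℝ≥0 := fun k => (interp N₀ N₁ θ (u k) + ε k).toNNReal with hr
  have hrc : ∀ k, (r k : ℝ≥0∞) = interp N₀ N₁ θ (u k) + ε k := fun k => ENNReal.coe_toNNReal (hk k)
  have hrs : (∑' k, (r k : ℝ≥0∞)) ≠ ∞ := by simpa only [hrc] using hfin
  obtain ⟨G, hG, hGn⟩ := exists_calderon_sum h₀ h₁ hF (ENNReal.tsum_coe_ne_top_iff_summable.1 hrs)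
    fun k => (hFr k).le.trans_eq (hrc k).symm
  refine ⟨G θ, tendsto_of_tendsto_of_tendsto_of_le_of_le tendsto_const_nhds
    (ENNReal.tendsto_sum_nat_add _ hrs) (fun _ => zero_le) fun n => ?_⟩
  refine le_trans ?_ (hGn n)
  have := interp_le (θ := θ) (hG.sub h₀ h₁ (MemCalderon.sum h₀ h₁ hF n)) rfl
  simpa only [hFθ] using this

end Interp

end Butterfly

namespace Butterfly

/-! ### Explicit elements of interpolation spaces -/

section Exponentials

variable {α : Type*} [MeasurableSpace α] {μ : Measure α} {N N₀ N₁ : ENormOn μ}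

/-- The class of a measurable function. -/
noncomputable def ofMeas (μ : Measure α) (g : α → ℂ) (hg : Measurable g) : L0 μ :=
  AEEqFun.mk g hg.aestronglyMeasurable

theorem coeFn_ofMeas (μ : Measure α) (g : α → ℂ) (hg : Measurable g) :
    ∀ᵐ a ∂μ, ofMeas μ g hg a = g a := AEEqFun.coeFn_mk _ _

/-- The exponential family `v exp (z l)`. -/
noncomputable def expFamily (v : L0 μ) (l : α → ℝ) (hl : Measurable l) (z : ℂ) : L0 μ :=
  ofMeas μ (fun a => v a * Complex.exp (z * l a)) (by
    have := v.measurable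
    fun_prop)

theorem coeFn_expFamily (v : L0 μ) {l : α → ℝ} (hl : Measurable l) (z : ℂ) :
    ∀ᵐ a ∂μ, expFamily v l hl z a = v a * Complex.exp (z * l a) := coeFn_ofMeas _ _ _

theorem IsKotheNorm.le_of_le_mul (h : IsKotheNorm N) {f g : L0 μ} {c : ℝ} (hc : 0 ≤ c)
    (hfg : ∀ᵐ a ∂μ, ‖f a‖ ≤ c * ‖g a‖) : N f ≤ ENNReal.ofReal c * N g := by
  have e : ENNReal.ofReal c = ‖(c : ℂ)‖ₑ := by
    rw [← ofReal_norm, Complex.norm_real, Real.norm_of_nonneg hc]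
  rw [e, ← h.smul]
  apply h.mono
  filter_upwards [hfg, AEEqFun.coeFn_smul (c : ℂ) g] with a h1 h2
  rwa [h2, Pi.smul_apply, norm_smul, Complex.norm_real, Real.norm_of_nonneg hc]

theorem exp_re_mul_le {l m : ℝ} (hm : |l| ≤ m) (z : ℂ) :
    ‖Complex.exp (z * l)‖ ≤ Real.exp (|z.re| * m) := by
  rw [Complex.norm_exp, Complex.re_mul_ofReal]
  apply Real.exp_le_exp.2
  refine (le_abs_self _).trans ?_
  rw [abs_mul]
  exact mul_le_mul_of_nonneg_left hm (abs_nonneg _)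

theorem expFamily_le (h : IsKotheNorm N) (v : L0 μ) {l : α → ℝ} (hl : Measurable l) {m : ℝ}
    (hm : ∀ a, |l a| ≤ m) (z : ℂ) :
    N (expFamily v l hl z) ≤ ENNReal.ofReal (Real.exp (|z.re| * m)) * N v := by
  refine h.le_of_le_mul (Real.exp_pos _).le ?_
  filter_upwards [coeFn_expFamily v hl z] with a ha
  rw [ha, norm_mul, mul_comm]
  exact mul_le_mul_of_nonneg_right (exp_re_mul_le (hm a) z) (norm_nonneg _)

theorem expFamily_lt_top (h : IsKotheNorm N) {v : L0 μ} (hv : N v < ∞) {l : α → ℝ}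
    (hl : Measurable l) {m : ℝ} (hm : ∀ a, |l a| ≤ m) (z : ℂ) : N (expFamily v l hl z) < ∞ :=
  (expFamily_le h v hl hm z).trans_lt (ENNReal.mul_lt_top ENNReal.ofReal_lt_top hv)

/-- The exponential family is an entire function. -/
theorem differentiable_expFamily (h : IsKotheNorm N) {v : L0 μ} (hv : N v < ∞) {l : α → ℝ}
    (hl : Measurable l) {m : ℝ} (hm0 : 0 ≤ m) (hm : ∀ a, |l a| ≤ m) :
    Differentiable ℂ fun z => h.lift (expFamily v l hl z) := by
  intro z
  set v' : L0 μ := ofMeas μ (fun a => v a * l a * Complex.exp (z * l a)) (by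
    have := v.measurable
    fun_prop) with hv'
  have cv' : ∀ᵐ a ∂μ, v' a = v a * l a * Complex.exp (z * l a) := coeFn_ofMeas _ _ _
  have hv'lt : N v' < ∞ := by
    refine (h.le_of_le_mul (c := m * Real.exp (|z.re| * m)) (g := v) (by positivity) ?_).trans_lt
      (ENNReal.mul_lt_top ENNReal.ofReal_lt_top hv)
    filter_upwards [cv'] with a ha
    rw [ha, norm_mul, norm_mul, Complex.norm_real, Real.norm_eq_abs]
    calc ‖v a‖ * |l a| * ‖Complex.exp (z * l a)‖ ≤ ‖v a‖ * m * Real.exp (|z.re| * m) := by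
          gcongr
          · exact hm a
          · exact exp_re_mul_le (hm a) z
      _ = _ := by ring
  suffices H : HasDerivAt (fun z => h.lift (expFamily v l hl z)) (h.lift v') z from
    H.differentiableAt
  rw [hasDerivAt_iff_isLittleO]
  -- Since `|l| ≤ m`, the estimate `|e^u - 1 - u| ≤ |u|²` for `|u| ≤ 1` applies at all points
  -- simultaneously. The remainder is then `O(|w - z|²)` times `|v|` pointwise, hence also in norm.
  refine Asymptotics.IsBigO.trans_isLittleO (g := fun w => ‖w - z‖ ^ 2) ?_
    (Asymptotics.isLittleO_pow_sub_sub z one_lt_two)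
  have hVlt := expFamily_lt_top h hv hl hm
  refine Asymptotics.IsBigO.of_bound (Real.exp (|z.re| * m) * m ^ 2 * (N v).toReal) ?_
  have hev : ∀ᶠ w in 𝓝 z, ‖w - z‖ * m < 1 := by
    have hcont : Continuous fun w => ‖w - z‖ * m := by fun_prop
    have := hcont.tendsto z
    simp only [sub_self, norm_zero, zero_mul] at this
    exact this.eventually (gt_mem_nhds zero_lt_one)
  filter_upwards [hev] with w hw
  have hval : h.val (h.lift (expFamily v l hl w) - h.lift (expFamily v l hl z) -
      (w - z) • h.lift v') = expFamily v l hl w - expFamily v l hl z - (w - z) • v' := by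
    rw [map_sub, map_sub, map_smul, h.val_lift (hVlt w), h.val_lift (hVlt z), h.val_lift hv'lt]
  have hle : N (expFamily v l hl w - expFamily v l hl z - (w - z) • v') ≤
      ENNReal.ofReal (Real.exp (|z.re| * m) * m ^ 2 * ‖w - z‖ ^ 2) * N v := by
    refine h.le_of_le_mul (by positivity) ?_
    filter_upwards [cv', coeFn_expFamily v hl w, coeFn_expFamily v hl z,
      AEEqFun.coeFn_sub (expFamily v l hl w - expFamily v l hl z) ((w - z) • v'),
      AEEqFun.coeFn_sub (expFamily v l hl w) (expFamily v l hl z),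
      AEEqFun.coeFn_smul (w - z) v'] with a g1 g2 g3 g4 g5 g6
    rw [g4, Pi.sub_apply, g5, Pi.sub_apply, g6, Pi.smul_apply, g1, g2, g3, smul_eq_mul]
    have hsmall : ‖(w - z) * l a‖ ≤ 1 := by
      rw [norm_mul, Complex.norm_real, Real.norm_eq_abs]
      exact (mul_le_mul_of_nonneg_left (hm a) (norm_nonneg _)).trans hw.le
    have e : v a * Complex.exp (w * l a) - v a * Complex.exp (z * l a) -
        (w - z) * (v a * l a * Complex.exp (z * l a)) =
        Complex.exp (z * l a) * (Complex.exp ((w - z) * l a) - 1 - (w - z) * l a) * v a := by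
      rw [show w * (l a : ℂ) = z * l a + (w - z) * l a by ring, Complex.exp_add]
      ring
    rw [e, norm_mul, norm_mul]
    refine mul_le_mul_of_nonneg_right ?_ (norm_nonneg _)
    rw [mul_assoc]
    refine mul_le_mul (exp_re_mul_le (hm a) z) ?_ (norm_nonneg _) (Real.exp_pos _).le
    refine (Complex.norm_exp_sub_one_sub_id_le hsmall).trans ?_
    rw [norm_mul, mul_pow, Complex.norm_real, Real.norm_eq_abs, mul_comm]
    gcongr
    exact hm a
  rw [h.norm_def, hval, norm_pow, norm_norm]
  refine (ENNReal.toReal_mono (ENNReal.mul_lt_top ENNReal.ofReal_lt_top hv).ne hle).trans_eq ?_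
  rw [ENNReal.toReal_mul, ENNReal.toReal_ofReal (by positivity)]
  ring

theorem norm_gaussian_vertical (θ j t : ℝ) :
    ‖Complex.exp (vertical j t ^ 2 - θ ^ 2)‖ = Real.exp (j ^ 2 - θ ^ 2 - t ^ 2) := by
  rw [Complex.norm_exp]
  congr 1
  simp only [vertical, pow_two, Complex.sub_re, Complex.mul_re, Complex.add_re, Complex.add_im,
    Complex.mul_im, Complex.ofReal_re, Complex.ofReal_im, Complex.I_re, Complex.I_im]
  ring

theorem norm_gaussian_le {θ : ℝ} {z : ℂ} (hz : z ∈ closedStrip) :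
    ‖Complex.exp (z ^ 2 - θ ^ 2)‖ ≤ Real.exp 1 := by
  rw [Complex.norm_exp]
  apply Real.exp_le_exp.2
  simp only [pow_two, Complex.sub_re, Complex.mul_re, Complex.ofReal_re, Complex.ofReal_im]
  nlinarith [hz.1, hz.2, sq_nonneg z.im, sq_nonneg θ]

theorem tendsto_gaussian_vertical (θ j : ℝ) :
    Tendsto (fun t => Complex.exp (vertical j t ^ 2 - θ ^ 2)) (cocompact ℝ) (𝓝 0) := by
  rw [tendsto_zero_iff_norm_tendsto_zero]
  simp_rw [norm_gaussian_vertical]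
  refine Real.tendsto_exp_atBot.comp ?_
  simp_rw [sub_eq_add_neg (j ^ 2 - θ ^ 2)]
  refine tendsto_const_nhds.add_atBot (tendsto_neg_atTop_atBot.comp ?_)
  have := (tendsto_pow_atTop (α := ℝ) two_ne_zero).comp (tendsto_norm_cocompact_atTop (E := ℝ))
  refine this.congr fun t => ?_
  simp

/-- The explicit elements `v exp (θ l)` of the interpolation space. -/
theorem interp_le_of_exp (h₀ : IsKothe N₀) (h₁ : IsKothe N₁) {θ : ℝ} {v : L0 μ} {l : α → ℝ}
    (hl : Measurable l) {m : ℝ} (hm0 : 0 ≤ m) (hm : ∀ a, |l a| ≤ m) {g x : L0 μ}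
    (hg : ∀ᵐ a ∂μ, g a = v a * Real.exp (l a)) (hx : ∀ᵐ a ∂μ, x a = v a * Real.exp (θ * l a))
    {K : ℝ≥0} (hv : N₀ v ≤ K) (hgK : N₁ g ≤ K) :
    interp N₀ N₁ θ x ≤ ENNReal.ofReal (Real.exp 1) * K := by
  have hs := sumNorm_isKotheNorm h₀ h₁
  have hv0 : N₀ v < ∞ := hv.trans_lt ENNReal.coe_lt_top
  -- The bound `l ≥ -m` gives `|v| ≤ e^m |g|`. This only ensures that the family is analytic into
  -- both spaces; the factor `e^m` does not enter the final estimate.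
  have hv1 : N₁ v < ∞ := by
    refine (h₁.norm.le_of_le_mul (Real.exp_pos m).le (g := g) ?_).trans_lt
      (ENNReal.mul_lt_top ENNReal.ofReal_lt_top (hgK.trans_lt ENNReal.coe_lt_top))
    filter_upwards [hg] with a ha
    rw [ha, norm_mul, Complex.norm_real, Real.norm_of_nonneg (Real.exp_pos _).le, mul_left_comm,
      ← Real.exp_add]
    refine le_mul_of_one_le_right (norm_nonneg _) (Real.one_le_exp ?_)
    linarith [neg_abs_le (l a), hm a]
  set V : ℂ → L0 μ := expFamily v l hl with hV
  -- The Gaussian factor equals `1` at `θ`, supplies the decay at infinity required on the boundary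
  -- lines, and is at most `e` in modulus on the strip, which is the constant in the conclusion.
  set γ : ℂ → ℂ := fun z => Complex.exp (z ^ 2 - θ ^ 2) with hγ
  have hγd : Differentiable ℂ γ := by fun_prop
  have d0 := differentiable_expFamily h₀.norm hv0 hl hm0 hm
  have d1 := differentiable_expFamily h₁.norm hv1 hl hm0 hm
  have lt0 := expFamily_lt_top h₀.norm hv0 hl hm
  have lt1 := expFamily_lt_top h₁.norm hv1 hl hm
  have hbound : ∀ {N : ENormOn μ} (h : IsKotheNorm N), N v < ∞ → ∀ z : ℂ, |z.re| ≤ 1 →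
      ‖h.lift (V z)‖ ≤ Real.exp m * (N v).toReal := by
    intro N h hNv z hz
    rw [h.norm_def, h.val_lift (expFamily_lt_top h hNv hl hm z)]
    refine (ENNReal.toReal_mono (ENNReal.mul_lt_top ENNReal.ofReal_lt_top hNv).ne
      (expFamily_le h v hl hm z)).trans ?_
    rw [ENNReal.toReal_mul, ENNReal.toReal_ofReal (Real.exp_pos _).le]
    refine mul_le_mul_of_nonneg_right (Real.exp_le_exp.2 ?_) ENNReal.toReal_nonneg
    exact mul_le_of_le_one_left hm0 hz
  have habs : ∀ z ∈ closedStrip, |z.re| ≤ 1 := fun z hz => by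
    rw [abs_of_nonneg hz.1]
    exact hz.2
  have hzero : ∀ {N : ENormOn μ} (h : IsKotheNorm N), N v < ∞ → ∀ j : ℝ, |j| ≤ 1 →
      Tendsto (fun t => γ (vertical j t) • h.lift (V (vertical j t))) (cocompact ℝ) (𝓝 0) := by
    intro N h hNv j hj
    rw [tendsto_zero_iff_norm_tendsto_zero]
    have := (tendsto_zero_iff_norm_tendsto_zero.1 (tendsto_gaussian_vertical θ j)).mul_const
      (Real.exp m * (N v).toReal)
    rw [zero_mul] at this
    refine squeeze_zero (fun _ => norm_nonneg _) (fun t => ?_) this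
    rw [norm_smul]
    exact mul_le_mul_of_nonneg_left (hbound h hNv _ (by rwa [vertical_re])) (norm_nonneg _)
  set ι := h₀.norm.incl hs (sumNorm_le_left h₁.norm)
  have hF : MemCalderon N₀ N₁ fun z => γ z • V z := by
    refine MemCalderon.of_lift h₀.norm h₁.norm hs (e := fun z => ι (γ z • h₀.norm.lift (V z)))
      (f₀ := fun t => γ (vertical 0 t) • h₀.norm.lift (V (vertical 0 t)))
      (f₁ := fun t => γ (vertical 1 t) • h₁.norm.lift (V (vertical 1 t)))
      (M := ‖ι‖ * (Real.exp 1 * (Real.exp m * (N₀ v).toReal))) (fun z hz => ?_) ?_ ?_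
      (fun z hz => ?_) ?_ (hzero h₀.norm hv0 0 (by simp)) (fun t => ?_) ?_
      (hzero h₁.norm hv1 1 (by simp)) fun t => ?_
    · rw [IsKotheNorm.val_incl, map_smul, h₀.norm.val_lift (lt0 z)]
    · exact (ι.continuous.comp (hγd.smul d0).continuous).continuousOn
    · exact (ι.differentiable.comp (hγd.smul d0)).differentiableOn
    · refine (ι.le_opNorm _).trans (mul_le_mul_of_nonneg_left ?_ (norm_nonneg _))
      rw [norm_smul]
      exact mul_le_mul (norm_gaussian_le hz) (hbound h₀.norm hv0 z (habs z hz)) (norm_nonneg _)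
        (Real.exp_pos _).le
    · exact (hγd.smul d0).continuous.comp (continuous_vertical 0)
    · rw [map_smul, h₀.norm.val_lift (lt0 _)]
    · exact (hγd.smul d1).continuous.comp (continuous_vertical 1)
    · rw [map_smul, h₁.norm.val_lift (lt1 _)]
  have hFθ : γ θ • V θ = x := by
    have : γ θ = 1 := by simp [hγ]
    rw [this]
    refine (one_smul ℂ (V θ)).trans (AEEqFun.ext ?_)
    filter_upwards [hx, coeFn_expFamily v hl θ] with a h1 h2
    rw [h1, hV, h2]
    push_cast
    rfl
  refine (interp_le hF hFθ).trans (calderonNorm_le (fun t => ?_) fun t => ?_)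
  · refine (h₀.norm.le_of_le_mul (Real.exp_pos 1).le (g := v) ?_).trans (by gcongr)
    filter_upwards [coeFn_expFamily v hl (vertical 0 t),
      AEEqFun.coeFn_smul (γ (vertical 0 t)) (V (vertical 0 t))] with a h1 h2
    rw [h2, Pi.smul_apply, hV, h1, norm_smul, norm_mul, Complex.norm_exp (vertical 0 t * _),
      Complex.re_mul_ofReal, vertical_re, zero_mul, Real.exp_zero, mul_one]
    exact mul_le_mul_of_nonneg_right (norm_gaussian_le (vertical_zero_mem t)) (norm_nonneg _)
  · refine (h₁.norm.le_of_le_mul (Real.exp_pos 1).le (g := g) ?_).trans (by gcongr)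
    filter_upwards [coeFn_expFamily v hl (vertical 1 t), hg,
      AEEqFun.coeFn_smul (γ (vertical 1 t)) (V (vertical 1 t))] with a h1 h3 h2
    rw [h2, Pi.smul_apply, hV, h1, h3, norm_smul, norm_mul, norm_mul (v a),
      Complex.norm_exp (vertical 1 t * _), Complex.re_mul_ofReal, vertical_re, one_mul, Complex.norm_real,
      Real.norm_of_nonneg (Real.exp_pos _).le]
    exact mul_le_mul_of_nonneg_right (norm_gaussian_le (vertical_one_mem t)) (by positivity)

end Exponentials

end Butterfly

namespace Butterfly

/-! ### The spaces `X_θ` and their duals -/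

section Convexification

variable {α : Type*} [MeasurableSpace α] {μ : Measure α} {N N₀ N₁ X : ENormOn μ} {θ : ℝ}

/-- At `s = log (A / B)` the two terms of the bound are equal, each being `A^{1-θ} B^θ`. -/
theorem exp_log_div_mul_add {A B : ℝ} (hA : 0 < A) (hB : 0 < B) (θ : ℝ) :
    Real.exp (Real.log (A / B) * (1 - θ)) * B + Real.exp (Real.log (A / B) * (0 - θ)) * A =
      2 * (A ^ (1 - θ) * B ^ θ) := by
  have hab : 0 < A / B := div_pos hA hB
  rw [← Real.rpow_def_of_pos hab, ← Real.rpow_def_of_pos hab, Real.div_rpow hA.le hB.le,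
    Real.div_rpow hA.le hB.le, zero_sub, Real.rpow_neg hA.le, Real.rpow_neg hB.le,
    Real.rpow_sub hA, Real.rpow_sub hB, Real.rpow_one, Real.rpow_one]
  have := (Real.rpow_pos_of_pos hA θ).ne'
  have := (Real.rpow_pos_of_pos hB θ).ne'
  field_simp
  ring

/-- Optimizing the parameter in the pointwise bounds. -/
theorem le_rpow_mul_rpow_of_forall_exp (h0 : 0 < θ) (h1 : θ < 1) {y A B : ℝ} (hA : 0 ≤ A)
    (hB : 0 ≤ B) (h : ∀ s : ℝ, y ≤ Real.exp (s * (1 - θ)) * B + Real.exp (s * (0 - θ)) * A) :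
    y ≤ 2 * (A ^ (1 - θ) * B ^ θ) := by
  -- The optimal parameter makes sense only for positive `A` and `B`; the perturbation by `ε` covers
  -- zero values and is removed by continuity of the powers.
  have key : ∀ ε : ℝ, 0 < ε → y ≤ 2 * ((A + ε) ^ (1 - θ) * (B + ε) ^ θ) := by
    intro ε hε
    rw [← exp_log_div_mul_add (by positivity) (by positivity)]
    refine (h (Real.log ((A + ε) / (B + ε)))).trans (add_le_add ?_ ?_) <;>
    exact mul_le_mul_of_nonneg_left (by linarith) (Real.exp_pos _).le
  have hc : Continuous fun ε : ℝ => 2 * ((A + ε) ^ (1 - θ) * (B + ε) ^ θ) := by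
    have c1 : Continuous fun ε : ℝ => (A + ε) ^ (1 - θ) :=
      (by fun_prop : Continuous fun ε : ℝ => A + ε).rpow_const fun _ => Or.inr (by linarith)
    have c2 : Continuous fun ε : ℝ => (B + ε) ^ θ :=
      (by fun_prop : Continuous fun ε : ℝ => B + ε).rpow_const fun _ => Or.inr h0.le
    exact continuous_const.mul (c1.mul c2)
  have hl : Tendsto (fun ε : ℝ => 2 * ((A + ε) ^ (1 - θ) * (B + ε) ^ θ)) (𝓝[>] 0)
      (𝓝 (2 * (A ^ (1 - θ) * B ^ θ))) := by
    have := hc.tendsto 0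
    rw [add_zero, add_zero] at this
    exact this.mono_left nhdsWithin_le_nhds
  exact ge_of_tendsto hl (eventually_mem_nhdsWithin.mono fun ε hε => key ε hε)

/-- Elements of `X_θ` are dominated by powers of elements of `X`. -/
theorem exists_convexified_majorant (hX : IsKothe X) (h0 : 0 < θ) (h1 : θ < 1) :
    ∃ C : ℝ≥0, ∀ (f : L0 μ) (R : ℝ≥0), convexified X θ f < R →
      ∃ A : L0 μ, X A ≤ C * R ∧
        ∀ᵐ a ∂μ, ‖f a‖ ≤ 2 * (‖A a‖ ^ (1 - θ) * ((C : ℝ) * R) ^ θ) := by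
  obtain ⟨C, hC⟩ := exists_pointwise_bound hX (Linfty_isKothe μ) h0 h1
  refine ⟨C, fun f R hf => ?_⟩
  obtain ⟨F, hF, hFθ, hFR⟩ := exists_of_interp_lt hf
  obtain ⟨D, hD⟩ := hF.analytic θ (ofReal_mem_openStrip h0 h1)
  obtain ⟨A, B, hA, hB, hAB⟩ := hC F R D hF hFR.le hD
  refine ⟨A, hA, ?_⟩
  filter_upwards [hAB, ae_le_of_Linfty_le hB] with a h2 h3
  have h4 : ‖B a‖ ≤ C * R := by
    rw [← ENNReal.coe_mul] at h3
    exact_mod_cast enorm_le_coe.1 h3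
  rw [← hFθ]
  refine le_rpow_mul_rpow_of_forall_exp h0 h1 (norm_nonneg _) (by positivity) fun s => ?_
  exact (h2 s).1.trans (add_le_add (mul_le_mul_of_nonneg_left h4 (Real.exp_pos _).le) le_rfl)

/-- Truncations of functions dominated by powers of elements of `X` are in `X_θ`. -/
theorem convexified_truncation_le (hX : IsKothe X) (h1 : θ < 1) {K : ℝ≥0}
    (hK : 1 ≤ K) {A f x : L0 μ} (hA : X A ≤ K) (hf : ∀ᵐ a ∂μ, ‖f a‖ ≤ ‖A a‖ ^ (1 - θ))
    {S : Set α} (hS : MeasurableSet S) {c : ℝ} (hc : 0 < c)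
    (hSf : ∀ a ∈ S, c⁻¹ ≤ ‖f a‖ ∧ ‖f a‖ ≤ c) (hx : ∀ᵐ a ∂μ, x a = S.indicator f a) :
    convexified X θ x ≤ ENNReal.ofReal (Real.exp 1) * K := by
  set p := (1 - θ)⁻¹ with hp
  have hp0 : 0 < p := inv_pos.2 (by linarith)
  have hpθ : 1 + θ * p = p := by
    have : (1 - θ) ≠ 0 := by linarith
    rw [hp]; field_simp; ring
  have hpp : (1 - θ) * p = 1 := mul_inv_cancel₀ (by linarith)
  -- On `S` write `f = v e^{θ l}`. As `1 + θ p = p`, this gives `|v| = |f|^p ≤ |A|` and `|v e^l| =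
  -- 1`, so `v` is bounded in `X` and `v e^l` in `L_∞`; the latter is where `1 ≤ K` enters. The
  -- two-sided bound on `|f|` over `S` makes `l` bounded.
  set l : α → ℝ := S.indicator fun a => -(p * Real.log ‖f a‖) with hl
  have hfm := f.measurable
  have hlm : Measurable l := Measurable.indicator (by fun_prop) hS
  have hbound : ∀ a, |l a| ≤ p * |Real.log c| := by
    intro a
    by_cases ha : a ∈ S
    · rw [hl, Set.indicator_of_mem ha, abs_neg, abs_mul, abs_of_pos hp0]
      refine mul_le_mul_of_nonneg_left ?_ hp0.le
      obtain ⟨g1, g2⟩ := hSf a ha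
      have hpos : 0 < ‖f a‖ := (inv_pos.2 hc).trans_le g1
      rw [abs_le]
      constructor
      · have := Real.log_le_log (inv_pos.2 hc) g1
        rw [Real.log_inv] at this
        linarith [le_abs_self (Real.log c)]
      · exact (Real.log_le_log hpos g2).trans (le_abs_self _)
    · rw [hl, Set.indicator_of_notMem ha, abs_zero]
      positivity
  have hvm : Measurable fun a => S.indicator f a * Real.exp (-(θ * l a)) :=
    (hfm.indicator hS).mul (by fun_prop)
  have hgm : Measurable fun a => S.indicator f a * Real.exp (-(θ * l a)) * Real.exp (l a) :=
    hvm.mul (by fun_prop)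
  have hv := coeFn_ofMeas μ _ hvm
  have hg := coeFn_ofMeas μ _ hgm
  have hnorm : ∀ a ∈ S, ‖S.indicator f a * Real.exp (-(θ * l a))‖ = Real.exp (p * Real.log ‖f a‖) := by
    intro a ha
    have hpos : 0 < ‖f a‖ := (inv_pos.2 hc).trans_le (hSf a ha).1
    rw [Set.indicator_of_mem ha, norm_mul, Complex.norm_real,
      Real.norm_of_nonneg (Real.exp_pos _).le, hl, Set.indicator_of_mem ha]
    nth_rw 1 [← Real.exp_log hpos]
    rw [← Real.exp_add]
    congr 1
    linear_combination Real.log ‖f a‖ * hpθ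
  refine interp_le_of_exp hX (Linfty_isKothe μ) hlm (m := p * |Real.log c|) (by positivity) hbound
    (v := ofMeas μ _ hvm) (g := ofMeas μ _ hgm) ?_ ?_ ((hX.mono _ _ ?_).trans hA) ?_
  · filter_upwards [hv, hg] with a e1 e2
    rw [e1, e2]
  · filter_upwards [hv, hx] with a e1 e2
    rw [e1, e2, mul_assoc, ← Complex.ofReal_mul, ← Real.exp_add, neg_add_cancel, Real.exp_zero,
      Complex.ofReal_one, mul_one]
  · filter_upwards [hv, hf] with a e1 e2
    rw [e1]
    by_cases ha : a ∈ S
    · rw [hnorm a ha]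
      have hpos : 0 < ‖f a‖ := (inv_pos.2 hc).trans_le (hSf a ha).1
      rw [mul_comm p, ← Real.rpow_def_of_pos hpos]
      refine (Real.rpow_le_rpow hpos.le e2 hp0.le).trans_eq ?_
      rw [← Real.rpow_mul (norm_nonneg _), hpp, Real.rpow_one]
    · rw [Set.indicator_of_notMem ha, zero_mul, norm_zero]
      exact norm_nonneg _
  · refine (Linfty_le_of_ae (C := 1) ?_).trans (by exact_mod_cast hK)
    filter_upwards [hg] with a e1
    rw [e1]
    by_cases ha : a ∈ S
    · rw [← ENNReal.coe_one, enorm_le_coe, ← NNReal.coe_le_coe, coe_nnnorm, norm_mul, hnorm a ha, Complex.norm_real,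
        Real.norm_of_nonneg (Real.exp_pos _).le, ← Real.exp_add, hl, Set.indicator_of_mem ha,
        add_neg_cancel, Real.exp_zero, NNReal.coe_one]
    · simp [Set.indicator_of_notMem ha]

/-- Hölder's inequality between powers of elements of `X` and the dual of `X_θ`. -/
theorem lintegral_mul_le_convexified (hX : IsKothe X) (h0 : 0 < θ) (h1 : θ < 1) {K : ℝ≥0}
    (hK : 1 ≤ K) {A f : L0 μ} (hA : X A ≤ K) (hf : ∀ᵐ a ∂μ, ‖f a‖ ≤ ‖A a‖ ^ (1 - θ)) (g : L0 μ) :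
    ∫⁻ a, ‖f a * g a‖ₑ ∂μ ≤
      ENNReal.ofReal (Real.exp 1) * K * kotheDual (convexified X θ) g := by
  have hZ : IsKothe (convexified X θ) := interp_isKothe hX (Linfty_isKothe μ) h0 h1
  -- These sets increase to `{f ≠ 0}`. The truncations of `f` lie in `X_θ` with a bound independent
  -- of `n`, which is enough for the integral even if `f` itself is not in `X_θ`.
  set S : ℕ → Set α := fun n => {a | ((n : ℝ) + 1)⁻¹ ≤ ‖f a‖ ∧ ‖f a‖ ≤ (n : ℝ) + 1} with hS
  have hfm := f.measurable
  have hSm : ∀ n, MeasurableSet (S n) := fun n =>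
    (measurableSet_le measurable_const hfm.norm).inter (measurableSet_le hfm.norm measurable_const)
  have hmono : Monotone S := by
    intro n k hnk a ha
    have hnk' : (n : ℝ) + 1 ≤ (k : ℝ) + 1 := by exact_mod_cast Nat.succ_le_succ hnk
    exact ⟨(inv_anti₀ (by positivity) hnk').trans ha.1, ha.2.trans hnk'⟩
  have hle : ∀ n, ∫⁻ a in S n, ‖f a * g a‖ₑ ∂μ ≤
      ENNReal.ofReal (Real.exp 1) * K * kotheDual (convexified X θ) g := by
    intro n
    have hxm : Measurable ((S n).indicator f) := hfm.indicator (hSm n)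
    have hx := coeFn_ofMeas μ _ hxm
    have hZx := convexified_truncation_le hX h1 hK hA hf (hSm n) (c := (n : ℝ) + 1)
      (by positivity) (fun a ha => ha) hx
    have hZlt : convexified X θ (ofMeas μ _ hxm) < ∞ :=
      hZx.trans_lt (ENNReal.mul_lt_top ENNReal.ofReal_lt_top ENNReal.coe_lt_top)
    calc ∫⁻ a in S n, ‖f a * g a‖ₑ ∂μ = ∫⁻ a, ‖ofMeas μ _ hxm a * g a‖ₑ ∂μ := by
          rw [← lintegral_indicator (hSm n)]
          refine lintegral_congr_ae ?_
          filter_upwards [hx] with a ha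
          rw [ha]
          by_cases haS : a ∈ S n <;> simp [haS]
      _ ≤ convexified X θ (ofMeas μ _ hxm) * kotheDual (convexified X θ) g :=
          hZ.norm.lintegral_mul_le hZlt g
      _ ≤ _ := by gcongr
  have hunion : ∫⁻ a, ‖f a * g a‖ₑ ∂μ = ∫⁻ a in ⋃ n, S n, ‖f a * g a‖ₑ ∂μ := by
    rw [← lintegral_indicator (MeasurableSet.iUnion hSm)]
    refine lintegral_congr fun a => ?_
    by_cases ha : a ∈ ⋃ n, S n
    · rw [Set.indicator_of_mem ha]
    · rw [Set.indicator_of_notMem ha]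
      have hfa : f a = 0 := by
        by_contra hne
        have hpos : 0 < ‖f a‖ := norm_pos_iff.2 hne
        obtain ⟨n, hn⟩ := exists_nat_ge (max ‖f a‖⁻¹ ‖f a‖)
        refine ha (Set.mem_iUnion.2 ⟨n, ?_, ?_⟩)
        · rw [inv_le_comm₀ (by positivity) hpos]
          linarith [le_max_left ‖f a‖⁻¹ ‖f a‖]
        · linarith [le_max_right ‖f a‖⁻¹ ‖f a‖]
      simp [hfa]
  rw [hunion, setLIntegral_iUnion_of_directed _ hmono.directed_le]
  exact iSup_le hle

theorem kotheDual_mono {f g : L0 μ} (hfg : ∀ᵐ a ∂μ, ‖f a‖ ≤ ‖g a‖) :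
    kotheDual N f ≤ kotheDual N g := by
  refine iSup₂_le fun x hx => le_trans (lintegral_mono_ae ?_) (lintegral_mul_le_kotheDual hx)
  filter_upwards [hfg] with a ha
  rw [enorm_mul, enorm_mul]
  gcongr
  exact enorm_le_iff_norm_le.2 ha

theorem lintegral_enorm_eq_zero {f g : L0 μ} (h : ∫⁻ a, ‖f a * g a‖ₑ ∂μ = 0) :
    ∀ᵐ a ∂μ, f a = 0 ∨ g a = 0 := by
  have hm : Measurable fun a => ‖f a * g a‖ₑ := (f.measurable.mul g.measurable).enorm
  rw [lintegral_eq_zero_iff hm] at h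
  filter_upwards [h] with a ha
  simpa using ha

/-- Elements of the dual of `X_θ` from elements of the dual of `X`. -/
theorem exists_kotheDual_convexified_le (hX : IsKothe X) (h0 : 0 < θ) (h1 : θ < 1) (K : ℝ≥0) :
    ∃ C : ℝ≥0, ∀ b x g : L0 μ, kotheDual X b ≤ K → ∫⁻ a, ‖x a‖ₑ ^ 2 ∂μ ≤ 1 →
      (∀ᵐ a ∂μ, ‖g a‖ ≤ ‖b a‖ ^ (1 - θ) * (‖x a‖ ^ 2) ^ θ) →
      kotheDual (convexified X θ) g ≤ C := by
  obtain ⟨C, hC⟩ := exists_convexified_majorant (μ := μ) hX h0 h1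
  set M : ℝ≥0 := C * 2 with hM
  set c : ℝ≥0 := 2 * M ^ θ with hc
  refine ⟨c * (M * K + 1), fun b x g hb hx hg => iSup₂_le fun f hf => ?_⟩
  obtain ⟨A, hA, hfA⟩ := hC f 2 (hf.trans_lt (by norm_num))
  rw [← ENNReal.coe_mul] at hA
  -- The product of the two majorants is a constant times `|A b|^{1-θ} (|x|²)^θ`, and the weighted
  -- arithmetic-geometric mean inequality separates it into two integrable functions. The radius `2`
  -- above only provides a strict inequality on the unit ball.
  have hpt : ∀ᵐ a ∂μ, ‖f a * g a‖ₑ ≤ c * (‖A a * b a‖ₑ + ‖x a‖ₑ ^ 2) := by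
    filter_upwards [hfA, hg] with a e1 e2
    have h3 : ‖f a * g a‖ ≤ c * (‖A a * b a‖ + ‖x a‖ ^ 2) := by
      have am := Real.geom_mean_le_arith_mean2_weighted (w₁ := 1 - θ) (w₂ := θ) (by linarith) h0.le
        (p₁ := ‖A a * b a‖) (p₂ := ‖x a‖ ^ 2) (norm_nonneg _) (by positivity) (by ring)
      have am' : ‖A a * b a‖ ^ (1 - θ) * (‖x a‖ ^ 2) ^ θ ≤ ‖A a * b a‖ + ‖x a‖ ^ 2 := by
        refine am.trans (add_le_add ?_ ?_)
        · exact mul_le_of_le_one_left (norm_nonneg _) (by linarith)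
        · exact mul_le_of_le_one_left (by positivity) h1.le
      have hcv : (c : ℝ) = 2 * ((C : ℝ) * (2 : ℝ≥0)) ^ θ := by
        rw [hc, hM]; push_cast; rfl
      rw [norm_mul]
      calc ‖f a‖ * ‖g a‖ ≤ (2 * (‖A a‖ ^ (1 - θ) * ((C : ℝ) * (2 : ℝ≥0)) ^ θ)) *
            (‖b a‖ ^ (1 - θ) * (‖x a‖ ^ 2) ^ θ) :=
            mul_le_mul e1 e2 (norm_nonneg _) (by positivity)
        _ = c * (‖A a * b a‖ ^ (1 - θ) * (‖x a‖ ^ 2) ^ θ) := by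
            rw [hcv, norm_mul, Real.mul_rpow (norm_nonneg _) (norm_nonneg _)]
            ring
        _ ≤ _ := mul_le_mul_of_nonneg_left am' c.coe_nonneg
    have h4 : ((‖f a * g a‖₊ : ℝ≥0) : ℝ) ≤ ((c * (‖A a * b a‖₊ + ‖x a‖₊ ^ 2) : ℝ≥0) : ℝ) := by
      push_cast
      exact h3
    have h5 : ‖f a * g a‖₊ ≤ c * (‖A a * b a‖₊ + ‖x a‖₊ ^ 2) := h4
    simp only [enorm_eq_nnnorm]
    exact_mod_cast h5
  have hm : Measurable fun a => ‖A a * b a‖ₑ := (A.measurable.mul b.measurable).enorm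
  calc ∫⁻ a, ‖f a * g a‖ₑ ∂μ ≤ ∫⁻ a, c * (‖A a * b a‖ₑ + ‖x a‖ₑ ^ 2) ∂μ := lintegral_mono_ae hpt
    _ = c * (∫⁻ a, ‖A a * b a‖ₑ ∂μ + ∫⁻ a, ‖x a‖ₑ ^ 2 ∂μ) := by
        rw [lintegral_const_mul' _ _ ENNReal.coe_ne_top,
          lintegral_add_left hm]
    _ ≤ c * (M * K + 1) := by
        gcongr
        exact (hX.norm.lintegral_mul_le (hA.trans_lt ENNReal.coe_lt_top) b).trans
          (mul_le_mul' hA hb)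
    _ = _ := by push_cast; rfl

/-- If `[X, X^*]_θ` is a normed function space then the dual of `X` is a normed space. -/
theorem eq_zero_of_kotheDual_eq_zero (hX : IsKothe X)
    (hX2 : SameSpace (interp X (kotheDual X) (1 / 2)) (L2 μ)) {g : L0 μ}
    (hg : kotheDual X g = 0) : g = 0 := by
  -- `F` is constant in the open strip and jumps only on the left line, where the jump `g` is
  -- invisible to the sum seminorm. It is thus in the Calderón space with norm zero, which forces
  -- the interpolation norm of `g`, and so its `L₂` norm, to vanish.
  set F : ℂ → L0 μ := fun z => if z.re = 0 then 0 else g with hF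
  have hzero : ∀ᵐ a ∂μ, ‖(0 : L0 μ) a‖ ≤ ‖g a‖ := by
    filter_upwards [AEEqFun.coeFn_zero (μ := μ) (α := α) (β := ℂ)] with a ha
    rw [ha]
    simp
  have hval : ∀ z w, kotheDual X (F z - F w) = 0 := by
    intro z w
    refine le_antisymm (le_trans (kotheDual_mono ?_) hg.le) zero_le
    by_cases hz : z.re = 0 <;> by_cases hw : w.re = 0
    · simpa [hF, hz, hw] using hzero
    · simp only [hF, hz, hw, if_true, if_false, zero_sub]
      filter_upwards [AEEqFun.coeFn_neg g] with a ha
      rw [ha, Pi.neg_apply, norm_neg]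
    · simp [hF, hz, hw]
    · simpa [hF, hz, hw] using hzero
  have hval' : ∀ z, kotheDual X (F z) = 0 := by
    intro z
    have := hval z 0
    simpa [hF] using this
  have hsum : ∀ f, kotheDual X f = 0 → sumNorm X (kotheDual X) f = 0 := fun f hf =>
    le_antisymm ((sumNorm_le_right hX.norm f).trans hf.le) zero_le
  have h0 : ∀ t, F (vertical 0 t) = 0 := fun t => by simp [hF, vertical_re]
  have hmem : MemCalderon X (kotheDual X) F := by
    refine ⟨⟨0, fun z _ => (hsum _ (hval' z)).le⟩, fun z _ => ?_, fun z hz => ⟨0, ?_⟩, ?_, ?_⟩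
    · simp only [hsum _ (hval _ _)]
      exact tendsto_const_nhds
    · refine tendsto_const_nhds.congr' ?_
      filter_upwards [mem_nhdsWithin_of_mem_nhds (isOpen_openStrip.mem_nhds hz)] with w hw
      have : F w - F z = 0 := by
        simp [hF, hw.1.ne', hz.1.ne']
      rw [this, sub_zero, show (w - z)⁻¹ • (0 : L0 μ) = 0 from smul_zero (A := L0 μ) ((w - z)⁻¹ : ℂ)]
      exact (hsum 0 (by simpa using hval 0 0)).symm
    · refine ⟨fun t => ?_, fun t => ?_, ?_⟩ <;> simp only [h0, sub_zero, hX.norm.zero]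
      · exact ENNReal.zero_lt_top
      · exact tendsto_const_nhds
      · exact tendsto_const_nhds
    · refine ⟨fun t => ?_, fun t => ?_, ?_⟩ <;> simp only [hval, hval']
      · exact ENNReal.zero_lt_top
      · exact tendsto_const_nhds
      · exact tendsto_const_nhds
  have hFg : F ((1 / 2 : ℝ) : ℂ) = g := by
    simp [hF]
  have hint : interp X (kotheDual X) (1 / 2) g = 0 := by
    refine le_antisymm ((interp_le hmem hFg).trans (calderonNorm_le (fun t => ?_) fun t => ?_))
      zero_le
    · rw [h0, hX.norm.zero]
    · rw [hval']
  obtain ⟨C, hC⟩ := hX2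
  have h2 := (hC g).2
  rw [hint, mul_zero, nonpos_iff_eq_zero, L2, eLpNorm_eq_zero_iff g.aestronglyMeasurable
    two_ne_zero] at h2
  exact AEEqFun.ext (h2.trans AEEqFun.coeFn_zero.symm)

/-- For `A` in the unit ball of `X`, Hölder's inequality for `|A|^{1-θ}` shows that `|A|^{1-θ} g`
vanishes almost everywhere. This power has the same zeros as `A`, so `A g = 0` as well and
saturation of `X` applies. -/
theorem eq_zero_of_kotheDual_convexified_eq_zero (hX : IsKothe X)
    (hs : ∀ g, kotheDual X g = 0 → g = 0) (h0 : 0 < θ) (h1 : θ < 1) {g : L0 μ}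
    (hg : kotheDual (convexified X θ) g = 0) : g = 0 := by
  refine hs g ?_
  simp only [kotheDual, ENNReal.iSup_eq_zero]
  intro A hA
  have hAm := A.measurable
  have hfm : Measurable fun a => ((‖A a‖ ^ (1 - θ) : ℝ) : ℂ) := by fun_prop
  have hf := coeFn_ofMeas μ _ hfm
  have key := lintegral_mul_le_convexified hX h0 h1 (K := 1) le_rfl (A := A) (f := ofMeas μ _ hfm)
    (by simpa using hA) (by
      filter_upwards [hf] with a ha
      rw [ha, Complex.norm_real, Real.norm_of_nonneg (by positivity)]) g
  rw [hg, mul_zero, nonpos_iff_eq_zero] at key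
  rw [← lintegral_zero (μ := μ)]
  refine lintegral_congr_ae ?_
  filter_upwards [hf, lintegral_enorm_eq_zero key] with a h2 h3
  rcases h3 with h3 | h3
  · rw [h2] at h3
    have h4 : ‖A a‖ ^ (1 - θ) = 0 := by exact_mod_cast h3
    rw [Real.rpow_eq_zero (norm_nonneg _) (by linarith), norm_eq_zero] at h4
    simp [h4]
  · simp [h3]

end Convexification

end Butterfly

namespace Butterfly

/-! ### Square integrability and the logarithmic form of differentials -/

section Hilbert

variable {α : Type*} [MeasurableSpace α] {μ : Measure α} {N M X : ENormOn μ} {θ : ℝ}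

theorem L2_isKotheNorm (μ : Measure α) : IsKotheNorm (L2 μ) := by
  refine ⟨fun f => ?_, fun f g => ?_, fun c f => ?_, fun f g hfg => ?_⟩
  · unfold L2
    rw [eLpNorm_eq_zero_iff f.aestronglyMeasurable two_ne_zero]
    constructor
    · intro h
      exact AEEqFun.ext (h.trans AEEqFun.coeFn_zero.symm)
    · rintro rfl
      exact AEEqFun.coeFn_zero
  · unfold L2
    rw [eLpNorm_congr_ae (AEEqFun.coeFn_add f g)]
    exact eLpNorm_add_le f.aestronglyMeasurable g.aestronglyMeasurable (by norm_num)
  · unfold L2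
    rw [eLpNorm_congr_ae (AEEqFun.coeFn_smul c f), eLpNorm_const_smul]
  · exact eLpNorm_mono_ae hfg

theorem L2_sq (f : L0 μ) : L2 μ f ^ 2 = ∫⁻ a, ‖f a‖ₑ ^ 2 ∂μ := by
  have := eLpNorm_nnreal_pow_eq_lintegral (μ := μ) (f := f) (p := 2) two_ne_zero
  unfold L2
  simpa using this

theorem L2_le_of_lintegral_le {f : L0 μ} {C : ℝ≥0∞} (h : ∫⁻ a, ‖f a‖ₑ ^ 2 ∂μ ≤ C ^ 2) :
    L2 μ f ≤ C := by
  rw [← L2_sq] at h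
  exact (ENNReal.pow_le_pow_left_iff two_ne_zero).1 h

theorem lintegral_sq_le_one {f : L0 μ} (h : L2 μ f ≤ 1) : ∫⁻ a, ‖f a‖ₑ ^ 2 ∂μ ≤ 1 := by
  rw [← L2_sq]
  exact pow_le_one' h 2

/-- A homogeneous estimate follows from the estimate on the unit ball. -/
theorem le_mul_of_le_on_ball {K : ENormOn μ} (hK : IsKotheNorm K) {Φ : L0 μ → L0 μ} (hN : IsKotheNorm N) {C : ℝ≥0∞}
    (hΦ : ∀ (c : ℂ) x, K x < ∞ → Φ (c • x) = c • Φ x)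
    (h : ∀ x, K x ≤ 1 → N (Φ x) ≤ C) {x : L0 μ} (hx : K x < ∞) : N (Φ x) ≤ C * K x := by
  rcases eq_or_ne (K x) 0 with h0 | h0
  · rw [hK.eq_zero_iff] at h0
    subst h0
    have h1 := hΦ 0 0 hx
    rw [show (0 : ℂ) • (0 : L0 μ) = 0 from zero_smul ℂ (0 : L0 μ),
      show (0 : ℂ) • Φ 0 = 0 from zero_smul ℂ (Φ 0)] at h1
    rw [h1, hN.zero]
    exact zero_le
  · set r := (K x).toReal with hr
    have hr0 : 0 < r := ENNReal.toReal_pos h0 hx.ne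
    have hrx : ‖(r : ℂ)‖ₑ = K x := by
      rw [← ofReal_norm, Complex.norm_real, Real.norm_of_nonneg hr0.le, hr,
        ENNReal.ofReal_toReal hx.ne]
    have hrc : (r : ℂ) ≠ 0 := by exact_mod_cast hr0.ne'
    have hxr : x = (r : ℂ) • ((r : ℂ)⁻¹ • x) := by
      rw [smul_smul, mul_inv_cancel₀ hrc, show (1 : ℂ) • x = x from one_smul ℂ x]
    have hy : K ((r : ℂ)⁻¹ • x) = 1 := by
      rw [hK.smul, enorm_inv hrc, hrx, ENNReal.inv_mul_cancel h0 hx.ne]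
    calc N (Φ x) = N (Φ ((r : ℂ) • ((r : ℂ)⁻¹ • x))) := by rw [← hxr]
      _ = ‖(r : ℂ)‖ₑ * N (Φ ((r : ℂ)⁻¹ • x)) := by rw [hΦ _ _ (hy ▸ ENNReal.one_lt_top), hN.smul]
      _ ≤ K x * C := by
          rw [hrx]
          gcongr
          exact h _ hy.le
      _ = C * K x := mul_comm _ _

/-- Functions in `[N, N^*]_{1/2}` are square roots of products. -/
theorem sq_le_of_forall_exp {y A B : ℝ} (hy : 0 ≤ y) (hA : 0 ≤ A) (hB : 0 ≤ B)
    (h : ∀ s : ℝ, y ≤ Real.exp (s * (1 - (1 / 2 : ℝ))) * B + Real.exp (s * (0 - (1 / 2 : ℝ))) * A) :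
    y ^ 2 ≤ 4 * (A * B) := by
  have h1 := le_rpow_mul_rpow_of_forall_exp (by norm_num) (by norm_num) hA hB h
  calc y ^ 2 ≤ (2 * (A ^ (1 - (1 / 2 : ℝ)) * B ^ (1 / 2 : ℝ))) ^ 2 := pow_le_pow_left₀ hy h1 2
    _ = 4 * (A * B) := by
        rw [show (1 - (1 / 2 : ℝ)) = 1 / 2 by norm_num, ← Real.sqrt_eq_rpow, ← Real.sqrt_eq_rpow,
          mul_pow, mul_pow, Real.sq_sqrt hA, Real.sq_sqrt hB]
        norm_num

theorem enorm_sq_le {x y : ℂ} {c : ℝ≥0} (h : ‖x‖ ^ 2 ≤ c * ‖y‖) : ‖x‖ₑ ^ 2 ≤ c * ‖y‖ₑ := by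
  have h5 : ‖x‖₊ ^ 2 ≤ c * ‖y‖₊ := by
    rw [← NNReal.coe_le_coe]
    push_cast
    exact h
  simp only [enorm_eq_nnnorm]
  exact_mod_cast h5

/-- The pointwise bounds give `|x|² ≤ 4 |A| |B|` with `A` in the space and `B` in its dual, and the
right side is integrable by Hölder's inequality. One inclusion of `[N, N^*]_{1/2} = L₂` is thus
automatic. -/
theorem exists_L2_le_interp (hN : IsKothe N) (hN' : IsKothe (kotheDual N)) :
    ∃ C : ℝ≥0, ∀ x, L2 μ x ≤ C * interp N (kotheDual N) (1 / 2) x := by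
  have h0 : (0 : ℝ) < 1 / 2 := by norm_num
  have h1 : (1 / 2 : ℝ) < 1 := by norm_num
  obtain ⟨C, hC⟩ := exists_pointwise_bound hN hN' h0 h1
  refine ⟨2 * C * 2 + 1, fun x => ?_⟩
  have key : ∀ (x : L0 μ) (R : ℝ≥0), interp N (kotheDual N) (1 / 2) x < R → L2 μ x ≤ (2 * C : ℝ≥0) * R := by
    intro x R hR
    obtain ⟨F, hF, hFx, hFR⟩ := exists_of_interp_lt hR
    obtain ⟨D, hD⟩ := hF.analytic _ (ofReal_mem_openStrip h0 h1)
    obtain ⟨A, B, hA, hB, hAB⟩ := hC F R D hF hFR.le hD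
    apply L2_le_of_lintegral_le
    have hA' : N A < ∞ := hA.trans_lt (by finiteness)
    calc ∫⁻ a, ‖x a‖ₑ ^ 2 ∂μ ≤ ∫⁻ a, (4 : ℝ≥0) * ‖A a * B a‖ₑ ∂μ := by
          refine lintegral_mono_ae ?_
          filter_upwards [hAB] with a ha
          apply enorm_sq_le
          rw [← hFx, norm_mul]
          exact sq_le_of_forall_exp (norm_nonneg _) (norm_nonneg _) (norm_nonneg _)
            fun s => (ha s).1
      _ = (4 : ℝ≥0) * ∫⁻ a, ‖A a * B a‖ₑ ∂μ := lintegral_const_mul' _ _ ENNReal.coe_ne_top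
      _ ≤ (4 : ℝ≥0) * ((C * R) * (C * R)) := by
          gcongr
          exact (hN.norm.lintegral_mul_le hA' B).trans (mul_le_mul' hA hB)
      _ = ((2 * C : ℝ≥0) * R) ^ 2 := by
          norm_cast
          ring
  rcases eq_or_ne (interp N (kotheDual N) (1 / 2) x) ∞ with hi | hi
  · rw [hi, ENNReal.mul_top (by simp)]
    exact le_top
  · exact le_mul_of_le_on_ball (interp_isKotheNorm hN hN' h0 h1) (L2_isKotheNorm μ) (Φ := id)
      (fun c x _ => rfl) (fun x hx => (key x 2 (hx.trans_lt (by norm_num))).trans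
        (by norm_cast; linarith)) hi.lt_top

/-- Differentials are logarithms, up to square roots of products. -/
theorem norm_sub_log_sq_le {x D : ℂ} {A B A' B' : ℝ} (hA : 0 ≤ A) (hB : 0 ≤ B) (hA' : 0 ≤ A')
    (hB' : 0 ≤ B') (hx : ‖x‖ ^ 2 ≤ A' * B')
    (h : ∀ s : ℝ, ‖D + s * x‖ ≤
      Real.exp (s * (1 - (1 / 2 : ℝ))) * B + Real.exp (s * (0 - (1 / 2 : ℝ))) * A) :
    ‖D - x * Real.log (B' / A')‖ ^ 2 ≤ 16 * ((A + A') * (B + B')) := by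
  rcases (mul_nonneg hA' hB').eq_or_lt with h0 | h0
  · have hx0 : x = 0 := by
      rw [← norm_eq_zero]
      nlinarith [norm_nonneg x]
    subst hx0
    have h1 : ‖D‖ ^ 2 ≤ 4 * (A * B) :=
      sq_le_of_forall_exp (norm_nonneg _) hA hB fun s => by simpa using h s
    rw [zero_mul, sub_zero]
    nlinarith [mul_nonneg hA hB', mul_nonneg hA' hB, mul_nonneg hA' hB', mul_nonneg hA hB]
  · have pA' : 0 < A' := lt_of_le_of_ne hA' fun e => by simp [← e] at h0
    have pB' : 0 < B' := lt_of_le_of_ne hB' fun e => by simp [← e] at h0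
    -- The pairs `(A, B)` and `(A', B')` are both compared with the larger pair `(P, Q)`. The
    -- logarithm is controlled by `log t ≤ 2 √t` for `t ≥ 1`: it yields `|x| log (P / A') ≤ 2 √(P
    -- B')`, and similarly for `Q`.
    set P := A + A' with hP
    set Q := B + B' with hQ
    have pP : 0 < P := by positivity
    have pQ : 0 < Q := by positivity
    set w := Real.sqrt (P * Q) with hw
    have hlog : ∀ {t : ℝ}, 1 ≤ t → 0 ≤ Real.log t ∧ Real.log t ≤ 2 * Real.sqrt t := by
      intro t ht
      refine ⟨Real.log_nonneg ht, ?_⟩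
      have h1 := Real.log_le_sub_one_of_pos (Real.sqrt_pos.2 (by linarith : 0 < t))
      rw [Real.log_sqrt (by linarith)] at h1
      linarith
    have hxs : ‖x‖ ≤ Real.sqrt (A' * B') := Real.le_sqrt_of_sq_le hx
    have e1 := hlog ((one_le_div pA').2 (by linarith : A' ≤ P))
    have e2 := hlog ((one_le_div pB').2 (by linarith : B' ≤ Q))
    have f1 : ‖x‖ * Real.log (P / A') ≤ 2 * w := by
      calc ‖x‖ * Real.log (P / A') ≤ Real.sqrt (A' * B') * (2 * Real.sqrt (P / A')) :=
            mul_le_mul hxs e1.2 e1.1 (Real.sqrt_nonneg _)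
        _ = 2 * Real.sqrt (P * B') := by
            rw [mul_left_comm, ← Real.sqrt_mul (by positivity)]
            congr 2
            field_simp
        _ ≤ 2 * w := by
            rw [hw]
            gcongr
            linarith
    have f2 : ‖x‖ * Real.log (Q / B') ≤ 2 * w := by
      calc ‖x‖ * Real.log (Q / B') ≤ Real.sqrt (A' * B') * (2 * Real.sqrt (Q / B')) :=
            mul_le_mul hxs e2.2 e2.1 (Real.sqrt_nonneg _)
        _ = 2 * Real.sqrt (A' * Q) := by
            rw [mul_left_comm, ← Real.sqrt_mul (by positivity)]
            congr 2
            field_simp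
        _ ≤ 2 * w := by
            rw [hw]
            gcongr
            linarith
    have f3 : ‖D + Real.log (P / Q) * x‖ ≤ 2 * w := by
      refine (h _).trans ((add_le_add (mul_le_mul_of_nonneg_left (by linarith : B ≤ Q)
        (Real.exp_pos _).le) (mul_le_mul_of_nonneg_left (by linarith : A ≤ P)
        (Real.exp_pos _).le)).trans_eq ?_)
      rw [exp_log_div_mul_add pP pQ, show (1 - (1 / 2 : ℝ)) = 1 / 2 by norm_num,
        ← Real.sqrt_eq_rpow, ← Real.sqrt_eq_rpow, hw, Real.sqrt_mul pP.le]
    -- The first term is the hypothesis at the optimal parameter for `(P, Q)`; the second is the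
    -- cost of replacing `(P, Q)` by `(A', B')`. Each is at most `2 √(P Q)`.
    have e3 : D - x * Real.log (B' / A') = (D + Real.log (P / Q) * x) -
        ((Real.log (P / A') - Real.log (Q / B') : ℝ) : ℂ) * x := by
      rw [Real.log_div pP.ne' pQ.ne', Real.log_div pP.ne' pA'.ne', Real.log_div pQ.ne' pB'.ne',
        Real.log_div pB'.ne' pA'.ne']
      push_cast
      ring
    have f4 : ‖((Real.log (P / A') - Real.log (Q / B') : ℝ) : ℂ) * x‖ ≤ 2 * w := by
      rw [norm_mul, Complex.norm_real, Real.norm_eq_abs]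
      have n1 := mul_nonneg (norm_nonneg x) e1.1
      have n2 := mul_nonneg (norm_nonneg x) e2.1
      have e : |Real.log (P / A') - Real.log (Q / B')| * ‖x‖ =
          |‖x‖ * Real.log (P / A') - ‖x‖ * Real.log (Q / B')| := by
        rw [← mul_sub, abs_mul, abs_of_nonneg (norm_nonneg x), mul_comm]
      rw [e, abs_le]
      constructor <;> linarith
    have f5 : ‖D - x * Real.log (B' / A')‖ ≤ 4 * w := by
      rw [e3]
      exact (norm_sub_le _ _).trans (by linarith)
    calc ‖D - x * Real.log (B' / A')‖ ^ 2 ≤ (4 * w) ^ 2 := pow_le_pow_left₀ (norm_nonneg _) f5 2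
      _ = 16 * (P * Q) := by
          rw [mul_pow, hw, Real.sq_sqrt (by positivity)]
          norm_num

end Hilbert

end Butterfly

namespace Butterfly

/-! ### Identification of `[X_θ, X_θ^*]_{1/2}` with `L₂` -/

section Factorization

variable {α : Type*} [MeasurableSpace α] {μ : Measure α} {N M X : ENormOn μ} {θ : ℝ}

theorem zero_lt_half : (0 : ℝ) < 1 / 2 := by norm_num

theorem half_lt_one_real : (1 / 2 : ℝ) < 1 := by norm_num

/-- Factorization of square integrable functions through a space and its dual. -/
theorem exists_factorization (hX : IsKothe X) (hX' : IsKothe (kotheDual X))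
    (hX2 : SameSpace (interp X (kotheDual X) (1 / 2)) (L2 μ)) :
    ∃ K : ℝ≥0, 1 ≤ K ∧ ∀ x : L0 μ, L2 μ x ≤ 1 → ∃ A B : L0 μ, X A ≤ K ∧ kotheDual X B ≤ K ∧
      ∀ᵐ a ∂μ, ‖x a‖ ^ 2 ≤ ‖A a‖ * ‖B a‖ := by
  obtain ⟨C, hC⟩ := exists_pointwise_bound hX hX' zero_lt_half half_lt_one_real
  obtain ⟨C₂, hC₂⟩ := hX2
  refine ⟨4 * (C * (C₂ + 1)) + 1, le_add_self, fun x hx => ?_⟩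
  have hlt : interp X (kotheDual X) (1 / 2) x < ((C₂ + 1 : ℝ≥0) : ℝ≥0∞) := by
    refine ((hC₂ x).1.trans (mul_le_of_le_one_right' hx)).trans_lt ?_
    exact_mod_cast lt_add_one C₂
  obtain ⟨F, hF, hFx, hFR⟩ := exists_of_interp_lt hlt
  obtain ⟨D, hD⟩ := hF.analytic _ (ofReal_mem_openStrip zero_lt_half half_lt_one_real)
  obtain ⟨A, B, hA, hB, hAB⟩ := hC F _ D hF hFR.le hD
  -- The constant of `sq_le_of_forall_exp` is absorbed into the first factor.
  refine ⟨(4 : ℂ) • A, B, ?_, hB.trans ?_, ?_⟩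
  · rw [hX.norm.smul]
    refine (mul_le_mul_right hA _).trans ?_
    rw [show ‖(4 : ℂ)‖ₑ = ((4 : ℝ≥0) : ℝ≥0∞) by rw [enorm_eq_nnnorm]; simp]
    norm_cast
    exact le_self_add
  · norm_cast
    refine le_trans ?_ le_self_add
    exact le_mul_of_one_le_left' (by norm_num)
  · filter_upwards [hAB, AEEqFun.coeFn_smul (4 : ℂ) A] with a ha h4
    rw [h4, Pi.smul_apply, norm_smul, ← hFx, mul_assoc]
    simpa using sq_le_of_forall_exp (norm_nonneg _) (norm_nonneg (A a)) (norm_nonneg (B a))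
      fun s => (ha s).1

/-- A bounded approximate right inverse gives an exact one. -/
theorem le_of_approx (hM : IsKothe M) (hN : IsKotheNorm N) {C' C : ℝ≥0}
    (hNM : ∀ x, N x ≤ C' * M x)
    (H : ∀ x, N x ≤ 1 → ∃ y, M y ≤ C ∧ N (x - y) ≤ 2⁻¹) {x : L0 μ} (hx : N x ≤ 1) :
    M x ≤ 2 * C := by
  choose! Y hY hY2 using H
  -- The residuals are doubled at each step so as to remain in the unit ball. Then `x` minus the
  -- first `n` terms `2^{-k} Y (z k)` equals `2^{-n} z n`, and the geometric series accounts for the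
  -- factor `2` in the conclusion.
  set z : ℕ → L0 μ := fun n => Nat.rec x (fun _ z => (2 : ℂ) • (z - Y z)) n with hz
  have hzs : ∀ n, z (n + 1) = (2 : ℂ) • (z n - Y (z n)) := fun n => rfl
  have two : ‖(2 : ℂ)‖ₑ = 2 := by rw [enorm_eq_nnnorm]; simp
  have hz1 : ∀ n, N (z n) ≤ 1 := by
    intro n
    induction n with
    | zero => exact hx
    | succ n ih =>
      rw [hzs, hN.smul, two]
      refine (mul_le_mul_right (hY2 _ ih) _).trans_eq ?_
      exact ENNReal.mul_inv_cancel two_ne_zero (by simp)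
  set u : ℕ → L0 μ := fun k => ((2 : ℂ)⁻¹ ^ k) • Y (z k) with hu
  have hpow : ∀ k : ℕ, ‖(2 : ℂ)⁻¹ ^ k‖ₑ = 2⁻¹ ^ k := by
    intro k
    rw [enorm_pow, enorm_inv two_ne_zero, two]
  have hsum : ∀ n, x - ∑ k ∈ Finset.range n, u k = ((2 : ℂ)⁻¹ ^ n) • z n := by
    intro n
    induction n with
    | zero => simp [hz]
    | succ n ih =>
      rw [Finset.sum_range_succ, ← sub_sub, ih, hzs, smul_smul, pow_succ, mul_assoc,
        inv_mul_cancel₀ two_ne_zero, mul_one]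
      exact (smul_sub ((2 : ℂ)⁻¹ ^ n) (z n) (Y (z n))).symm
  have hMu : ∀ k, M (u k) ≤ 2⁻¹ ^ k * C := fun k => by
    rw [hu, hM.smul, hpow]
    gcongr
    exact hY _ (hz1 k)
  have htot : ∑' k, M (u k) ≤ 2 * C := by
    refine (ENNReal.tsum_le_tsum hMu).trans_eq ?_
    rw [ENNReal.tsum_mul_right, ENNReal.tsum_geometric]
    simp
  have htop : (2 : ℝ≥0∞) * C ≠ ∞ := by finiteness
  obtain ⟨f, hf, hlim⟩ := hM.series u (htot.trans_lt htop.lt_top).ne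
  -- The series converges to `f` in `M`, by completeness, and to `x` in `N`. The bound `hNM`
  -- transfers the first convergence to `N`, where limits are unique.
  have hxf : x = f := by
    rw [← sub_eq_zero, ← hN.eq_zero_iff]
    refine le_antisymm ?_ zero_le
    have hle : ∀ n, N (x - f) ≤ 2⁻¹ ^ n + C' * M (f - ∑ k ∈ Finset.range n, u k) := by
      intro n
      have e : x - f = (x - ∑ k ∈ Finset.range n, u k) - (f - ∑ k ∈ Finset.range n, u k) := by
        abel
      rw [e]
      refine (hN.sub_le _ _).trans (add_le_add ?_ (hNM _))
      rw [hsum, hN.smul, hpow]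
      exact mul_le_of_le_one_right' (hz1 n)
    have hT : Tendsto (fun n : ℕ => (2⁻¹ : ℝ≥0∞) ^ n + C' * M (f - ∑ k ∈ Finset.range n, u k))
        atTop (𝓝 (0 + C' * 0)) :=
      (ENNReal.tendsto_pow_atTop_nhds_zero_of_lt_one (by simp)).add
        (ENNReal.Tendsto.const_mul hlim (Or.inr ENNReal.coe_ne_top))
    rw [mul_zero, add_zero] at hT
    exact ge_of_tendsto' hT hle
  rw [hxf]
  have hle : ∀ n, M f ≤ M (f - ∑ k ∈ Finset.range n, u k) + 2 * C := by
    intro n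
    calc M f = M ((f - ∑ k ∈ Finset.range n, u k) + ∑ k ∈ Finset.range n, u k) := by
          rw [sub_add_cancel]
      _ ≤ M (f - ∑ k ∈ Finset.range n, u k) + M (∑ k ∈ Finset.range n, u k) := hM.add_le _ _
      _ ≤ _ := by
          gcongr
          refine le_trans ?_ ((ENNReal.sum_le_tsum (Finset.range n)).trans htot)
          exact Finset.le_sum_of_subadditive M hM.norm.zero.le hM.add_le _ _
  have hT := hlim.add_const (2 * (C : ℝ≥0∞))
  rw [zero_add] at hT
  exact ge_of_tendsto' hT hle

/-- Square integrable functions are approximated by bounded sets of `[X_θ, X_θ^*]_{1/2}`. -/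
theorem exists_approx_convexified (hX : IsKothe X) (hX' : IsKothe (kotheDual X))
    (hX2 : SameSpace (interp X (kotheDual X) (1 / 2)) (L2 μ)) (h0 : 0 < θ) (h1 : θ < 1)
    (hZ' : IsKothe (kotheDual (convexified X θ))) :
    ∃ C : ℝ≥0, ∀ x : L0 μ, L2 μ x ≤ 1 → ∃ y,
      interp (convexified X θ) (kotheDual (convexified X θ)) (1 / 2) y ≤ C ∧
        L2 μ (x - y) ≤ 2⁻¹ := by
  obtain ⟨K, hK, H⟩ := exists_factorization hX hX' hX2
  obtain ⟨C₁, hC₁⟩ := exists_kotheDual_convexified_le (μ := μ) hX h0 h1 K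
  have hZ : IsKothe (convexified X θ) := interp_isKothe hX (Linfty_isKothe μ) h0 h1
  set E : ℝ≥0 := ⟨Real.exp 1, (Real.exp_pos 1).le⟩ with hE
  have hEc : ENNReal.ofReal (Real.exp 1) = E := ENNReal.ofReal_eq_coe_nnreal (Real.exp_pos 1).le
  refine ⟨E * (E * K + C₁), fun x hx => ?_⟩
  obtain ⟨A, B, hA, hB, hAB⟩ := H x hx
  have hxm := x.measurable
  have hBm := B.measurable
  -- With `f = x e^{-l/2}` the exponents give, where `x ≠ 0`, `|f| = (|x|² / |B|)^{1-θ} ≤ |A|^{1-θ}`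
  -- and `|f e^l| = |B|^{1-θ} |x|^{2θ}`. These are the factors for `X_θ` and its dual, and `x = f
  -- e^{l/2}` is the midpoint of the exponential family.
  set l : α → ℝ := fun a => 2 * (1 - θ) * Real.log ‖B a‖ + (4 * θ - 2) * Real.log ‖x a‖ with hl
  have hlm : Measurable l := by fun_prop
  have hfm : Measurable fun a => x a * Real.exp (-(1 / 2 * l a)) := by fun_prop
  set f := ofMeas μ _ hfm with hfdef
  have hf : ∀ᵐ a ∂μ, f a = x a * Real.exp (-(1 / 2 * l a)) := coeFn_ofMeas μ _ hfm
  have hfm' := f.measurable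
  have hfA : ∀ᵐ a ∂μ, ‖f a‖ ≤ ‖A a‖ ^ (1 - θ) := by
    filter_upwards [hf, hAB] with a e1 e2
    rw [e1]
    rcases eq_or_ne (x a) 0 with hx0 | hx0
    · rw [hx0, zero_mul, norm_zero]
      positivity
    · have px : 0 < ‖x a‖ := norm_pos_iff.2 hx0
      have pAB : 0 < ‖A a‖ * ‖B a‖ := (pow_pos px 2).trans_le e2
      have pA : 0 < ‖A a‖ := pos_of_mul_pos_left pAB (norm_nonneg _)
      have pB : 0 < ‖B a‖ := pos_of_mul_pos_right pAB (norm_nonneg _)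
      have e3 := Real.log_le_log (pow_pos px 2) e2
      rw [Real.log_mul pA.ne' pB.ne', Real.log_pow] at e3
      push_cast at e3
      rw [norm_mul, Complex.norm_real, Real.norm_of_nonneg (Real.exp_pos _).le,
        Real.rpow_def_of_pos pA]
      nth_rw 1 [← Real.exp_log px]
      rw [← Real.exp_add, Real.exp_le_exp, hl]
      nlinarith
  set S : ℕ → Set α := fun n => {a | (((n : ℝ) + 1)⁻¹ ≤ ‖f a‖ ∧ ‖f a‖ ≤ (n : ℝ) + 1) ∧
    |l a| ≤ n} with hS
  have hSm : ∀ n, MeasurableSet (S n) := fun n =>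
    ((measurableSet_le measurable_const hfm'.norm).inter
      (measurableSet_le hfm'.norm measurable_const)).inter
      (measurableSet_le (continuous_abs.measurable.comp hlm) measurable_const)
  have hym : ∀ n, Measurable ((S n).indicator x) := fun n => hxm.indicator (hSm n)
  have hint : ∀ n, interp (convexified X θ) (kotheDual (convexified X θ)) (1 / 2)
      (ofMeas μ _ (hym n)) ≤ (E * (E * K + C₁) : ℝ≥0) := by
    intro n
    have hvm : Measurable ((S n).indicator f) := hfm'.indicator (hSm n)
    have hgm : Measurable fun a => (S n).indicator f a * Real.exp ((S n).indicator l a) :=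
      hvm.mul (Complex.measurable_ofReal.comp (hlm.indicator (hSm n)).exp)
    have cv := coeFn_ofMeas μ _ hvm
    have cg := coeFn_ofMeas μ _ hgm
    refine (interp_le_of_exp hZ hZ' (l := (S n).indicator l) (hlm.indicator (hSm n)) (m := n)
      (by positivity) (fun a => ?_) (v := ofMeas μ _ hvm) (g := ofMeas μ _ hgm) ?_ ?_
      (K := E * K + C₁) ?_ ?_).trans_eq ?_
    · by_cases ha : a ∈ S n
      · rw [Set.indicator_of_mem ha]
        exact ha.2
      · rw [Set.indicator_of_notMem ha, abs_zero]
        positivity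
    · filter_upwards [cv, cg] with a e1 e2
      rw [e1, e2]
    · filter_upwards [cv, coeFn_ofMeas μ _ (hym n), hf] with a e1 e2 e3
      rw [e1, e2]
      by_cases ha : a ∈ S n
      · rw [Set.indicator_of_mem ha, Set.indicator_of_mem ha, Set.indicator_of_mem ha, e3,
          mul_assoc, ← Complex.ofReal_mul, ← Real.exp_add, neg_add_cancel, Real.exp_zero,
          Complex.ofReal_one, mul_one]
      · rw [Set.indicator_of_notMem ha, Set.indicator_of_notMem ha, zero_mul]
    · refine (convexified_truncation_le hX h1 hK hA hfA (hSm n) (c := (n : ℝ) + 1)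
        (by positivity) (fun a ha => ha.1) cv).trans ?_
      rw [hEc]
      norm_cast
      exact le_self_add
    · refine (hC₁ B x _ hB (lintegral_sq_le_one hx) ?_).trans (by norm_cast; exact le_add_self)
      filter_upwards [cg, hf, hAB] with a e1 e2 e3
      rw [e1]
      by_cases ha : a ∈ S n
      · rw [Set.indicator_of_mem ha, Set.indicator_of_mem ha, e2, mul_assoc,
          ← Complex.ofReal_mul, ← Real.exp_add, norm_mul, Complex.norm_real,
          Real.norm_of_nonneg (Real.exp_pos _).le]
        rcases eq_or_ne (x a) 0 with hx0 | hx0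
        · rw [hx0, norm_zero, zero_mul]
          positivity
        · have px : 0 < ‖x a‖ := norm_pos_iff.2 hx0
          have pAB : 0 < ‖A a‖ * ‖B a‖ := (pow_pos px 2).trans_le e3
          have pB : 0 < ‖B a‖ := pos_of_mul_pos_right pAB (norm_nonneg _)
          rw [Real.rpow_def_of_pos pB, Real.rpow_def_of_pos (pow_pos px 2), Real.log_pow]
          nth_rw 1 [← Real.exp_log px]
          rw [← Real.exp_add, ← Real.exp_add, Real.exp_le_exp, hl]
          push_cast
          apply le_of_eq
          ring
      · rw [Set.indicator_of_notMem ha, zero_mul, norm_zero]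
        positivity
    · rw [hEc]
      norm_cast
  have hfin : ∫⁻ a, ‖x a‖ₑ ^ 2 ∂μ ≠ ∞ := ((lintegral_sq_le_one hx).trans_lt ENNReal.one_lt_top).ne
  -- Almost every point with `x ≠ 0` eventually lies in `S n`, as `f` is nonzero and `f`, `l` are
  -- finite there. Dominated convergence makes the discarded part of `x` small in `L₂`.
  have hT : Tendsto (fun n => ∫⁻ a, (S n)ᶜ.indicator (fun a => ‖x a‖ₑ ^ 2) a ∂μ) atTop
      (𝓝 (∫⁻ _, 0 ∂μ)) := by
    refine tendsto_lintegral_of_dominated_convergence (fun a => ‖x a‖ₑ ^ 2)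
      (fun n => (hxm.enorm.pow_const 2).indicator (hSm n).compl)
      (fun n => Eventually.of_forall fun a => Set.indicator_le_self _ _ a) hfin ?_
    filter_upwards [hf] with a e1
    rcases eq_or_ne (x a) 0 with hx0 | hx0
    · simp [Set.indicator_apply, hx0]
    · have pf : 0 < ‖f a‖ := by
        rw [e1, norm_pos_iff]
        exact mul_ne_zero hx0 (by simp)
      refine tendsto_const_nhds.congr' ?_
      have hn := tendsto_natCast_atTop_atTop (R := ℝ)
      filter_upwards [hn.eventually_ge_atTop |l a|, hn.eventually_ge_atTop ‖f a‖,
        hn.eventually_ge_atTop ‖f a‖⁻¹] with n n1 n2 n3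
      rw [Set.indicator_of_notMem]
      rw [Set.mem_compl_iff, not_not]
      refine ⟨⟨?_, by linarith⟩, n1⟩
      rw [inv_le_comm₀ (by positivity) pf]
      linarith
  rw [lintegral_zero] at hT
  obtain ⟨n, hn⟩ := (hT.eventually (gt_mem_nhds (show (0 : ℝ≥0∞) < 2⁻¹ ^ 2 from
    ENNReal.pow_pos (ENNReal.inv_pos.2 ENNReal.ofNat_ne_top) 2))).exists
  refine ⟨_, hint n, L2_le_of_lintegral_le (le_trans (le_of_eq ?_) hn.le)⟩
  refine lintegral_congr_ae ?_
  filter_upwards [AEEqFun.coeFn_sub x (ofMeas μ _ (hym n)), coeFn_ofMeas μ _ (hym n)] with a e1 e2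
  rw [e1, Pi.sub_apply, e2]
  by_cases ha : a ∈ S n <;> simp [ha]

/-- `[X_θ, X_θ^*]_{1/2} = L₂`. -/
theorem sameSpace_convexified (hX : IsKothe X) (hX' : IsKothe (kotheDual X))
    (hX2 : SameSpace (interp X (kotheDual X) (1 / 2)) (L2 μ)) (h0 : 0 < θ) (h1 : θ < 1)
    (hZ' : IsKothe (kotheDual (convexified X θ))) :
    SameSpace (interp (convexified X θ) (kotheDual (convexified X θ)) (1 / 2)) (L2 μ) := by
  have hZ : IsKothe (convexified X θ) := interp_isKothe hX (Linfty_isKothe μ) h0 h1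
  have hM := interp_isKothe hZ hZ' zero_lt_half half_lt_one_real
  obtain ⟨C, hC⟩ := exists_approx_convexified hX hX' hX2 h0 h1 hZ'
  obtain ⟨C', hC'⟩ := exists_L2_le_interp hZ hZ'
  refine ⟨2 * C + C' + 1, fun x => ⟨?_, (hC' x).trans ?_⟩⟩
  · rcases eq_or_ne (L2 μ x) ∞ with hi | hi
    · rw [hi, ENNReal.mul_top (by simp)]
      exact le_top
    · refine (le_mul_of_le_on_ball (Φ := id) (L2_isKotheNorm μ) hM.norm (fun c x _ => rfl)
        (fun x hx => le_of_approx hM (L2_isKotheNorm μ) hC' hC hx) hi.lt_top).trans ?_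
      gcongr
      norm_cast
      rw [add_assoc]
      exact le_self_add
  · gcongr
    rw [add_right_comm]
    exact le_add_self

end Factorization

end Butterfly

namespace Butterfly

/-! ### Homogeneity, perturbation and existence of differentials -/

section Differentials

variable {α : Type*} [MeasurableSpace α] {μ : Measure α} {N₀ N₁ : ENormOn μ} {θ : ℝ}
  {F G : ℂ → L0 μ} {D D' : L0 μ}

theorem MemCalderon.hasDerivIn_unique (hs : IsKotheNorm (sumNorm N₀ N₁))
    (hF : MemCalderon N₀ N₁ F) {z : ℂ} (hz : z ∈ openStrip)
    (h : HasDerivIn (sumNorm N₀ N₁) F D z) (h' : HasDerivIn (sumNorm N₀ N₁) F D' z) : D = D' := by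
  obtain ⟨h1, h2⟩ := hF.hasDerivAt_lift hs hz h
  obtain ⟨h3, h4⟩ := hF.hasDerivAt_lift hs hz h'
  rw [← hs.val_lift h1, h2.unique h4, hs.val_lift h3]

/-- Because `φ` vanishes at `z`, the derivative of `G` drops out of the product rule. Thus the
derivative of `F` can be changed by a prescribed vector while its value at `z` is kept. -/
theorem MemCalderon.hasDerivIn_add_smul (hs : IsKotheNorm (sumNorm N₀ N₁))
    (hF : MemCalderon N₀ N₁ F) (hG : MemCalderon N₀ N₁ G) {z : ℂ} (hz : z ∈ openStrip)
    (h : HasDerivIn (sumNorm N₀ N₁) F D z) {φ : ℂ → ℂ} {φ' : ℂ} (hφ : HasDerivAt φ φ' z)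
    (hφz : φ z = 0) :
    HasDerivIn (sumNorm N₀ N₁) (fun w => F w + φ w • G w) (D + φ' • G z) z := by
  obtain ⟨h1, h2⟩ := hF.hasDerivAt_lift hs hz h
  obtain ⟨D', hD'⟩ := hG.analytic z hz
  have h3 := h2.add (hφ.smul (hG.hasDerivAt_lift hs hz hD').2)
  have h4 := HasDerivIn.of_lift hs (F := fun w => F w + φ w • G w) (fun w hw => ?_) hz h3
  · rw [map_add, map_add, map_smul, map_smul, hs.val_lift h1, hφz,
      hG.val_lift hs (openStrip_subset hz)] at h4
    rwa [show (0 : ℂ) • hs.val (hs.lift D') = 0 from zero_smul ℂ (hs.val (hs.lift D')),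
      zero_add] at h4
  · change F w + φ w • G w = hs.val (hs.lift (F w) + φ w • hs.lift (G w))
    rw [map_add, map_smul, hF.val_lift hs hw, hG.val_lift hs hw]

theorem HasDerivIn.const_smul (hs : IsKotheNorm (sumNorm N₀ N₁)) (hF : MemCalderon N₀ N₁ F)
    {z : ℂ} (hz : z ∈ openStrip) (h : HasDerivIn (sumNorm N₀ N₁) F D z) (c : ℂ)
    (hG : ∀ w ∈ closedStrip, G w = c • F w) : HasDerivIn (sumNorm N₀ N₁) G (c • D) z := by
  obtain ⟨h1, h2⟩ := hF.hasDerivAt_lift hs hz h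
  have h4 := HasDerivIn.of_lift hs (F := G) (fun w hw => ?_) hz (h2.const_smul c)
  · rwa [map_smul, hs.val_lift h1] at h4
  · rw [hG w hw]
    change c • F w = hs.val (c • hs.lift (F w))
    rw [map_smul, hF.val_lift hs hw]

/-- The homogeneity required of the selection passes to `Ω` by uniqueness of the derivative. -/
theorem IsDifferential.smul (h₀ : IsKothe N₀) (h₁ : IsKothe N₁) (h0 : 0 < θ) (h1 : θ < 1)
    {Ω : L0 μ → L0 μ} (hΩ : IsDifferential N₀ N₁ θ Ω) (c : ℂ) {x : L0 μ}
    (hx : interp N₀ N₁ θ x < ∞) : Ω (c • x) = c • Ω x := by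
  have hs := sumNorm_isKotheNorm h₀ h₁
  have hz := ofReal_mem_openStrip h0 h1
  obtain ⟨B, K, hB⟩ := hΩ
  obtain ⟨m, -, -, hc, hd⟩ := hB x hx
  have hcx : interp N₀ N₁ θ (c • x) < ∞ := by
    rw [(interp_isKotheNorm h₀ h₁ h0 h1).smul]
    exact ENNReal.mul_lt_top enorm_lt_top hx
  obtain ⟨m', -, -, -, hd'⟩ := hB (c • x) hcx
  exact m'.hasDerivIn_unique hs hz hd' (HasDerivIn.const_smul hs m hz hd c (hc c))

/-- Adding a bounded homogeneous map to a differential gives a differential. -/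
theorem IsDifferential.add_bounded (h₀ : IsKothe N₀) (h₁ : IsKothe N₁) (h0 : 0 < θ) (h1 : θ < 1)
    {Ω R : L0 μ → L0 μ} (hΩ : IsDifferential N₀ N₁ θ Ω) {C : ℝ≥0}
    (hR : ∀ x, interp N₀ N₁ θ x < ∞ → interp N₀ N₁ θ (R x) ≤ C * interp N₀ N₁ θ x)
    (hRc : ∀ (c : ℂ) x, interp N₀ N₁ θ x < ∞ → R (c • x) = c • R x) :
    IsDifferential N₀ N₁ θ fun x => Ω x + R x := by
  have hs := sumNorm_isKotheNorm h₀ h₁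
  have hz := ofReal_mem_openStrip h0 h1
  obtain ⟨B, K, hB⟩ := hΩ
  -- This function vanishes at `θ` with derivative `1`. For `Re z ≥ 0` one has `|z - θ| ≤ |z + 1|`,
  -- so it is bounded by `θ + 1` on the strip, and adding `φ` times the selection at `R x` changes
  -- the derivative by exactly `R x`.
  set φ : ℂ → ℂ := fun z => (θ + 1) * ((z - θ) / (z + 1)) with hφ
  have hne : ∀ z ∈ closedStrip, z + 1 ≠ 0 := fun z hz e => by
    have := congrArg Complex.re e
    simp at this
    linarith [hz.1]
  have hφd : ∀ z ∈ closedStrip, HasDerivAt φ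
      ((θ + 1) * ((1 * (z + 1) - (z - θ) * 1) / (z + 1) ^ 2)) z := fun z hz =>
    ((((hasDerivAt_id z).sub_const (θ : ℂ)).div ((hasDerivAt_id z).add_const 1)
      (hne z hz))).const_mul _
  have hφb : ∀ z ∈ closedStrip, ‖φ z‖ ≤ θ + 1 := by
    intro z hz
    rw [hφ, norm_mul, norm_div]
    have e : ‖(θ + 1 : ℂ)‖ = θ + 1 := by
      rw [← Complex.ofReal_one, ← Complex.ofReal_add, Complex.norm_real,
        Real.norm_of_nonneg (by linarith)]
    rw [e]
    refine mul_le_of_le_one_right (by linarith) ?_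
    rw [div_le_one (norm_pos_iff.2 (hne z hz)), ← sq_le_sq₀ (norm_nonneg _) (norm_nonneg _),
      Complex.sq_norm, Complex.sq_norm, Complex.normSq_apply, Complex.normSq_apply]
    simp
    nlinarith [hz.1]
  have hφ1 : (θ + 1 : ℂ) * ((1 * ((θ : ℂ) + 1) - (θ - θ) * 1) / ((θ : ℂ) + 1) ^ 2) = 1 := by
    have := hne _ (openStrip_subset hz)
    field_simp
    ring
  have hφ0 : φ θ = 0 := by simp [hφ]
  set T : ℝ≥0 := ⟨θ + 1, by linarith⟩ with hT
  refine ⟨fun x z => B x z + φ z • B (R x) z, K + T * (K * C), fun x hx => ?_⟩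
  obtain ⟨m, e, b, hc, hd⟩ := hB x hx
  have hRx : interp N₀ N₁ θ (R x) < ∞ :=
    (hR x hx).trans_lt (ENNReal.mul_lt_top ENNReal.coe_lt_top hx)
  obtain ⟨m', e', b', hc', hd'⟩ := hB (R x) hRx
  refine ⟨m.add h₀ h₁ (m'.smul h₀ h₁ (fun z hz => (hφd z hz).continuousAt.continuousWithinAt)
    (fun z hz => (hφd z (openStrip_subset hz)).differentiableAt.differentiableWithinAt) hφb),
    ?_, ?_, ?_, ?_⟩
  · change B x θ + φ θ • B (R x) θ = x
    rw [e, hφ0, show (0 : ℂ) • B (R x) θ = 0 from zero_smul ℂ (B (R x) θ), add_zero]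
  · calc _ ≤ calderonNorm N₀ N₁ (B x) + calderonNorm N₀ N₁ (fun z => φ z • B (R x) z) :=
          calderonNorm_add_le h₀.norm h₁.norm _ _
      _ ≤ K * interp N₀ N₁ θ x + T * (K * (C * interp N₀ N₁ θ x)) := by
          gcongr
          refine (calderonNorm_smul_le h₀.norm h₁.norm (c := T) fun z hz => ?_).trans ?_
          · exact enorm_le_coe.2 (hφb z hz)
          · gcongr
            exact b'.trans (by gcongr; exact hR x hx)
      _ = _ := by
          push_cast
          ring
  · intro c z hz
    change B (c • x) z + φ z • B (R (c • x)) z = c • (B x z + φ z • B (R x) z)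
    rw [hc c z hz, hRc c x hx, hc' c z hz, smul_comm]
    exact (smul_add c (B x z) (φ z • B (R x) z)).symm
  · have h5 := m.hasDerivIn_add_smul hs m' hz hd (hφd _ (openStrip_subset hz)) hφ0
    rwa [hφ1, e', show (1 : ℂ) • R x = R x from one_smul ℂ (R x)] at h5

/-- Existence of differentials. -/
theorem exists_isDifferential (h₀ : IsKothe N₀) (h₁ : IsKothe N₁) (h0 : 0 < θ) (h1 : θ < 1) :
    ∃ Ω, IsDifferential N₀ N₁ θ Ω := by
  classical
  have hs := sumNorm_isKotheNorm h₀ h₁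
  have hz := ofReal_mem_openStrip h0 h1
  have hI := interp_isKotheNorm h₀ h₁ h0 h1
  have sel : ∀ x : L0 μ, ∃ F, x ≠ 0 → interp N₀ N₁ θ x < ∞ → MemCalderon N₀ N₁ F ∧ F θ = x ∧
      calderonNorm N₀ N₁ F ≤ 2 * interp N₀ N₁ θ x := by
    intro x
    by_cases hx : x ≠ 0 ∧ interp N₀ N₁ θ x < ∞
    · have hx0 : interp N₀ N₁ θ x ≠ 0 := fun h => hx.1 ((hI.eq_zero_iff x).1 h)
      have hlt : interp N₀ N₁ θ x < 2 * interp N₀ N₁ θ x := by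
        rw [two_mul]
        exact ENNReal.lt_add_right hx.2.ne hx0
      obtain ⟨F, hF, hFx, hlt⟩ := exists_of_interp_lt hlt
      exact ⟨F, fun _ _ => ⟨hF, hFx, hlt.le⟩⟩
    · exact ⟨0, fun g1 g2 => (hx ⟨g1, g2⟩).elim⟩
  choose B₀ hB₀ using sel
  -- Homogeneity is obtained by selecting only at one representative of each complex line and
  -- extending by scaling; `a` is the scalar that moves `x` to the representative of its line.
  have rep : ∀ x : L0 μ, ∃ a : ℂ, ∀ hx : x ≠ 0,
      a ≠ 0 ∧ a • x = (Projectivization.mk ℂ x hx).rep := by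
    intro x
    by_cases hx : x ≠ 0
    · obtain ⟨a, ha⟩ := Projectivization.exists_smul_eq_mk_rep ℂ x hx
      exact ⟨a, fun _ => ⟨a.ne_zero, ha⟩⟩
    · exact ⟨0, fun h => (hx h).elim⟩
  choose r hr using rep
  set B : L0 μ → ℂ → L0 μ := fun x z => if x = 0 then 0 else (r x)⁻¹ • B₀ (r x • x) z with hB
  have key : ∀ x, interp N₀ N₁ θ x < ∞ → MemCalderon N₀ N₁ (B x) ∧ B x θ = x ∧
      calderonNorm N₀ N₁ (B x) ≤ 2 * interp N₀ N₁ θ x := by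
    intro x hx
    by_cases hx0 : x = 0
    · have e : B x = fun _ => 0 := by
        funext z
        simp [hB, hx0]
      rw [e]
      refine ⟨MemCalderon.zero h₀ h₁, hx0.symm, calderonNorm_le (fun t => ?_) fun t => ?_⟩
      · rw [h₀.norm.zero]; exact zero_le
      · rw [h₁.norm.zero]; exact zero_le
    · have e : B x = fun z => (r x)⁻¹ • B₀ (r x • x) z := by
        funext z
        simp [hB, hx0]
      obtain ⟨hr0, -⟩ := hr x hx0
      have hne : r x • x ≠ 0 := smul_ne_zero hr0 hx0
      have hlt : interp N₀ N₁ θ (r x • x) < ∞ := by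
        rw [hI.smul]
        exact ENNReal.mul_lt_top enorm_lt_top hx
      obtain ⟨m, ev, b⟩ := hB₀ _ hne hlt
      rw [e]
      refine ⟨m.const_smul h₀ h₁ _, ?_, ?_⟩
      · change (r x)⁻¹ • B₀ (r x • x) θ = x
        rw [ev, smul_smul, inv_mul_cancel₀ hr0]
        exact one_smul ℂ x
      · refine (calderonNorm_smul_le h₀.norm h₁.norm (φ := fun _ => (r x)⁻¹)
          fun z _ => le_rfl).trans ?_
        refine (mul_le_mul_right b _).trans_eq ?_
        rw [hI.smul, enorm_inv hr0, mul_left_comm, ← mul_assoc ‖r x‖ₑ⁻¹,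
          ENNReal.inv_mul_cancel (by simpa using hr0) enorm_ne_top, one_mul]
  have hom : ∀ (c : ℂ) x z, B (c • x) z = c • B x z := by
    intro c x z
    by_cases hx0 : x = 0
    · subst hx0
      have e : c • (0 : L0 μ) = 0 := smul_zero (A := L0 μ) c
      simp [hB, e]
    by_cases hc : c = 0
    · subst hc
      rw [show (0 : ℂ) • x = 0 from zero_smul ℂ x,
        show (0 : ℂ) • B x z = 0 from zero_smul ℂ (B x z)]
      simp [hB]
    have hcx : c • x ≠ 0 := smul_ne_zero hc hx0
    obtain ⟨hr0, hrx⟩ := hr x hx0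
    obtain ⟨hr0', hrx'⟩ := hr _ hcx
    have emk : Projectivization.mk ℂ (c • x) hcx = Projectivization.mk ℂ x hx0 :=
      (Projectivization.mk_eq_mk_iff' ℂ _ _ hcx hx0).2 ⟨c, rfl⟩
    have e1 : r (c • x) • (c • x) = r x • x := by rw [hrx, hrx', emk]
    have e2 : r (c • x) * c = r x := by
      rw [smul_smul] at e1
      exact smul_left_injective ℂ hx0 e1
    simp only [hB, hcx, hx0, if_false]
    rw [e1, smul_smul, ← e2, mul_inv, mul_left_comm, mul_inv_cancel₀ hc, mul_one]
  have der : ∀ x, ∃ D, interp N₀ N₁ θ x < ∞ → HasDerivIn (sumNorm N₀ N₁) (B x) D θ := by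
    intro x
    by_cases hx : interp N₀ N₁ θ x < ∞
    · obtain ⟨D, hD⟩ := (key x hx).1.analytic _ hz
      exact ⟨D, fun _ => hD⟩
    · exact ⟨0, fun h => (hx h).elim⟩
  choose Ω hΩ using der
  exact ⟨Ω, B, 2, fun x hx => ⟨(key x hx).1, (key x hx).2.1, (key x hx).2.2,
    fun c z _ => hom c x z, hΩ x hx⟩⟩

end Differentials

end Butterfly

namespace Butterfly

/-! ### Comparison of the differentials of `X_θ` and `X` -/

section Comparison

variable {α : Type*} [MeasurableSpace α] {μ : Measure α} {X Y : ENormOn μ} {θ : ℝ}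

/-- The logarithmic term `2 θ x log |x|`. -/
noncomputable def logTerm (θ : ℝ) (x : L0 μ) : L0 μ :=
  ofMeas μ (fun a => x a * ((2 * θ * Real.log ‖x a‖ : ℝ) : ℂ)) (by
    have := x.measurable
    fun_prop)

theorem coeFn_logTerm (θ : ℝ) (x : L0 μ) :
    ∀ᵐ a ∂μ, logTerm θ x a = x a * ((2 * θ * Real.log ‖x a‖ : ℝ) : ℂ) := coeFn_ofMeas _ _ _

/-- Both `D` and `E` are compared with logarithms: `D` with that of `(2B) / (2A)`, and `E` with that
of `Q / P`, where `P = (2A)^{1-θ}` and `Q = (2B)^{1-θ} |x|^{2θ}`. The relation `log (Q / P) = (1 -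
θ) log (B / A) + 2 θ log |x|` makes the logarithms cancel. -/
theorem norm_sub_sq_le (h0 : 0 < θ) (h1 : θ < 1) {x D E : ℂ} {A B A' B' : ℝ}
    (hA : 0 ≤ A) (hB : 0 ≤ B) (hA' : 0 ≤ A') (hB' : 0 ≤ B')
    (hx : ∀ s : ℝ, ‖x‖ ≤ Real.exp (s * (1 - (1 / 2 : ℝ))) * B +
      Real.exp (s * (0 - (1 / 2 : ℝ))) * A)
    (h : ∀ s : ℝ, ‖D + s * x‖ ≤
      Real.exp (s * (1 - (1 / 2 : ℝ))) * B + Real.exp (s * (0 - (1 / 2 : ℝ))) * A)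
    (h' : ∀ s : ℝ, ‖E + s * x‖ ≤
      Real.exp (s * (1 - (1 / 2 : ℝ))) * B' + Real.exp (s * (0 - (1 / 2 : ℝ))) * A') :
    ‖E - ((1 - θ : ℝ) : ℂ) * D - x * ((2 * θ * Real.log ‖x‖ : ℝ) : ℂ)‖ ^ 2 ≤
      288 * ((A' + (2 * A) ^ (1 - θ)) * (B' + (2 * B) ^ (1 - θ) * (‖x‖ ^ 2) ^ θ) + A * B) := by
  have hx2 : ‖x‖ ^ 2 ≤ (2 * A) * (2 * B) :=
    (sq_le_of_forall_exp (norm_nonneg _) hA hB hx).trans_eq (by ring)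
  set P := (2 * A) ^ (1 - θ) with hP
  set Q := (2 * B) ^ (1 - θ) * (‖x‖ ^ 2) ^ θ with hQ
  have hP0 : 0 ≤ P := by positivity
  have hQ0 : 0 ≤ Q := by positivity
  have hPQ : ‖x‖ ^ 2 ≤ P * Q := by
    calc ‖x‖ ^ 2 = (‖x‖ ^ 2) ^ (1 - θ) * (‖x‖ ^ 2) ^ θ := by
          rw [← Real.rpow_add_of_nonneg (by positivity) (by linarith) h0.le, sub_add_cancel,
            Real.rpow_one]
      _ ≤ ((2 * A) * (2 * B)) ^ (1 - θ) * (‖x‖ ^ 2) ^ θ := by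
          gcongr
      _ = P * Q := by
          rw [Real.mul_rpow (by positivity) (by positivity)]
          ring
  have k1 := norm_sub_log_sq_le hA hB (by positivity) (by positivity) hx2 h
  have k2 := norm_sub_log_sq_le hA' hB' hP0 hQ0 hPQ h'
  have e : E - ((1 - θ : ℝ) : ℂ) * D - x * ((2 * θ * Real.log ‖x‖ : ℝ) : ℂ) =
      (E - x * Real.log (Q / P)) -
        ((1 - θ : ℝ) : ℂ) * (D - x * Real.log ((2 * B) / (2 * A))) := by
    rcases eq_or_ne x 0 with hx0 | hx0
    · simp [hx0]
    · have px : 0 < ‖x‖ ^ 2 := pow_pos (norm_pos_iff.2 hx0) 2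
      have pA : 0 < 2 * A := pos_of_mul_pos_left (px.trans_le hx2) (by positivity)
      have pB : 0 < 2 * B := pos_of_mul_pos_right (px.trans_le hx2) (by positivity)
      have e1 : Real.log (Q / P) = (1 - θ) * Real.log ((2 * B) / (2 * A)) +
          2 * θ * Real.log ‖x‖ := by
        rw [hP, hQ, Real.log_div (by positivity) (by positivity),
          Real.log_mul (by positivity) (by positivity), Real.log_rpow pA, Real.log_rpow pB,
          Real.log_rpow px, Real.log_div pB.ne' pA.ne', Real.log_pow]
        push_cast
        ring
      rw [e1]
      push_cast
      ring
  have k3 : ‖((1 - θ : ℝ) : ℂ) * (D - x * Real.log ((2 * B) / (2 * A)))‖ ≤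
      ‖D - x * Real.log ((2 * B) / (2 * A))‖ := by
    rw [norm_mul, Complex.norm_real, Real.norm_of_nonneg (by linarith)]
    exact mul_le_of_le_one_left (norm_nonneg _) (by linarith)
  rw [e]
  set u := ‖E - x * Real.log (Q / P)‖
  set v := ‖D - x * Real.log ((2 * B) / (2 * A))‖
  have k4 : ‖(E - x * Real.log (Q / P)) -
      ((1 - θ : ℝ) : ℂ) * (D - x * Real.log ((2 * B) / (2 * A)))‖ ≤ u + v :=
    (norm_sub_le _ _).trans (add_le_add le_rfl k3)
  have k5 : 0 ≤ (A' + P) * (B' + Q) := by positivity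
  -- Here `u² ≤ 16 (A' + P) (B' + Q)` and `v² ≤ 16 · 3A · 3B = 144 A B`. After doubling, the larger
  -- of `32` and `288` serves for both.
  calc _ ≤ (u + v) ^ 2 := pow_le_pow_left₀ (norm_nonneg _) k4 2
    _ ≤ 2 * u ^ 2 + 2 * v ^ 2 := by nlinarith [sq_nonneg (u - v)]
    _ ≤ _ := by linarith

/-- Integration of the pointwise estimate leaves five products, each bounded by a Hölder inequality.
Those containing `P` use `lintegral_mul_le_convexified`, since `P` is not known to lie in `X_θ`. The
constant depends on `F` and `G` only through `K`. -/
theorem exists_L2_sub_le (hX : IsKothe X) (hX' : IsKothe (kotheDual X)) (h0 : 0 < θ)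
    (h1 : θ < 1) (hZ' : IsKothe (kotheDual (convexified X θ))) (K : ℝ≥0) :
    ∃ C : ℝ≥0, ∀ (x : L0 μ) (F G : ℂ → L0 μ) (D E : L0 μ), L2 μ x ≤ 1 →
      MemCalderon X (kotheDual X) F → F ((1 / 2 : ℝ) : ℂ) = x →
      calderonNorm X (kotheDual X) F ≤ K →
      HasDerivIn (sumNorm X (kotheDual X)) F D ((1 / 2 : ℝ) : ℂ) →
      MemCalderon (convexified X θ) (kotheDual (convexified X θ)) G → G ((1 / 2 : ℝ) : ℂ) = x →
      calderonNorm (convexified X θ) (kotheDual (convexified X θ)) G ≤ K →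
      HasDerivIn (sumNorm (convexified X θ) (kotheDual (convexified X θ))) G E
        ((1 / 2 : ℝ) : ℂ) →
      L2 μ (E - ((1 - θ : ℝ) : ℂ) • D - logTerm θ x) ≤ C := by
  have hZ : IsKothe (convexified X θ) := interp_isKothe hX (Linfty_isKothe μ) h0 h1
  obtain ⟨C₁, hC₁⟩ := exists_pointwise_bound hX hX' zero_lt_half half_lt_one_real
  obtain ⟨C₂, hC₂⟩ := exists_pointwise_bound hZ hZ' zero_lt_half half_lt_one_real
  set K₁ : ℝ≥0 := 2 * (C₁ * K) + 1 with hK₁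
  obtain ⟨C₃, hC₃⟩ := exists_kotheDual_convexified_le (μ := μ) hX h0 h1 K₁
  set e : ℝ≥0 := ⟨Real.exp 1, (Real.exp_pos 1).le⟩ with he
  have hec : ENNReal.ofReal (Real.exp 1) = e := ENNReal.ofReal_eq_coe_nnreal (Real.exp_pos 1).le
  set T : ℝ≥0 := 288 * ((C₂ * K) * (C₂ * K) + (C₂ * K) * C₃ + (e * K₁) * (C₂ * K) +
    (e * K₁) * C₃ + (C₁ * K) * (C₁ * K)) with hT
  refine ⟨T + 1, fun x F G D E hx hF hFx hFK hD hG hGx hGK hE => L2_le_of_lintegral_le ?_⟩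
  obtain ⟨A, B, hA, hB, hAB⟩ := hC₁ F K D hF hFK hD
  obtain ⟨A', B', hA', hB', hAB'⟩ := hC₂ G K E hG hGK hE
  have two : ‖(2 : ℂ)‖ₑ = ((2 : ℝ≥0) : ℝ≥0∞) := by rw [enorm_eq_nnnorm]; simp
  have hA2 : X ((2 : ℂ) • A) ≤ K₁ := by
    rw [hX.norm.smul, two]
    refine (mul_le_mul_right hA _).trans ?_
    norm_cast
    exact le_self_add
  have hB2 : kotheDual X ((2 : ℂ) • B) ≤ K₁ := by
    rw [hX'.norm.smul, two]
    refine (mul_le_mul_right hB _).trans ?_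
    norm_cast
    exact le_self_add
  have hAm := A.measurable
  have hBm := B.measurable
  have hxm := x.measurable
  have hPm : Measurable fun a => (((2 * ‖A a‖) ^ (1 - θ) : ℝ) : ℂ) := by fun_prop
  have hQm : Measurable fun a => (((2 * ‖B a‖) ^ (1 - θ) * (‖x a‖ ^ 2) ^ θ : ℝ) : ℂ) := by
    fun_prop
  set P := ofMeas μ _ hPm with hPdef
  set Q := ofMeas μ _ hQm with hQdef
  have hP : ∀ᵐ a ∂μ, ‖P a‖ = (2 * ‖A a‖) ^ (1 - θ) := by
    filter_upwards [coeFn_ofMeas μ _ hPm] with a ha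
    rw [ha, Complex.norm_real, Real.norm_of_nonneg (by positivity)]
  have hQ : ∀ᵐ a ∂μ, ‖Q a‖ = (2 * ‖B a‖) ^ (1 - θ) * (‖x a‖ ^ 2) ^ θ := by
    filter_upwards [coeFn_ofMeas μ _ hQm] with a ha
    rw [ha, Complex.norm_real, Real.norm_of_nonneg (by positivity)]
  have hQK : kotheDual (convexified X θ) Q ≤ C₃ := by
    refine hC₃ _ x Q hB2 (lintegral_sq_le_one hx) ?_
    filter_upwards [hQ, AEEqFun.coeFn_smul (2 : ℂ) B] with a h2 h3
    rw [h2, h3, Pi.smul_apply, norm_smul, Complex.norm_ofNat]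
  have hPK : ∀ g, ∫⁻ a, ‖P a * g a‖ₑ ∂μ ≤ (e * K₁ : ℝ≥0) * kotheDual (convexified X θ) g := by
    intro g
    have := lintegral_mul_le_convexified hX h0 h1 (le_add_self : 1 ≤ K₁) hA2 (f := P) (by
      filter_upwards [hP, AEEqFun.coeFn_smul (2 : ℂ) A] with a h2 h3
      rw [h2, h3, Pi.smul_apply, norm_smul, Complex.norm_ofNat]) g
    rw [hec] at this
    exact_mod_cast this
  have hpt : ∀ᵐ a ∂μ, ‖(E - ((1 - θ : ℝ) : ℂ) • D - logTerm θ x) a‖ₑ ^ 2 ≤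
      (288 : ℝ≥0) * (‖A' a * B' a‖ₑ + ‖A' a * Q a‖ₑ + ‖P a * B' a‖ₑ + ‖P a * Q a‖ₑ +
        ‖A a * B a‖ₑ) := by
    filter_upwards [hAB, hAB', hP, hQ, AEEqFun.coeFn_sub (E - ((1 - θ : ℝ) : ℂ) • D) (logTerm θ x),
      AEEqFun.coeFn_sub E (((1 - θ : ℝ) : ℂ) • D), AEEqFun.coeFn_smul ((1 - θ : ℝ) : ℂ) D,
      coeFn_logTerm θ x] with a g1 g2 g3 g4 g5 g6 g7 g8
    rw [hFx] at g1
    rw [hGx] at g2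
    have key := norm_sub_sq_le h0 h1 (norm_nonneg (A a)) (norm_nonneg (B a)) (norm_nonneg (A' a))
      (norm_nonneg (B' a)) (fun s => (g1 s).1) (fun s => (g1 s).2) fun s => (g2 s).2
    rw [← g3, ← g4] at key
    rw [g5, Pi.sub_apply, g6, Pi.sub_apply, g7, Pi.smul_apply, g8, smul_eq_mul]
    set w := E a - ((1 - θ : ℝ) : ℂ) * D a - x a * ((2 * θ * Real.log ‖x a‖ : ℝ) : ℂ)
    have h5 : ‖w‖₊ ^ 2 ≤ 288 * (‖A' a * B' a‖₊ + ‖A' a * Q a‖₊ + ‖P a * B' a‖₊ + ‖P a * Q a‖₊ +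
        ‖A a * B a‖₊) := by
      rw [← NNReal.coe_le_coe]
      push_cast
      simp only [norm_mul]
      refine key.trans_eq ?_
      ring
    simp only [enorm_eq_nnnorm]
    exact_mod_cast h5
  have hm : ∀ f g : L0 μ, Measurable fun a => ‖f a * g a‖ₑ := fun f g =>
    (f.measurable.mul g.measurable).enorm
  have lt : ∀ {N : ENormOn μ} {f : L0 μ} {c : ℝ≥0∞}, N f ≤ c → c ≠ ∞ → N f < ∞ := fun h h' =>
    h.trans_lt h'.lt_top
  have hA't := lt hA' (by finiteness)
  calc ∫⁻ a, ‖(E - ((1 - θ : ℝ) : ℂ) • D - logTerm θ x) a‖ₑ ^ 2 ∂μ ≤ _ := lintegral_mono_ae hpt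
    _ = (288 : ℝ≥0) * (∫⁻ a, ‖A' a * B' a‖ₑ ∂μ + ∫⁻ a, ‖A' a * Q a‖ₑ ∂μ +
        ∫⁻ a, ‖P a * B' a‖ₑ ∂μ + ∫⁻ a, ‖P a * Q a‖ₑ ∂μ + ∫⁻ a, ‖A a * B a‖ₑ ∂μ) := by
        rw [lintegral_const_mul' _ _ ENNReal.coe_ne_top, lintegral_add_right _ (hm _ _),
          lintegral_add_right _ (hm _ _), lintegral_add_right _ (hm _ _),
          lintegral_add_right _ (hm _ _)]
    _ ≤ (288 : ℝ≥0) * ((C₂ * K) * (C₂ * K) + (C₂ * K) * C₃ + (e * K₁ : ℝ≥0) * (C₂ * K) +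
        (e * K₁ : ℝ≥0) * C₃ + (C₁ * K) * (C₁ * K)) := by
        gcongr
        · exact (hZ.norm.lintegral_mul_le hA't B').trans (mul_le_mul' hA' hB')
        · exact (hZ.norm.lintegral_mul_le hA't Q).trans (mul_le_mul' hA' hQK)
        · exact (hPK B').trans (mul_le_mul_right hB' _)
        · exact (hPK Q).trans (mul_le_mul_right hQK _)
        · exact (hX.norm.lintegral_mul_le (lt hA (by finiteness)) B).trans (mul_le_mul' hA hB)
    _ = (T : ℝ≥0∞) := by
        rw [hT]
        push_cast
        rfl
    _ ≤ ((T + 1 : ℝ≥0) : ℝ≥0∞) ^ 2 := by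
        norm_cast
        nlinarith [zero_le (a := T)]

/-- Comparison of the differentials of `(X_θ, X_θ^*)` and `(X, X^*)`. -/
theorem IsOmega.isBoundedOn_sub (hX : IsKothe X) (hX' : IsKothe (kotheDual X))
    (hX2 : SameSpace (interp X (kotheDual X) (1 / 2)) (L2 μ)) (h0 : 0 < θ) (h1 : θ < 1)
    (hZ' : IsKothe (kotheDual (convexified X θ))) {Ω Ω' : L0 μ → L0 μ} (hΩ : IsOmega X Ω)
    (hΩ' : IsOmega (convexified X θ) Ω') :
    IsBoundedOn (L2 μ) fun x => Ω' x - ((1 - θ : ℝ) : ℂ) • Ω x - logTerm θ x := by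
  obtain ⟨C₁, hC₁⟩ := hX2
  obtain ⟨C₂, hC₂⟩ := sameSpace_convexified hX hX' ⟨C₁, hC₁⟩ h0 h1 hZ'
  obtain ⟨B, K, hB⟩ := hΩ
  obtain ⟨B', K', hB'⟩ := hΩ'
  obtain ⟨C, hC⟩ := exists_L2_sub_le hX hX' h0 h1 hZ' (K * C₁ + K' * C₂)
  refine ⟨C, fun x hx => ?_⟩
  have i1 : interp X (kotheDual X) (1 / 2) x ≤ C₁ :=
    (hC₁ x).1.trans (mul_le_of_le_one_right' hx)
  have i2 : interp (convexified X θ) (kotheDual (convexified X θ)) (1 / 2) x ≤ C₂ :=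
    (hC₂ x).1.trans (mul_le_of_le_one_right' hx)
  obtain ⟨m, e, b, -, d⟩ := hB x (i1.trans_lt ENNReal.coe_lt_top)
  obtain ⟨m', e', b', -, d'⟩ := hB' x (i2.trans_lt ENNReal.coe_lt_top)
  refine hC x _ _ _ _ hx m e (b.trans ?_) d m' e' (b'.trans ?_) d'
  · refine (mul_le_mul_right i1 _).trans ?_
    norm_cast
    exact le_self_add
  · refine (mul_le_mul_right i2 _).trans ?_
    norm_cast
    exact le_add_self

theorem isKothe_kotheDual (hX : IsKothe X)
    (hX2 : SameSpace (interp X (kotheDual X) (1 / 2)) (L2 μ)) : IsKothe (kotheDual X) :=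
  kotheDual_isKothe fun _ => eq_zero_of_kotheDual_eq_zero hX hX2

theorem isKothe_kotheDual_convexified (hX : IsKothe X)
    (hX2 : SameSpace (interp X (kotheDual X) (1 / 2)) (L2 μ)) (h0 : 0 < θ) (h1 : θ < 1) :
    IsKothe (kotheDual (convexified X θ)) :=
  kotheDual_isKothe fun _ => eq_zero_of_kotheDual_convexified_eq_zero hX
    (fun _ => eq_zero_of_kotheDual_eq_zero hX hX2) h0 h1

/-- The correction `logTerm θ x` is the same for `X` and `Y`, so it disappears on subtracting the
two comparisons. -/
theorem boundedlyEquivalent_convexified (hX : IsKothe X) (hY : IsKothe Y)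
    (hX2 : SameSpace (interp X (kotheDual X) (1 / 2)) (L2 μ))
    (hY2 : SameSpace (interp Y (kotheDual Y) (1 / 2)) (L2 μ)) (h0 : 0 < θ) (h1 : θ < 1)
    {ΩX ΩY ΩXθ ΩYθ : L0 μ → L0 μ} (hΩX : IsOmega X ΩX) (hΩY : IsOmega Y ΩY)
    (hΩXθ : IsOmega (convexified X θ) ΩXθ) (hΩYθ : IsOmega (convexified Y θ) ΩYθ) :
    AreBoundedlyEquivalentOn (L2 μ) (fun x => ΩXθ x - ΩYθ x)
      (fun x => ((1 - θ : ℝ) : ℂ) • (ΩX x - ΩY x)) := by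
  obtain ⟨C, hC⟩ := hΩX.isBoundedOn_sub hX (isKothe_kotheDual hX hX2) hX2 h0 h1
    (isKothe_kotheDual_convexified hX hX2 h0 h1) hΩXθ
  obtain ⟨C', hC'⟩ := hΩY.isBoundedOn_sub hY (isKothe_kotheDual hY hY2) hY2 h0 h1
    (isKothe_kotheDual_convexified hY hY2 h0 h1) hΩYθ
  refine ⟨C + C', fun x hx => ?_⟩
  have e : ΩXθ x - ΩYθ x - ((1 - θ : ℝ) : ℂ) • (ΩX x - ΩY x) =
      (ΩXθ x - ((1 - θ : ℝ) : ℂ) • ΩX x - logTerm θ x) -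
        (ΩYθ x - ((1 - θ : ℝ) : ℂ) • ΩY x - logTerm θ x) := by
    rw [show ((1 - θ : ℝ) : ℂ) • (ΩX x - ΩY x) =
      ((1 - θ : ℝ) : ℂ) • ΩX x - ((1 - θ : ℝ) : ℂ) • ΩY x from
        smul_sub ((1 - θ : ℝ) : ℂ) (ΩX x) (ΩY x)]
    abel
  change L2 μ (ΩXθ x - ΩYθ x - ((1 - θ : ℝ) : ℂ) • (ΩX x - ΩY x)) ≤ _
  rw [e, ENNReal.coe_add]
  exact ((L2_isKotheNorm μ).sub_le _ _).trans (add_le_add (hC x hx) (hC' x hx))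

/-- Exact equality of the two sides for suitable differentials. -/
theorem exists_isOmega_convexified_sub_eq (hX : IsKothe X) (hY : IsKothe Y)
    (hX2 : SameSpace (interp X (kotheDual X) (1 / 2)) (L2 μ))
    (hY2 : SameSpace (interp Y (kotheDual Y) (1 / 2)) (L2 μ)) (h0 : 0 < θ) (h1 : θ < 1)
    {ΩX ΩY : L0 μ → L0 μ} (hΩX : IsOmega X ΩX) (hΩY : IsOmega Y ΩY) :
    ∃ ΩXθ ΩYθ : L0 μ → L0 μ, IsOmega (convexified X θ) ΩXθ ∧ IsOmega (convexified Y θ) ΩYθ ∧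
      ∀ x, ΩXθ x - ΩYθ x = ((1 - θ : ℝ) : ℂ) • (ΩX x - ΩY x) := by
  have hX' := isKothe_kotheDual hX hX2
  have hY' := isKothe_kotheDual hY hY2
  have hZX : IsKothe (convexified X θ) := interp_isKothe hX (Linfty_isKothe μ) h0 h1
  have hZY : IsKothe (convexified Y θ) := interp_isKothe hY (Linfty_isKothe μ) h0 h1
  have hZX' := isKothe_kotheDual_convexified hX hX2 h0 h1
  have hZY' := isKothe_kotheDual_convexified hY hY2 h0 h1
  obtain ⟨c, hc⟩ := sameSpace_convexified hX hX' hX2 h0 h1 hZX'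
  obtain ⟨c', hc'⟩ := sameSpace_convexified hY hY' hY2 h0 h1 hZY'
  obtain ⟨Ψ, hΨ⟩ := exists_isDifferential hZX hZX' zero_lt_half half_lt_one_real
  obtain ⟨Φ, hΦ⟩ := exists_isDifferential hZY hZY' zero_lt_half half_lt_one_real
  obtain ⟨C, hC⟩ := boundedlyEquivalent_convexified hX hY hX2 hY2 h0 h1 hΩX hΩY hΨ hΦ
  have hL := L2_isKotheNorm μ
  -- `R` is the negative of the defect for an arbitrary choice of differentials. It is homogeneous
  -- on `L₂` and bounded there, so `Ψ + R` is again a differential, while `Φ` is kept.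
  set R : L0 μ → L0 μ := fun x =>
    -(Ψ x - Φ x - ((1 - θ : ℝ) : ℂ) • (ΩX x - ΩY x)) with hR
  have fin : ∀ {M : ENormOn μ} {c : ℝ≥0} {x : L0 μ}, M x ≤ c * L2 μ x → L2 μ x < ∞ → M x < ∞ :=
    fun h hx => h.trans_lt (ENNReal.mul_lt_top ENNReal.coe_lt_top hx)
  have hRhom : ∀ (k : ℂ) x, L2 μ x < ∞ → R (k • x) = k • R x := by
    intro k x hx
    obtain ⟨d, hd⟩ := hX2
    obtain ⟨d', hd'⟩ := hY2
    have e1 := hΨ.smul hZX hZX' zero_lt_half half_lt_one_real k (fin (hc x).1 hx)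
    have e2 := hΦ.smul hZY hZY' zero_lt_half half_lt_one_real k (fin (hc' x).1 hx)
    have e3 := IsDifferential.smul hX hX' zero_lt_half half_lt_one_real hΩX k (fin (hd x).1 hx)
    have e4 := IsDifferential.smul hY hY' zero_lt_half half_lt_one_real hΩY k (fin (hd' x).1 hx)
    have sub : ∀ f g : L0 μ, k • f - k • g = k • (f - g) := fun f g => (smul_sub k f g).symm
    simp only [hR]
    rw [e1, e2, e3, e4, sub, sub, smul_comm, sub]
    exact (smul_neg k _).symm
  have hRb : ∀ x, L2 μ x < ∞ → L2 μ (R x) ≤ C * L2 μ x := fun x hx =>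
    le_mul_of_le_on_ball hL hL hRhom (fun y hy => by
      simp only [hR]
      rw [hL.neg]
      exact hC y hy) hx
  have hfin : ∀ x, interp (convexified X θ) (kotheDual (convexified X θ)) (1 / 2) x < ∞ →
      L2 μ x < ∞ := fun x hx =>
    (hc x).2.trans_lt (ENNReal.mul_lt_top ENNReal.coe_lt_top hx)
  refine ⟨fun x => Ψ x + R x, Φ, hΨ.add_bounded hZX hZX' zero_lt_half half_lt_one_real
    (C := c * (C * c)) (fun x hx => ?_) (fun k x hx => hRhom k x (hfin x hx)), hΦ, fun x => ?_⟩
  · calc _ ≤ c * L2 μ (R x) := (hc _).1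
      _ ≤ c * (C * L2 μ x) := by
          gcongr
          exact hRb x (hfin x hx)
      _ ≤ c * (C * (c * interp (convexified X θ) (kotheDual (convexified X θ)) (1 / 2) x)) := by
          gcongr
          exact (hc x).2
      _ = _ := by
          push_cast
          ring
  · simp only [hR]
    abel

/-- Both implications of the theorem are instances: a linear `T` gives equivalence, with `c • T` as
the new linear map, and `T = 0` gives bounded equivalence. -/
theorem AreBoundedlyEquivalentOn.isBoundedOn {Ω Ψ T : L0 μ → L0 μ} {c : ℂ}
    (h : AreBoundedlyEquivalentOn (L2 μ) Ω fun x => c • Ψ x)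
    (h' : IsBoundedOn (L2 μ) fun x => Ψ x - T x) :
    IsBoundedOn (L2 μ) fun x => Ω x - c • T x := by
  have hL := L2_isKotheNorm μ
  obtain ⟨C, hC⟩ := h
  obtain ⟨C', hC'⟩ := h'
  refine ⟨C + ‖c‖₊ * C', fun x hx => ?_⟩
  have e : Ω x - c • T x = (Ω x - c • Ψ x) + c • (Ψ x - T x) := by
    rw [show c • (Ψ x - T x) = c • Ψ x - c • T x from smul_sub c (Ψ x) (T x)]
    abel
  change L2 μ (Ω x - c • T x) ≤ _
  rw [e]
  refine (hL.add_le _ _).trans ?_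
  rw [hL.smul]
  push_cast
  exact add_le_add (hC x hx) (mul_le_mul' le_rfl (hC' x hx))

end Comparison

end Butterfly

theorem mainTheorem8 {α : Type*} [MeasurableSpace α] (μ : Measure α) [SigmaFinite μ]
    (X Y : Butterfly.ENormOn μ) (hX : Butterfly.IsKothe X) (hY : Butterfly.IsKothe Y)
    (hX2 : Butterfly.SameSpace
      (Butterfly.interp X (Butterfly.kotheDual X) (1 / 2)) (Butterfly.L2 μ))
    (hY2 : Butterfly.SameSpace
      (Butterfly.interp Y (Butterfly.kotheDual Y) (1 / 2)) (Butterfly.L2 μ))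
    (θ : ℝ) (hθ0 : 0 < θ) (hθ1 : θ < 1) :
    -- `X_θ` and `Y_θ` again interpolate with their duals to `L₂`
    Butterfly.SameSpace
      (Butterfly.interp (Butterfly.convexified X θ)
        (Butterfly.kotheDual (Butterfly.convexified X θ)) (1 / 2)) (Butterfly.L2 μ) ∧
    Butterfly.SameSpace
      (Butterfly.interp (Butterfly.convexified Y θ)
        (Butterfly.kotheDual (Butterfly.convexified Y θ)) (1 / 2)) (Butterfly.L2 μ) ∧
    -- the identity, exactly, for suitable choices of the differentials on the left
    (∀ ΩX ΩY : Butterfly.L0 μ → Butterfly.L0 μ,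
      Butterfly.IsOmega X ΩX → Butterfly.IsOmega Y ΩY →
      ∃ ΩXθ ΩYθ : Butterfly.L0 μ → Butterfly.L0 μ,
        Butterfly.IsOmega (Butterfly.convexified X θ) ΩXθ ∧
        Butterfly.IsOmega (Butterfly.convexified Y θ) ΩYθ ∧
        ∀ x, Butterfly.L2 μ x < ∞ →
          ΩXθ x - ΩYθ x = ((1 - θ : ℝ) : ℂ) • (ΩX x - ΩY x)) ∧
    -- for all choices of the four differentials
    (∀ ΩX ΩY ΩXθ ΩYθ : Butterfly.L0 μ → Butterfly.L0 μ,
      Butterfly.IsOmega X ΩX → Butterfly.IsOmega Y ΩY →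
      Butterfly.IsOmega (Butterfly.convexified X θ) ΩXθ →
      Butterfly.IsOmega (Butterfly.convexified Y θ) ΩYθ →
      -- the identity, up to a bounded map
      Butterfly.AreBoundedlyEquivalentOn (Butterfly.L2 μ)
        (fun x => ΩXθ x - ΩYθ x) (fun x => ((1 - θ : ℝ) : ℂ) • (ΩX x - ΩY x)) ∧
      -- the two implications
      (Butterfly.AreEquivalentOn (Butterfly.L2 μ) ΩX ΩY →
        Butterfly.AreEquivalentOn (Butterfly.L2 μ) ΩXθ ΩYθ) ∧
      (Butterfly.AreBoundedlyEquivalentOn (Butterfly.L2 μ) ΩX ΩY →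
        Butterfly.AreBoundedlyEquivalentOn (Butterfly.L2 μ) ΩXθ ΩYθ)) := by
  have hX' := Butterfly.isKothe_kotheDual hX hX2
  have hY' := Butterfly.isKothe_kotheDual hY hY2
  refine ⟨Butterfly.sameSpace_convexified hX hX' hX2 hθ0 hθ1
      (Butterfly.isKothe_kotheDual_convexified hX hX2 hθ0 hθ1),
    Butterfly.sameSpace_convexified hY hY' hY2 hθ0 hθ1
      (Butterfly.isKothe_kotheDual_convexified hY hY2 hθ0 hθ1),
    fun ΩX ΩY hΩX hΩY => ?_, fun ΩX ΩY ΩXθ ΩYθ hΩX hΩY hΩXθ hΩYθ => ?_⟩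
  · obtain ⟨ΩXθ, ΩYθ, h, h', e⟩ :=
      Butterfly.exists_isOmega_convexified_sub_eq hX hY hX2 hY2 hθ0 hθ1 hΩX hΩY
    exact ⟨ΩXθ, ΩYθ, h, h', fun x _ => e x⟩
  · have key := Butterfly.boundedlyEquivalent_convexified hX hY hX2 hY2 hθ0 hθ1 hΩX hΩY hΩXθ hΩYθ
    refine ⟨key, ?_, fun h => ?_⟩
    · rintro ⟨L, hL⟩
      exact ⟨((1 - θ : ℝ) : ℂ) • L, key.isBoundedOn (T := L) hL⟩
    · have h' : Butterfly.IsBoundedOn (Butterfly.L2 μ) fun x => ΩX x - ΩY x := h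
      have h2 := key.isBoundedOn (T := fun _ => 0) (by simpa only [sub_zero] using h')
      simp only [show ((1 - θ : ℝ) : ℂ) • (0 : Butterfly.L0 μ) = 0 from
        smul_zero (A := Butterfly.L0 μ) ((1 - θ : ℝ) : ℂ), sub_zero] at h2
      exact h2
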